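/- **Setting.** Let $(\mathcal X,\nu_{\mathcal X})$ be a measure space, $d\ge 1$, $\Theta\subseteq\mathbb R^d$, and $\{P_\theta:\theta\in\Theta\}$ a family of probability distributions on $\mathcal X$. Let $R$ be a twice differentiable function on $\Theta$, $\sigma>0$, $A\in\mathbb R^{p\times d}$ with rows $A_1,\dots,A_p$, and $b\in\mathbb R^p$. **Assumption 1 (regularity).** $\Theta$ is convex and open; each $P_\theta$ has a density $f(\cdot;\theta)>0$ with respect to $\nu_{\mathcal X}$; and for each $x$ the function $\theta\mapsto L(\theta;x)=-\log f(x;\theta)+R(\theta)$ is twice continuously differentiable on $\Theta$. Write $L(\theta;x,w)=L(\theta;x)+\sigma w^\top\theta$, and let $\hat\theta:\mathcal X\times\mathbb R^d\to\Theta$ be any measurable function (the output of a solver for minimizing $L(\theta;x,w)$ over $\theta\in\Theta$ with $A\theta\le b$). Put $\hat g(x,w)=\nabla_\theta L(\hat\theta(x,w);x,w)$. For $\theta\in\Theta$ let $\mathcal A(\theta)=\{i: A_i^\top\theta=b_i\}$, and let $U_{\mathcal A}$ be a matrix whose columns are an orthonormal basis of the orthogonal complement of $\mathrm{span}\{A_i:i\in\mathcal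 A\}$. A point $\theta\in\Theta$ is a *strict second-order stationary point* (SSOSP) for $(x,w)$ if $A\theta\le b$; there are $\lambda_i\ge0$ with $\lambda_i=0$ for $i\notin\mathcal A(\theta)$ and $\nabla_\theta L(\theta;x,w)+\sum_i\lambda_iA_i=0$; and $U_{\mathcal A(\theta)}^\top\nabla^2_\theta L(\theta;x,w)U_{\mathcal A(\theta)}\succ0$. For $\theta\in\Theta$ and $g\in\mathbb R^d$ let $\mathcal X_{\theta,g}$ be the set of $x$ such that for some $w$ the point $\theta=\hat\theta(x,w)$ is an SSOSP for $(x,w)$ and $g=\nabla_\theta L(\theta;x,w)$, and let $p_\theta(\cdot\mid\theta,g)$ be the density with respect to $\nu_{\mathcal X}$ proportional to $$f(x;\theta)\,\exp\Big\{-\frac{\|g-\nabla_\theta L(\theta;x)\|^2}{2\sigma^2/d}\Big\}\,\det\big(U_{\mathcal A(\theta)}^\top\nabla^2_\theta L(\theta;x)U_{\mathcal A(\theta)}\big)\,\mathbf 1_{x\in\mathcal X_{\theta,g}},$$ which is well defined whenever this function has a finite positive integral. **Procedure (constrained aCSS).** Fix $M\ge 0$ and a family (Markov kernel) $\tilde P_M(\cdot;x,\theta,g)$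 of distributions on $\mathcal X^M$ such that, whenever $p_\theta(\cdot\mid\theta,g)$ is well defined, $X\sim p_\theta(\cdot\mid\theta,g)$ and $(\tilde X^{(1)},\dots,\tilde X^{(M)})\mid X\sim\tilde P_M(\cdot;X,\theta,g)$ make $(X,\tilde X^{(1)},\dots,\tilde X^{(M)})$ exchangeable. (For example, $M$ i.i.d. draws from $p_\theta(\cdot\mid\theta,g)$.) Draw $X\sim P_{\theta_0}$ and, independently, $W\sim\mathcal N(0,\frac1d\mathbf I_d)$; put $\hat\theta=\hat\theta(X,W)$ and $\hat g=\hat g(X,W)$. If $\hat\theta$ is not an SSOSP for $(X,W)$, set $\tilde X^{(1)}=\dots=\tilde X^{(M)}=X$; otherwise draw $(\tilde X^{(1)},\dots,\tilde X^{(M)})\mid(X,\hat\theta,\hat g)\sim\tilde P_M(\cdot;X,\hat\theta,\hat g)$. **Assumptions 2 and 3.** Let $r,\delta,\epsilon$ be real functions on $\Theta$ with $r\ge0$. Let $H(\theta;x)=-\nabla^2_\theta\log f(x;\theta)$, $H(\theta)=\mathbb E_{\theta_0}[H(\theta;X)]$, and let $\mathbb B(\theta_0,r)$ be the closed ball. For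 every $\theta_0\in\Theta$: (2) for $(X,W)\sim P_{\theta_0}\times\mathcal N(0,\frac1d\mathbf I_d)$, with probability at least $1-\delta(\theta_0)$, $\hat\theta(X,W)$ is an SSOSP for $(X,W)$ and $\|\hat\theta(X,W)-\theta_0\|\le r(\theta_0)$; (3) $H(\theta)$ exists for all $\theta\in\mathbb B(\theta_0,r(\theta_0))\cap\Theta$, and $$\mathbb E_{\theta_0}\Big[\sup_{\theta\in\mathbb B(\theta_0,r(\theta_0))\cap\Theta}r(\theta_0)^2\big(\lambda_{\max}(H(\theta)-H(\theta;X))\big)_+\Big]\le\epsilon(\theta_0),$$ $$\log\mathbb E_{\theta_0}\Big[\exp\Big\{\sup_{\theta\in\mathbb B(\theta_0,r(\theta_0))\cap\Theta}r(\theta_0)^2\big(\lambda_{\max}(H(\theta;X)-H(\theta))\big)_+\Big\}\Big]\le\epsilon(\theta_0).$$ **Theorem.** Suppose Assumptions 1–3 hold, let $\theta_0\in\Theta$, and let $X\sim P_{\theta_0}$ and the copies $\tilde X^{(1)},\dots,\tilde X^{(M)}$ be generated by the constrained aCSS procedure. Then $$d_{\mathrm{exch}}(X,\tilde X^{(1)},\dots,\tilde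 X^{(M)})\le 3\sigma r(\theta_0)+\epsilon(\theta_0)+\delta(\theta_0),$$ where $d_{\mathrm{exch}}$ is the infimum of the total variation distances between the law of the vector and exchangeable probability distributions on $\mathcal X^{M+1}$. Moreover, for every measurable $T:\mathcal X\to\mathbb R$ and every $\alpha\in[0,1]$, the p-value $\mathrm{pval}=\frac1{M+1}\big(1+\sum_{m=1}^M\mathbf 1\{T(\tilde X^{(m)})\ge T(X)\}\big)$ satisfies $$\mathbb P(\mathrm{pval}\le\alpha)\le\alpha+3\sigma r(\theta_0)+\epsilon(\theta_0)+\delta(\theta_0).$$ -/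

import Mathlib

open MeasureTheory ProbabilityTheory
open scoped Matrix ENNReal

noncomputable section

namespace ACSS

/-! ## Linear algebra and calculus on `ℝ^d` -/

/-- The Hessian matrix of `F` at `θ` (second partial derivatives in the standard basis). -/
def hessian {d : ℕ} (F : EuclideanSpace ℝ (Fin d) → ℝ) (θ : EuclideanSpace ℝ (Fin d)) :
    Matrix (Fin d) (Fin d) ℝ :=
  Matrix.of fun i j =>
    iteratedFDeriv ℝ 2 F θ ![EuclideanSpace.single i (1 : ℝ), EuclideanSpace.single j (1 : ℝ)]

/-- The largest (real) eigenvalue of a matrix; it is only used for symmetric matrices of positive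
size, where the spectrum is finite and nonempty. -/
def lambdaMax {d : ℕ} (B : Matrix (Fin d) (Fin d) ℝ) : ℝ := sSup (spectrum ℝ B)

/-- The noise distribution `N(0, (1/d) I_d)` on `ℝ^d`. -/
def noise (d : ℕ) : Measure (EuclideanSpace ℝ (Fin d)) :=
  multivariateGaussian 0 ((1 / (d : ℝ)) • (1 : Matrix (Fin d) (Fin d) ℝ))

/-! ## Exchangeability -/

/-- A measure on `𝓧^n` is exchangeable if it is invariant under all permutations of the
coordinates. -/
def IsExchangeable {𝓧 : Type*} [MeasurableSpace 𝓧] {n : ℕ} (μ : Measure (Fin n → 𝓧)) : Prop :=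
  ∀ π : Equiv.Perm (Fin n), μ.map (fun x => x ∘ π) = μ

/-- Total variation distance (of probability measures): `sup_S |μ S - μ' S|` over measurable
sets `S`. -/
def tvDist {Y : Type*} [MeasurableSpace Y] (μ μ' : Measure Y) : ℝ :=
  ⨆ S : {S : Set Y // MeasurableSet S}, |μ.real S.1 - μ'.real S.1|

/-- Distance to exchangeability of (the law of) a random vector with `n` entries in `𝓧`: the
infimum of the total variation distances to exchangeable probability distributions. -/
def dExch {𝓧 : Type*} [MeasurableSpace 𝓧] {n : ℕ} (μ : Measure (Fin n → 𝓧)) : ℝ :=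
  ⨅ Q : {Q : Measure (Fin n → 𝓧) // IsProbabilityMeasure Q ∧ IsExchangeable Q}, tvDist μ Q.1

/-- The p-value `(1 + ∑ₘ 1{T(x̃ₘ) ≥ T(x)}) / (M + 1)`. -/
def pval {𝓧 : Type*} {M : ℕ} (T : 𝓧 → ℝ) (x : 𝓧) (xt : Fin M → 𝓧) : ℝ :=
  open Classical in
  (1 / ((M : ℝ) + 1)) * (1 + ∑ m : Fin M, if T (xt m) ≥ T x then (1 : ℝ) else 0)

/-! ## The constrained problem -/

/-- The ingredients of constrained aCSS for data in `𝓧`, a parameter in `ℝ^d` and `p` linear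
constraints `A θ ≤ b`. -/
structure Setup (𝓧 : Type*) [MeasurableSpace 𝓧] (d p : ℕ) where
  /-- the common base measure -/
  ν : Measure 𝓧
  /-- the parameter space -/
  Θ : Set (EuclideanSpace ℝ (Fin d))
  /-- the density `f θ x = f(x; θ)` of `P_θ` -/
  f : EuclideanSpace ℝ (Fin d) → 𝓧 → ℝ
  /-- the regularizer -/
  R : EuclideanSpace ℝ (Fin d) → ℝ
  /-- the size of the perturbation -/
  σ : ℝ
  /-- the constraint matrix -/
  A : Matrix (Fin p) (Fin d) ℝ
  /-- the right-hand side of the constraints -/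
  b : Fin p → ℝ
  /-- the output `θhat x w` of the solver on data `x` and noise `w` -/
  θhat : 𝓧 → EuclideanSpace ℝ (Fin d) → EuclideanSpace ℝ (Fin d)
  σ_pos : 0 < σ
  R_differentiable : DifferentiableOn ℝ R Θ
  R_twice_differentiable : DifferentiableOn ℝ (fderiv ℝ R) Θ
  θhat_measurable : Measurable fun z : 𝓧 × EuclideanSpace ℝ (Fin d) => θhat z.1 z.2
  θhat_mem : ∀ x w, θhat x w ∈ Θ

namespace Setup

variable {𝓧 : Type*} [MeasurableSpace 𝓧] {d p : ℕ} (S : Setup 𝓧 d p)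

/-- The distribution `P_θ`, with density `f(·; θ)` with respect to `ν`. -/
def P (θ : EuclideanSpace ℝ (Fin d)) : Measure 𝓧 :=
  S.ν.withDensity fun x => ENNReal.ofReal (S.f θ x)

/-- `L(θ; x) = - log f(x; θ) + R(θ)`. -/
def loss (θ : EuclideanSpace ℝ (Fin d)) (x : 𝓧) : ℝ :=
  -Real.log (S.f θ x) + S.R θ

/-- `L(θ; x, w) = - log f(x; θ) + R(θ) + σ wᵀθ`. -/
def pertLoss (θ : EuclideanSpace ℝ (Fin d)) (x : 𝓧) (w : EuclideanSpace ℝ (Fin d)) : ℝ :=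
  -Real.log (S.f θ x) + S.R θ + S.σ * inner ℝ w θ

/-- `∇_θ L(θ; x)`. -/
def gradLoss (θ : EuclideanSpace ℝ (Fin d)) (x : 𝓧) : EuclideanSpace ℝ (Fin d) :=
  gradient (fun t => S.loss t x) θ

/-- `∇_θ L(θ; x, w)`. -/
def gradPertLoss (θ : EuclideanSpace ℝ (Fin d)) (x : 𝓧) (w : EuclideanSpace ℝ (Fin d)) :
    EuclideanSpace ℝ (Fin d) :=
  gradient (fun t => S.pertLoss t x w) θ

/-- `ĝ(x, w) = ∇_θ L(θ̂(x, w); x, w)`. -/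
def ghat (x : 𝓧) (w : EuclideanSpace ℝ (Fin d)) : EuclideanSpace ℝ (Fin d) :=
  S.gradPertLoss (S.θhat x w) x w

/-- The `i`-th row `A_i` of the constraint matrix, as a vector of `ℝ^d`. -/
def row (i : Fin p) : EuclideanSpace ℝ (Fin d) := WithLp.toLp 2 (S.A i)

/-- The set of active constraints at `θ`. -/
def active (θ : EuclideanSpace ℝ (Fin d)) : Set (Fin p) :=
  {i | (S.A *ᵥ WithLp.ofLp θ) i = S.b i}

/-- The orthogonal complement of `span {A_i : i ∈ s}`. -/
def perp (s : Set (Fin p)) : Submodule ℝ (EuclideanSpace ℝ (Fin d)) :=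
  (Submodule.span ℝ (S.row '' s))ᗮ

/-- A matrix `U_s` whose columns form an orthonormal basis of the orthogonal complement of
`span {A_i : i ∈ s}`. -/
def U (s : Set (Fin p)) : Matrix (Fin d) (Fin (Module.finrank ℝ (S.perp s))) ℝ :=
  Matrix.of fun i j =>
    ((stdOrthonormalBasis ℝ (S.perp s) j : S.perp s) : EuclideanSpace ℝ (Fin d)) i

/-- `θ` is a strict second-order stationary point of the problem of minimizing `L(θ; x, w)`
over `θ ∈ Θ` subject to `A θ ≤ b`. -/
structure IsSSOSP (θ : EuclideanSpace ℝ (Fin d)) (x : 𝓧) (w : EuclideanSpace ℝ (Fin d)) :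
    Prop where
  mem : θ ∈ S.Θ
  feasible : ∀ i, (S.A *ᵥ WithLp.ofLp θ) i ≤ S.b i
  kkt : ∃ mult : Fin p → ℝ, (∀ i, 0 ≤ mult i) ∧ (∀ i, i ∉ S.active θ → mult i = 0) ∧
    S.gradPertLoss θ x w + ∑ i, mult i • S.row i = 0
  second_order :
    ((S.U (S.active θ))ᵀ * hessian (fun t => S.pertLoss t x w) θ * S.U (S.active θ)).PosDef

/-- The set `𝓧_{θ,g}` of data values that are compatible with `(θ̂, ĝ) = (θ, g)` at an SSOSP. -/
def compat (θ g : EuclideanSpace ℝ (Fin d)) : Set 𝓧 :=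
  {x | ∃ w, θ = S.θhat x w ∧ S.IsSSOSP θ x w ∧ g = S.gradPertLoss θ x w}

/-- The unnormalized plug-in conditional density
`f(x; θ) exp(-‖g - ∇L(θ; x)‖² / (2σ²/d)) det(Uᵀ ∇²L(θ; x) U) 1{x ∈ 𝓧_{θ,g}}`,
where `U = U_{𝒜(θ)}`. -/
def unDensity (θ g : EuclideanSpace ℝ (Fin d)) (x : 𝓧) : ℝ :=
  open Classical in
  S.f θ x * Real.exp (-(‖g - S.gradLoss θ x‖ ^ 2 / (2 * S.σ ^ 2 / (d : ℝ)))) *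
    ((S.U (S.active θ))ᵀ * hessian (fun t => S.loss t x) θ * S.U (S.active θ)).det *
    (if x ∈ S.compat θ g then 1 else 0)

/-- The normalizing constant of `unDensity`. -/
def normConst (θ g : EuclideanSpace ℝ (Fin d)) : ℝ≥0∞ :=
  ∫⁻ x, ENNReal.ofReal (S.unDensity θ g x) ∂S.ν

/-- The plug-in conditional distribution `p_θ(· ∣ θ, g)`; it is meaningful (a probability
measure) when the normalizing constant is neither `0` nor `∞`. -/
def condLaw (θ g : EuclideanSpace ℝ (Fin d)) : Measure 𝓧 :=
  (S.normConst θ g)⁻¹ • S.ν.withDensity fun x => ENNReal.ofReal (S.unDensity θ g x)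

/-- The requirement on the sampling mechanism `P̃_M(·; x, θ, g)`: for all `(θ, g)` for which
`p_θ(· ∣ θ, g)` is well defined, if `X ∼ p_θ(· ∣ θ, g)` and the copies are drawn from
`P̃_M(·; X, θ, g)`, then `(X, copies)` is exchangeable. -/
def IsValidSampler {M : ℕ}
    (Pt : Kernel (𝓧 × EuclideanSpace ℝ (Fin d) × EuclideanSpace ℝ (Fin d)) (Fin M → 𝓧)) : Prop :=
  ∀ θ ∈ S.Θ, ∀ g : EuclideanSpace ℝ (Fin d), S.normConst θ g ≠ 0 → S.normConst θ g ≠ ∞ →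
    IsExchangeable
      ((S.condLaw θ g ⊗ₘ Pt.comap (fun x => (x, θ, g)) (by fun_prop)).map
        fun z => (Fin.cons z.1 z.2 : Fin (M + 1) → 𝓧))

/-- `(X, W, X̃)` is produced by the constrained aCSS procedure when the true parameter is `θ₀`. -/
structure IsRun {M : ℕ}
    (Pt : Kernel (𝓧 × EuclideanSpace ℝ (Fin d) × EuclideanSpace ℝ (Fin d)) (Fin M → 𝓧))
    (θ₀ : EuclideanSpace ℝ (Fin d)) {Ω : Type*} [MeasurableSpace Ω] (μ : Measure Ω)
    (X : Ω → 𝓧) (W : Ω → EuclideanSpace ℝ (Fin d)) (Xt : Ω → Fin M → 𝓧) : Prop where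
  measurable_data : Measurable X
  measurable_noise : Measurable W
  measurable_copies : Measurable Xt
  /-- `X ∼ P_{θ₀}`, and `W ∼ N(0, (1/d) I_d)` is independent of `X`. -/
  law_data_noise : μ.map (fun ω => (X ω, W ω)) = (S.P θ₀).prod (noise d)
  /-- If the solver does not return an SSOSP, then all copies equal `X`. -/
  copies_of_not_SSOSP : ∀ᵐ ω ∂μ, ¬ S.IsSSOSP (S.θhat (X ω) (W ω)) (X ω) (W ω) →
    ∀ m, Xt ω m = X ω
  /-- On the event that it does, the copies are drawn from `P̃_M(·; X, θ̂, ĝ)` conditionally on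
  `(X, θ̂, ĝ)`. -/
  copies_of_SSOSP :
    (μ.restrict {ω | S.IsSSOSP (S.θhat (X ω) (W ω)) (X ω) (W ω)}).map
        (fun ω => ((X ω, S.θhat (X ω) (W ω), S.ghat (X ω) (W ω)), Xt ω)) =
      (μ.restrict {ω | S.IsSSOSP (S.θhat (X ω) (W ω)) (X ω) (W ω)}).map
        (fun ω => (X ω, S.θhat (X ω) (W ω), S.ghat (X ω) (W ω))) ⊗ₘ Pt

/-! ## The assumptions -/

/-- Regularity of the family of distributions and of the regularizer. -/
structure Regularity : Prop where
  convex : Convex ℝ S.Θ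
  isOpen : IsOpen S.Θ
  measurable_density : ∀ θ ∈ S.Θ, Measurable (S.f θ)
  density_pos : ∀ θ ∈ S.Θ, ∀ x, 0 < S.f θ x
  isProbabilityMeasure : ∀ θ ∈ S.Θ, IsProbabilityMeasure (S.P θ)
  contDiff_loss : ∀ x, ContDiffOn ℝ 2 (fun θ => S.loss θ x) S.Θ

/-- For each true parameter `θ₀`, with probability at least `1 - δ(θ₀)` the solver returns an
SSOSP within distance `r(θ₀)` of `θ₀`. -/
def Accuracy (r δ : EuclideanSpace ℝ (Fin d) → ℝ) : Prop :=
  ∀ θ₀ ∈ S.Θ, 1 - δ θ₀ ≤ ((S.P θ₀).prod (noise d)).real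
    {z | S.IsSSOSP (S.θhat z.1 z.2) z.1 z.2 ∧ ‖S.θhat z.1 z.2 - θ₀‖ ≤ r θ₀}

/-- `H(θ; x) = - ∇²_θ log f(x; θ)`. -/
def negHess (θ : EuclideanSpace ℝ (Fin d)) (x : 𝓧) : Matrix (Fin d) (Fin d) ℝ :=
  hessian (fun t => -Real.log (S.f t x)) θ

/-- `H(θ) = 𝔼_{θ₀}[H(θ; X)]` (entrywise). -/
def meanNegHess (θ₀ θ : EuclideanSpace ℝ (Fin d)) : Matrix (Fin d) (Fin d) ℝ :=
  Matrix.of fun i j => ∫ x, S.negHess θ x i j ∂S.P θ₀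

/-- Concentration of the Hessian of the negative log-likelihood around its mean, uniformly over
the closed ball of radius `r(θ₀)` around the true parameter `θ₀` (intersected with `Θ`), controlled
by `ε(θ₀)`. -/
structure HessianConcentration (r ε : EuclideanSpace ℝ (Fin d) → ℝ) : Prop where
  integrable : ∀ θ₀ ∈ S.Θ, ∀ θ ∈ Metric.closedBall θ₀ (r θ₀) ∩ S.Θ, ∀ i j,
    Integrable (fun x => S.negHess θ x i j) (S.P θ₀)
  lower : ∀ θ₀ ∈ S.Θ,
    ∫⁻ x, ⨆ θ ∈ Metric.closedBall θ₀ (r θ₀) ∩ S.Θ,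
        ENNReal.ofReal (r θ₀ ^ 2 * max (lambdaMax (S.meanNegHess θ₀ θ - S.negHess θ x)) 0)
      ∂S.P θ₀ ≤ ENNReal.ofReal (ε θ₀)
  upper : ∀ θ₀ ∈ S.Θ,
    ENNReal.log (∫⁻ x, EReal.exp (((⨆ θ ∈ Metric.closedBall θ₀ (r θ₀) ∩ S.Θ,
        ENNReal.ofReal (r θ₀ ^ 2 * max (lambdaMax (S.negHess θ x - S.meanNegHess θ₀ θ)) 0) :
          ℝ≥0∞) : EReal)) ∂S.P θ₀) ≤ (ε θ₀ : EReal)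

end Setup

end ACSS

end

/-! Let κ(x, θ, g) be the density of (θ̂, ĝ) at (θ, g) given X = x, on the event of an SSOSP. It
does not involve θ₀, so given (θ̂, ĝ) = (θ, g) the data have density proportional to f(x; θ₀) κ,
while the sampler works with f(x; θ) κ. Data drawn from this plug-in law would be exchangeable with
the copies. The distance to exchangeability is therefore at most the cost of replacing θ₀ by θ, plus
δ for the event that the solver fails or ends farther than r from θ₀.

The kernel: for a fixed active set, the KKT condition puts ĝ in the span of the active rows, so (θ,
g) is coded by the single vector y = Pθ + g of ℝ^d, with P the projection onto the complement of
that span. The noise w = σ⁻¹(g - ∇L(θ; x)) is a function of y, and Sylvester's determinant identity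
gives its Jacobian as σ⁻ᵈ |det(Uᵀ∇²L U)|, which is where the determinant in the plug-in density
comes from (`abs_det_noiseOf_param`, `setLIntegral_noise_eq`, `density₀_mul_kernelDensity`).

The replacement: expand L(·; x') - L(·; x) at θ. Both data values share the same g, so the gradients
differ by σ(w - w'); the Hessians are compared through their mean. Hence f(x'; θ) f(x; θ₀) ≤ f(x';
θ₀) A(x') f(x; θ) exp(b(x)), with A = exp(σr‖w'‖ + Fu(x')/2) and b = σr‖w‖ + Fl(x)/2
(`density_mul_le`). Integrating over x' bounds the logarithm of the ratio ρ of the normalized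
densities, and 1 - 1/ρ ≤ log ρ turns this into a bound on probabilities (`setLIntegral_le_plugIn`).

The constants: the claim is trivial unless σr < 1/3, and then E[b] and log E[A] are both at most
(5/4)σr + ε/2. Their sum is at most 3σr + ε. The p-value bound follows because rank p-values are
valid under the nearby exchangeable law. -/

noncomputable section

namespace ACSS

/-! ### Exchangeability, total variation and rank p-values -/

section Exchangeability

variable {Y : Type*} [MeasurableSpace Y]

/-- The reverse inequality for a set is the given one for its complement, so only upper bounds have
to be proved later. -/
theorem tvDist_le_of_forall_le {μ Q : Measure Y} [IsProbabilityMeasure μ] [IsProbabilityMeasure Q]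
    {B : ℝ} (h : ∀ S, MeasurableSet S → μ.real S ≤ Q.real S + B) : tvDist μ Q ≤ B := by
  have : Nonempty {S : Set Y // MeasurableSet S} := ⟨⟨∅, MeasurableSet.empty⟩⟩
  refine ciSup_le fun S => ?_
  have h1 := h S.1 S.2
  have h2 := h S.1ᶜ S.2.compl
  rw [probReal_compl_eq_one_sub S.2, probReal_compl_eq_one_sub S.2] at h2
  exact abs_le.2 ⟨by linarith, by linarith⟩

theorem tvDist_nonneg (μ Q : Measure Y) : 0 ≤ tvDist μ Q :=
  Real.iSup_nonneg fun _ => abs_nonneg _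

theorem dExch_le_tvDist {n : ℕ} (μ : Measure (Fin n → Y)) {Q : Measure (Fin n → Y)}
    (hQ : IsProbabilityMeasure Q) (hQe : IsExchangeable Q) : dExch μ ≤ tvDist μ Q :=
  ciInf_le (f := fun Q : {Q : Measure (Fin n → Y) // IsProbabilityMeasure Q ∧ IsExchangeable Q} =>
    tvDist μ Q.1) ⟨0, by rintro _ ⟨Q, rfl⟩; exact tvDist_nonneg _ _⟩ ⟨Q, hQ, hQe⟩

/-- Among `n` real numbers, at most `k` have at most `k` numbers at or above them. -/
theorem card_filter_card_le {n : ℕ} (t : Fin n → ℝ) (k : ℝ) (hk : 0 ≤ k) :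
    ((Finset.univ.filter fun i => ((Finset.univ.filter fun j => t i ≤ t j).card : ℝ) ≤ k).card : ℝ)
      ≤ k := by
  set s := Finset.univ.filter fun i => ((Finset.univ.filter fun j => t i ≤ t j).card : ℝ) ≤ k
  rcases s.eq_empty_or_nonempty with hs | hs
  · simpa [hs] using hk
  -- All members of `s` lie at or above the smallest one, which itself has at most `k` numbers at or
  -- above it.
  · obtain ⟨i, hi, hmin⟩ := s.exists_min_image t hs
    refine le_trans ?_ (Finset.mem_filter.1 hi).2
    exact_mod_cast Finset.card_le_card fun j hj => by simpa using hmin j hj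

theorem IsExchangeable.add {n : ℕ} {μ ρ : Measure (Fin n → Y)} (hμ : IsExchangeable μ)
    (hρ : IsExchangeable ρ) : IsExchangeable (μ + ρ) := fun π => by
  rw [Measure.map_add _ _ (by fun_prop), hμ π, hρ π]

/-- The law of a vector with identical entries is exchangeable. -/
theorem isExchangeable_map_const {Ω : Type*} [MeasurableSpace Ω] {n : ℕ} (μ : Measure Ω)
    {X : Ω → Y} (hX : Measurable X) :
    IsExchangeable (μ.map fun ω => (fun _ => X ω : Fin n → Y)) := fun π => by
  rw [Measure.map_map (by fun_prop) (by fun_prop)]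
  rfl

/-- Validity of the rank p-value under exchangeability. -/
theorem IsExchangeable.pval_le {M : ℕ} {Q : Measure (Fin (M + 1) → Y)} [IsProbabilityMeasure Q]
    (hQ : IsExchangeable Q) {T : Y → ℝ} (hT : Measurable T) {α : ℝ} (hα : 0 ≤ α) :
    MeasurableSet {x : Fin (M + 1) → Y | pval T (x 0) (fun m => x m.succ) ≤ α} ∧
    Q.real {x | pval T (x 0) (fun m => x m.succ) ≤ α} ≤ α := by
  classical
  set k : ℝ := α * (M + 1)
  let R : Fin (M + 1) → (Fin (M + 1) → Y) → ℝ := fun i x =>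
    ((Finset.univ.filter fun j => T (x i) ≤ T (x j)).card : ℝ)
  have hR : ∀ i, Measurable (R i) := fun i => by
    have : R i = fun x => ∑ j, if T (x i) ≤ T (x j) then (1 : ℝ) else 0 := by
      ext x; simp [R]
    rw [this]
    exact Finset.measurable_sum _ fun j _ => Measurable.ite
      (measurableSet_le (by fun_prop) (by fun_prop)) measurable_const measurable_const
  have hset : {x : Fin (M + 1) → Y | pval T (x 0) (fun m => x m.succ) ≤ α} = {x | R 0 x ≤ k} := by
    ext x
    have : R 0 x = 1 + ∑ m : Fin M, if T (x m.succ) ≥ T (x 0) then (1 : ℝ) else 0 := by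
      simp only [R, Finset.card_filter]
      push_cast
      rw [Fin.sum_univ_succ]
      simp
    simp only [Set.mem_ofPred_eq, pval, this, k]
    rw [one_div, inv_mul_le_iff₀ (by positivity), mul_comm α]
  have hmeas : ∀ i, MeasurableSet {x | R i x ≤ k} := fun i =>
    measurableSet_le (hR i) measurable_const
  refine ⟨hset ▸ hmeas 0, ?_⟩
  rw [hset]
  -- Swapping coordinates `0` and `i` preserves `Q` and carries one rank event to the other.
  have hsymm : ∀ i, Q.real {x | R i x ≤ k} = Q.real {x | R 0 x ≤ k} := fun i => by
    have h1 := hQ (Equiv.swap 0 i)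
    conv_rhs => rw [← h1]
    rw [Measure.real, Measure.real, Measure.map_apply (by fun_prop) (hmeas 0)]
    congr 2
    ext x
    have : R 0 (x ∘ Equiv.swap 0 i) = R i x := by
      simp only [R, Function.comp, Equiv.swap_apply_left]
      congr 1
      refine Finset.card_bij (fun j _ => Equiv.swap 0 i j) (by simp) (by simp) fun j hj => ?_
      exact ⟨Equiv.swap 0 i j, by simpa using hj, by simp⟩
    simp [this]
  have hint : ∀ i, Integrable ({x | R i x ≤ k}.indicator fun _ => (1 : ℝ)) Q := fun i =>
    (integrable_const _).indicator (hmeas i)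
  -- The sum is the expected number of entries of rank at most `k`, and that number never exceeds
  -- `k`.
  have h1 : ∑ i, Q.real {x | R i x ≤ k} ≤ k := by
    have : ∑ i, Q.real {x | R i x ≤ k} =
        ∫ x, ∑ i, {x | R i x ≤ k}.indicator (fun _ => (1 : ℝ)) x ∂Q := by
      rw [integral_finsetSum _ fun i _ => hint i]
      refine Finset.sum_congr rfl fun i _ => ?_
      rw [integral_indicator (hmeas i)]; simp
    rw [this]
    calc _ ≤ ∫ _, k ∂Q := by
          refine integral_mono (integrable_finsetSum _ fun i _ => hint i) (integrable_const _)
            fun x => ?_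
          have := card_filter_card_le (fun i => T (x i)) k (by positivity)
          simpa [Set.indicator_apply, R] using this
      _ = k := by simp
  simp only [hsymm, Finset.sum_const, Finset.card_univ, Fintype.card_fin, nsmul_eq_mul] at h1
  push_cast at h1
  have : (0 : ℝ) < M + 1 := by positivity
  simp only [k] at h1
  nlinarith

end Exchangeability

/-! ### Exponential moments of the Gaussian noise -/

section Noise

/-- The density of `noise d`. -/
def noisePDF (d : ℕ) (w : EuclideanSpace ℝ (Fin d)) : ℝ :=
  (2 * Real.pi / d) ^ (-(d / 2 : ℝ)) * Real.exp (-(d / 2 : ℝ) * ‖w‖ ^ 2)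

theorem noisePDF_pos {d : ℕ} (hd : 1 ≤ d) (w : EuclideanSpace ℝ (Fin d)) : 0 < noisePDF d w := by
  have : (0 : ℝ) < d := by exact_mod_cast hd
  unfold noisePDF
  positivity

theorem continuous_noisePDF (d : ℕ) : Continuous (noisePDF d) := by
  unfold noisePDF
  fun_prop

theorem posSemidef_noise_cov (d : ℕ) :
    ((1 / (d : ℝ)) • (1 : Matrix (Fin d) (Fin d) ℝ)).PosSemidef :=
  Matrix.PosSemidef.one.smul (by positivity)

theorem integrable_exp_neg_mul_sq_norm (d : ℕ) {b : ℝ} (hb : 0 < b) :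
    Integrable fun v : EuclideanSpace ℝ (Fin d) => Real.exp (-b * ‖v‖ ^ 2) := by
  -- A non-integrable function has integral `0` by convention, whereas the Gaussian integral is
  -- positive.
  by_contra h
  have h1 := GaussianFourier.integral_rexp_neg_mul_sq_norm (V := EuclideanSpace ℝ (Fin d)) hb
  rw [integral_undef h] at h1
  have : (0 : ℝ) < (Real.pi / b) ^ (Module.finrank ℝ (EuclideanSpace ℝ (Fin d)) / 2 : ℝ) := by
    positivity
  linarith

/-- Both sides are finite measures with the characteristic function exp(-‖t‖²/(2d)). -/
theorem noise_eq_withDensity {d : ℕ} (hd : 1 ≤ d) :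
    noise d = volume.withDensity fun w => ENNReal.ofReal (noisePDF d w) := by
  have hd0 : (0 : ℝ) < d := by exact_mod_cast hd
  have hd0' : (d : ℂ) ≠ 0 := by exact_mod_cast hd0.ne'
  have hfin : IsFiniteMeasure
      (volume.withDensity fun w : EuclideanSpace ℝ (Fin d) => ENNReal.ofReal (noisePDF d w)) := by
    refine isFiniteMeasure_withDensity_ofReal ?_
    exact ((integrable_exp_neg_mul_sq_norm d (by positivity : (0 : ℝ) < d / 2)).const_mul _).2
  have : IsProbabilityMeasure (noise d) := by unfold noise; infer_instance
  refine Measure.ext_of_charFun ?_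
  ext t
  rw [noise, charFun_multivariateGaussian (posSemidef_noise_cov d), charFun_apply,
    integral_withDensity_eq_integral_toReal_smul
      ((continuous_noisePDF d).measurable.ennreal_ofReal) (by simp)]
  have key := GaussianFourier.integral_cexp_neg_mul_sq_norm_add (V := EuclideanSpace ℝ (Fin d))
    (b := (d / 2 : ℂ)) (by simpa using hd0) Complex.I t
  have h2 : ∀ w : EuclideanSpace ℝ (Fin d),
      (ENNReal.ofReal (noisePDF d w)).toReal • Complex.exp (inner ℝ w t * Complex.I) =
      (((2 * Real.pi / d) ^ (-(d / 2 : ℝ)) : ℝ) : ℂ) *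
        Complex.exp (-(d / 2 : ℂ) * ‖w‖ ^ 2 + Complex.I * inner ℝ t w) := fun w => by
    rw [ENNReal.toReal_ofReal (noisePDF_pos hd w).le, noisePDF, Complex.real_smul, Complex.exp_add,
      real_inner_comm]
    push_cast
    rw [mul_assoc]
    congr 3
    rw [mul_comm]
  simp only [h2]
  rw [integral_const_mul, key, ← mul_assoc]
  have h3 : (((2 * Real.pi / d) ^ (-(d / 2 : ℝ)) : ℝ) : ℂ) *
      (Real.pi / (d / 2 : ℂ)) ^ (Module.finrank ℝ (EuclideanSpace ℝ (Fin d)) / 2 : ℂ) = 1 := by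
    have : (Real.pi / (d / 2 : ℂ)) ^ (Module.finrank ℝ (EuclideanSpace ℝ (Fin d)) / 2 : ℂ) =
        (((2 * Real.pi / d) ^ (d / 2 : ℝ) : ℝ) : ℂ) := by
      rw [Complex.ofReal_cpow (by positivity)]
      simp only [finrank_euclideanSpace, Fintype.card_fin]
      push_cast
      congr 1
      field_simp
    rw [this, ← Complex.ofReal_mul, ← Real.rpow_add (by positivity)]
    simp
  rw [h3, one_mul]
  congr 1
  have h4 : (t.ofLp ⬝ᵥ ((1 / (d : ℝ)) • (1 : Matrix (Fin d) (Fin d) ℝ)) *ᵥ t.ofLp) =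
      ‖t‖ ^ 2 / d := by
    rw [Matrix.smul_mulVec, Matrix.one_mulVec, dotProduct_smul, EuclideanSpace.real_norm_sq_eq]
    simp [dotProduct, pow_two]
    ring
  rw [h4]
  push_cast
  simp
  field_simp
  ring

instance isProbabilityMeasure_noise (d : ℕ) : IsProbabilityMeasure (noise d) := by
  unfold noise; infer_instance

/-- The integral equals (d/(d - t))^(d/2), whose logarithm is at most (t/2) · d/(d - t) by log u ≤ u
- 1. Since t ≤ 1/3 ≤ d/3, the last quotient is at most 3/2. -/
theorem lintegral_exp_sq_norm_noise_le {d : ℕ} (hd : 1 ≤ d) {t : ℝ} (ht : 0 ≤ t) (ht' : t ≤ 1 / 3) :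
    ∫⁻ w, ENNReal.ofReal (Real.exp (t / 2 * ‖w‖ ^ 2)) ∂noise d ≤
      ENNReal.ofReal (Real.exp (3 / 4 * t)) := by
  have hd1 : (1 : ℝ) ≤ d := by exact_mod_cast hd
  have hb : (0 : ℝ) < (d - t) / 2 := by linarith
  rw [noise_eq_withDensity hd, lintegral_withDensity_eq_lintegral_mul _
    ((continuous_noisePDF d).measurable.ennreal_ofReal) (by fun_prop)]
  have h1 : ∀ w : EuclideanSpace ℝ (Fin d),
      ((fun w : EuclideanSpace ℝ (Fin d) => ENNReal.ofReal (noisePDF d w)) *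
        fun w : EuclideanSpace ℝ (Fin d) => ENNReal.ofReal (Real.exp (t / 2 * ‖w‖ ^ 2))) w =
      ENNReal.ofReal ((2 * Real.pi / d) ^ (-(d / 2 : ℝ)) *
        Real.exp (-((d - t) / 2) * ‖w‖ ^ 2)) := fun w => by
    rw [Pi.mul_apply, ← ENNReal.ofReal_mul (noisePDF_pos hd w).le, noisePDF, mul_assoc,
      ← Real.exp_add]
    ring_nf
  simp only [h1]
  rw [← ofReal_integral_eq_lintegral_ofReal
    ((integrable_exp_neg_mul_sq_norm d hb).const_mul _)
    (Filter.Eventually.of_forall fun w => by positivity), integral_const_mul,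
    GaussianFourier.integral_rexp_neg_mul_sq_norm hb]
  refine ENNReal.ofReal_le_ofReal ?_
  have h2 : (0 : ℝ) < d - t := by linarith
  have hd0 : (0 : ℝ) < d := by linarith
  simp only [finrank_euclideanSpace, Fintype.card_fin]
  have h3 : (2 * Real.pi / d) ^ (-(d / 2 : ℝ)) * (Real.pi / ((d - t) / 2)) ^ (d / 2 : ℝ) =
      (d / (d - t)) ^ (d / 2 : ℝ) := by
    rw [Real.rpow_neg (by positivity), ← Real.inv_rpow (by positivity),
      ← Real.mul_rpow (by positivity) (by positivity)]
    congr 1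
    field_simp
  rw [h3, Real.rpow_def_of_pos (by positivity)]
  refine Real.exp_le_exp.2 ?_
  have h4 : Real.log (d / (d - t)) ≤ d / (d - t) - 1 := Real.log_le_sub_one_of_pos (by positivity)
  have h5 : d / (d - t) - 1 = t / (d - t) := by field_simp; ring
  rw [h5] at h4
  calc Real.log (d / (d - t)) * (d / 2) ≤ t / (d - t) * (d / 2) := by gcongr
    _ ≤ 3 / 4 * t := by
      rw [div_mul_eq_mul_div, div_le_iff₀ h2]
      nlinarith [mul_nonneg ht (by linarith : (0 : ℝ) ≤ d - 3 * t)]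

/-- From 2‖w‖ ≤ 1 + ‖w‖²; the constant is 5/4 = 1/2 + 3/4. -/
theorem lintegral_exp_norm_noise_le {d : ℕ} (hd : 1 ≤ d) {t : ℝ} (ht : 0 ≤ t) (ht' : t ≤ 1 / 3) :
    ∫⁻ w, ENNReal.ofReal (Real.exp (t * ‖w‖)) ∂noise d ≤
      ENNReal.ofReal (Real.exp (5 / 4 * t)) := by
  calc _ ≤ ∫⁻ w, ENNReal.ofReal (Real.exp (t / 2)) *
        ENNReal.ofReal (Real.exp (t / 2 * ‖w‖ ^ 2)) ∂noise d := by
        refine lintegral_mono fun w => ?_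
        dsimp only
        rw [← ENNReal.ofReal_mul (by positivity), ← Real.exp_add]
        gcongr
        nlinarith [mul_nonneg ht (sq_nonneg (‖w‖ - 1))]
    _ ≤ ENNReal.ofReal (Real.exp (t / 2)) * ENNReal.ofReal (Real.exp (3 / 4 * t)) := by
        rw [lintegral_const_mul _ (by fun_prop)]
        gcongr
        exact lintegral_exp_sq_norm_noise_le hd ht ht'
    _ = _ := by
        rw [← ENNReal.ofReal_mul (by positivity), ← Real.exp_add]
        ring_nf

/-- The mean is controlled by the cumulant generating function. -/
theorem lintegral_le_of_lintegral_exp_le {Ω : Type*} [MeasurableSpace Ω] {μ : Measure Ω}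
    [IsProbabilityMeasure μ] {Y : Ω → ℝ} (hY : Measurable Y) (hY0 : ∀ ω, 0 ≤ Y ω) {m : ℝ}
    (hm : 0 ≤ m)
    (h : ∫⁻ ω, ENNReal.ofReal (Real.exp (Y ω)) ∂μ ≤ ENNReal.ofReal (Real.exp m)) :
    ∫⁻ ω, ENNReal.ofReal (Y ω) ∂μ ≤ ENNReal.ofReal m := by
  have h1 : ∫⁻ ω, ENNReal.ofReal (Y ω) ∂μ + 1 ≤ ENNReal.ofReal m + 1 := by
    calc _ = ∫⁻ ω, (ENNReal.ofReal (Y ω) + 1) ∂μ := by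
          rw [lintegral_add_right _ measurable_const]; simp
      _ ≤ ∫⁻ ω, (ENNReal.ofReal m +
            ENNReal.ofReal (Real.exp (-m)) * ENNReal.ofReal (Real.exp (Y ω))) ∂μ := by
          refine lintegral_mono fun ω => ?_
          dsimp only
          rw [← ENNReal.ofReal_mul (by positivity), ← Real.exp_add, ← ENNReal.ofReal_one,
            ← ENNReal.ofReal_add (hY0 ω) zero_le_one, ← ENNReal.ofReal_add hm (by positivity)]
          refine ENNReal.ofReal_le_ofReal ?_
          -- Jensen's inequality in tangent form: Y + 1 ≤ m + exp(Y - m).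
          have := Real.add_one_le_exp (-m + Y ω)
          linarith
      _ ≤ ENNReal.ofReal m + ENNReal.ofReal (Real.exp (-m)) * ENNReal.ofReal (Real.exp m) := by
          rw [lintegral_add_left measurable_const, lintegral_const_mul _ (by fun_prop)]
          simp only [lintegral_const, measure_univ, mul_one]
          gcongr
      _ = _ := by rw [← ENNReal.ofReal_mul (by positivity), ← Real.exp_add]; simp
  exact (ENNReal.add_le_add_iff_right (by simp)).1 h1

theorem lintegral_norm_noise_le {d : ℕ} (hd : 1 ≤ d) {t : ℝ} (ht : 0 ≤ t) (ht' : t ≤ 1 / 3) :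
    ∫⁻ w, ENNReal.ofReal (t * ‖w‖) ∂noise d ≤ ENNReal.ofReal (5 / 4 * t) :=
  lintegral_le_of_lintegral_exp_le (by fun_prop) (fun w => by positivity) (by positivity)
    (lintegral_exp_norm_noise_le hd ht ht')

end Noise

/-! ### Replacing the true density by the plug-in density -/

section PlugIn

variable {𝓧 𝓨 : Type*} [MeasurableSpace 𝓧] [MeasurableSpace 𝓨]

/-- If `N u ≤ v e^b Z`, then `c⁻¹ u` exceeds `N⁻¹ v` by at most `c⁻¹ u` times an upper bound of
`b + log (Z / c)`. -/
theorem density_le_plugIn {u v c N Z b K : ℝ} (hu : 0 < u) (hv : 0 < v) (hc : 0 < c) (hN : 0 < N)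
    (hZ : c ≤ Z) (hK : 0 < K) (h : N * u ≤ v * Real.exp b * Z) :
    u ≤ v * (c / N) + u * (b + (Real.log K + (Z / (c * K) - 1))) := by
  have hZ0 : 0 < Z := hc.trans_le hZ
  have h1 : Real.log (N * u / (c * v)) ≤ b + Real.log (Z / c) := by
    rw [Real.log_le_iff_le_exp (by positivity), Real.exp_add, Real.exp_log (by positivity),
      div_le_iff₀ (by positivity)]
    calc N * u ≤ v * Real.exp b * Z := h
      _ = _ := by field_simp
  -- The tangent to the logarithm at `K` is affine in `Z / c`, so that integration against `c` needs
  -- only the integrals of `Z` and `c`.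
  have h2 : Real.log (Z / c) ≤ Real.log K + (Z / (c * K) - 1) := by
    have h3 : Z / c = K * (Z / (c * K)) := by field_simp
    rw [h3, Real.log_mul (by positivity) (by positivity)]
    gcongr
    exact Real.log_le_sub_one_of_pos (by positivity)
  -- With ρ = Nu/(cv) one has u - v(c/N) = u(1 - 1/ρ) ≤ u log ρ.
  have h4 := Real.one_sub_inv_le_log_of_pos (show 0 < N * u / (c * v) by positivity)
  have h5 : v * (c / N) = u * (N * u / (c * v))⁻¹ := by field_simp
  rw [h5, ← mul_add]
  nlinarith

/-- The plug-in density (with the marginal of `𝓨` kept) is close to the true density: densities are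
taken with respect to `ν.prod lam`, `κ` is the conditional density of `y` given `x`, and the true
and the plug-in densities of `x` are `f₀ x` and `f₁ x y`. -/
theorem setLIntegral_le_plugIn {ν : Measure 𝓧} {lam : Measure 𝓨} [SFinite ν] [SFinite lam]
    {f₀ : 𝓧 → ℝ≥0∞} {f₁ κ A b : 𝓧 × 𝓨 → ℝ≥0∞}
    (hf₀ : Measurable f₀) (hf₁ : Measurable f₁) (hκ : Measurable κ) (hA : Measurable A)
    (hb : Measurable b) (hf₀0 : ∀ x, f₀ x ≠ 0) (hf₀t : ∀ x, f₀ x ≠ ∞)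
    (hA1 : ∀ q, 1 ≤ A q) {G : Set 𝓨} (hG : MeasurableSet G)
    (hf₁0 : ∀ x, ∀ y ∈ G, f₁ (x, y) ≠ 0) (hf₁t : ∀ x, ∀ y ∈ G, f₁ (x, y) ≠ ∞)
    (hc0 : ∀ y ∈ G, ∫⁻ x, f₀ x * κ (x, y) ∂ν ≠ 0)
    (hct : ∀ y ∈ G, ∫⁻ x, f₀ x * κ (x, y) ∂ν ≠ ∞)
    (hN0 : ∀ y ∈ G, ∫⁻ x, f₁ (x, y) * κ (x, y) ∂ν ≠ 0)
    (hNt : ∀ y ∈ G, ∫⁻ x, f₁ (x, y) * κ (x, y) ∂ν ≠ ∞)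
    (hZt : ∀ y ∈ G, ∫⁻ x, f₀ x * κ (x, y) * A (x, y) ∂ν ≠ ∞)
    (hpair : ∀ x x', ∀ y ∈ G, b (x, y) ≠ ∞ → f₁ (x', y) * f₀ x ≤
      f₀ x' * A (x', y) * (f₁ (x, y) * ENNReal.ofReal (Real.exp (b (x, y)).toReal)))
    {B : ℝ≥0∞} {K : ℝ} (hK : 1 ≤ K)
    (hB : ∫⁻ y in G, ∫⁻ x, f₀ x * κ (x, y) * b (x, y) ∂ν ∂lam ≤ B)
    (hπ : ∫⁻ y in G, ∫⁻ x, f₀ x * κ (x, y) ∂ν ∂lam ≤ 1)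
    (hAK : ∫⁻ y in G, ∫⁻ x, f₀ x * κ (x, y) * A (x, y) ∂ν ∂lam + 1 ≤
      ENNReal.ofReal K + ∫⁻ y in G, ∫⁻ x, f₀ x * κ (x, y) ∂ν ∂lam)
    {h : 𝓧 × 𝓨 → ℝ≥0∞} (hh : Measurable h) (hh1 : ∀ q, h q ≤ 1) :
    ∫⁻ y in G, ∫⁻ x, f₀ x * κ (x, y) * h (x, y) ∂ν ∂lam ≤
      (∫⁻ y in G, ∫⁻ x, f₁ (x, y) * κ (x, y) *
        ((∫⁻ x, f₀ x * κ (x, y) ∂ν) / (∫⁻ x, f₁ (x, y) * κ (x, y) ∂ν)) * h (x, y) ∂ν ∂lam) +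
      (B + ENNReal.ofReal (Real.log K)) := by
  have hK0 : 0 < K := by linarith
  have hlogK : 0 ≤ Real.log K := Real.log_nonneg hK
  set c : 𝓨 → ℝ≥0∞ := fun y => ∫⁻ x, f₀ x * κ (x, y) ∂ν with hcdef
  set N : 𝓨 → ℝ≥0∞ := fun y => ∫⁻ x, f₁ (x, y) * κ (x, y) ∂ν with hNdef
  set Z : 𝓨 → ℝ≥0∞ := fun y => ∫⁻ x, f₀ x * κ (x, y) * A (x, y) ∂ν with hZdef
  replace hc0 : ∀ y ∈ G, c y ≠ 0 := hc0
  replace hct : ∀ y ∈ G, c y ≠ ∞ := hct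
  replace hN0 : ∀ y ∈ G, N y ≠ 0 := hN0
  replace hNt : ∀ y ∈ G, N y ≠ ∞ := hNt
  replace hZt : ∀ y ∈ G, Z y ≠ ∞ := hZt
  have hcm : Measurable c :=
    Measurable.lintegral_prod_left' (f := fun q : 𝓧 × 𝓨 => f₀ q.1 * κ q) (by fun_prop)
  have hNm : Measurable N :=
    Measurable.lintegral_prod_left' (f := fun q : 𝓧 × 𝓨 => f₁ q * κ q) (by fun_prop)
  have hZm : Measurable Z :=
    Measurable.lintegral_prod_left' (f := fun q : 𝓧 × 𝓨 => f₀ q.1 * κ q * A q) (by fun_prop)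
  have hcZ : ∀ y, c y ≤ Z y := fun y => lintegral_mono fun x => le_mul_of_one_le_right' (hA1 _)
  obtain ⟨ℓ, hℓdef⟩ : ∃ ℓ : 𝓨 → ℝ,
      ℓ = fun y => Real.log K + ((Z y).toReal / ((c y).toReal * K) - 1) := ⟨_, rfl⟩
  have hℓm : Measurable ℓ := by rw [hℓdef]; fun_prop
  -- `ℓ` dominates log(Z/c), which is nonnegative because A ≥ 1 forces Z ≥ c.
  have hℓ0 : ∀ y ∈ G, 0 ≤ ℓ y := fun y hy => by
    have hc := ENNReal.toReal_pos (hc0 y hy) (hct y hy)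
    have hZ : (c y).toReal ≤ (Z y).toReal := ENNReal.toReal_mono (hZt y hy) (hcZ y)
    have h1 := Real.log_le_sub_one_of_pos (show 0 < (Z y).toReal / ((c y).toReal * K) by
      have := hc.trans_le hZ; positivity)
    have h2 : 0 ≤ Real.log ((Z y).toReal / (c y).toReal) :=
      Real.log_nonneg ((one_le_div hc).2 hZ)
    have h3 : (Z y).toReal / ((c y).toReal * K) = (Z y).toReal / (c y).toReal / K := by
      rw [div_div]
    have hZc : (Z y).toReal / (c y).toReal ≠ 0 := by
      have := hc.trans_le hZ; positivity
    rw [h3, Real.log_div hZc hK0.ne'] at h1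
    simp only [hℓdef]; rw [h3]; linarith
  have hpt : ∀ y ∈ G, ∀ x, f₀ x * κ (x, y) * h (x, y) ≤
      f₁ (x, y) * κ (x, y) * (c y / N y) * h (x, y) +
        (f₀ x * κ (x, y) * b (x, y) + f₀ x * κ (x, y) * ENNReal.ofReal (ℓ y)) := by
    intro y hy x
    -- Here the right side is infinite, unless `κ` vanishes and the left side is zero.
    by_cases hbt : b (x, y) = ∞
    · by_cases hκ0 : κ (x, y) = 0
      · simp [hκ0]
      · rw [hbt, ENNReal.mul_top (mul_ne_zero (hf₀0 x) hκ0)]; simp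
    have hmain : f₀ x ≤ f₁ (x, y) * (c y / N y) +
        f₀ x * (b (x, y) + ENNReal.ofReal (ℓ y)) := by
      -- The pairwise inequality, integrated over `x'` against `κ`.
      have hNf : N y * f₀ x ≤
          Z y * (f₁ (x, y) * ENNReal.ofReal (Real.exp (b (x, y)).toReal)) := by
        simp only [hNdef, hZdef]
        rw [← lintegral_mul_const _ (by fun_prop), ← lintegral_mul_const _ (by fun_prop)]
        refine lintegral_mono fun x' => ?_
        calc f₁ (x', y) * κ (x', y) * f₀ x = κ (x', y) * (f₁ (x', y) * f₀ x) := by ring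
          _ ≤ κ (x', y) * (f₀ x' * A (x', y) *
              (f₁ (x, y) * ENNReal.ofReal (Real.exp (b (x, y)).toReal))) := by
            exact mul_le_mul' le_rfl (hpair x x' y hy hbt)
          _ = _ := by ring
      have e1 : f₁ (x, y) * (c y / N y) + f₀ x * (b (x, y) + ENNReal.ofReal (ℓ y)) =
          ENNReal.ofReal ((f₁ (x, y)).toReal * ((c y).toReal / (N y).toReal) +
            (f₀ x).toReal * ((b (x, y)).toReal + ℓ y)) := by
        have hℓ := hℓ0 y hy
        rw [ENNReal.ofReal_add (by positivity) (by positivity), ENNReal.ofReal_mul (by positivity),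
          ENNReal.ofReal_mul (by positivity), ENNReal.ofReal_add (by positivity) hℓ,
          ENNReal.ofReal_div_of_pos (ENNReal.toReal_pos (hN0 y hy) (hNt y hy)),
          ENNReal.ofReal_toReal (hf₁t x y hy), ENNReal.ofReal_toReal (hct y hy),
          ENNReal.ofReal_toReal (hNt y hy), ENNReal.ofReal_toReal (hf₀t x),
          ENNReal.ofReal_toReal hbt]
      rw [e1, ← ENNReal.ofReal_toReal (hf₀t x), ENNReal.toReal_ofReal ENNReal.toReal_nonneg]
      refine ENNReal.ofReal_le_ofReal ?_
      simp only [hℓdef]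
      refine density_le_plugIn (ENNReal.toReal_pos (hf₀0 x) (hf₀t x))
        (ENNReal.toReal_pos (hf₁0 x y hy) (hf₁t x y hy)) (ENNReal.toReal_pos (hc0 y hy) (hct y hy))
        (ENNReal.toReal_pos (hN0 y hy) (hNt y hy)) (ENNReal.toReal_mono (hZt y hy) (hcZ y)) hK0 ?_
      have := ENNReal.toReal_mono (ENNReal.mul_ne_top (hZt y hy)
        (ENNReal.mul_ne_top (hf₁t x y hy) ENNReal.ofReal_ne_top)) hNf
      rw [ENNReal.toReal_mul, ENNReal.toReal_mul, ENNReal.toReal_mul,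
        ENNReal.toReal_ofReal (Real.exp_pos _).le] at this
      linarith
    calc f₀ x * κ (x, y) * h (x, y) ≤ (f₁ (x, y) * (c y / N y) +
          f₀ x * (b (x, y) + ENNReal.ofReal (ℓ y))) * κ (x, y) * h (x, y) := by gcongr
      _ = f₁ (x, y) * κ (x, y) * (c y / N y) * h (x, y) +
          (f₀ x * κ (x, y) * b (x, y) + f₀ x * κ (x, y) * ENNReal.ofReal (ℓ y)) * h (x, y) := by
        ring
      _ ≤ f₁ (x, y) * κ (x, y) * (c y / N y) * h (x, y) +
          (f₀ x * κ (x, y) * b (x, y) + f₀ x * κ (x, y) * ENNReal.ofReal (ℓ y)) * 1 := by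
        gcongr; exact hh1 _
      _ = _ := by rw [mul_one]
  -- With π the mass of `G`, the integral is π log K + (∫Z)/K - π. As ∫Z ≤ K + π - 1, this is at
  -- most π log K + (1 - π)(1 - 1/K), hence at most log K.
  have hℓint : ∫⁻ y in G, c y * ENNReal.ofReal (ℓ y) ∂lam ≤ ENNReal.ofReal (Real.log K) := by
    set π := ∫⁻ y in G, c y ∂lam with hπdef
    have hπt : π ≠ ∞ := (hπ.trans_lt ENNReal.one_lt_top).ne
    have h1 : ∫⁻ y in G, c y * ENNReal.ofReal (ℓ y) ∂lam + π =
        π * ENNReal.ofReal (Real.log K) + (∫⁻ y in G, Z y ∂lam) * (ENNReal.ofReal K)⁻¹ := by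
      rw [hπdef, ← lintegral_mul_const _ hcm, ← lintegral_mul_const _ hZm,
        ← lintegral_add_right _ hcm, ← lintegral_add_left (by fun_prop)]
      refine setLIntegral_congr_fun hG fun y hy => ?_
      have hc := ENNReal.toReal_pos (hc0 y hy) (hct y hy)
      rw [← ENNReal.ofReal_inv_of_pos hK0]
      nth_rewrite 1 2 3 [← ENNReal.ofReal_toReal (hct y hy)]
      rw [← ENNReal.ofReal_toReal (hZt y hy), ← ENNReal.ofReal_mul (by positivity),
        ← ENNReal.ofReal_mul (by positivity), ← ENNReal.ofReal_mul (by positivity),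
        ← ENNReal.ofReal_add (mul_nonneg hc.le (hℓ0 y hy)) hc.le,
        ← ENNReal.ofReal_add (by positivity) (by positivity)]
      congr 1
      simp only [hℓdef]
      field_simp
      ring
    set I := ∫⁻ y in G, c y * ENNReal.ofReal (ℓ y) ∂lam
    set ZZ := ∫⁻ y in G, Z y ∂lam
    have hZZ : ZZ ≠ ∞ := by
      refine ne_top_of_le_ne_top ?_ (le_self_add.trans hAK)
      exact ENNReal.add_ne_top.2 ⟨ENNReal.ofReal_ne_top, hπt⟩
    have hR : I + π ≠ ∞ := by
      rw [h1]
      exact ENNReal.add_ne_top.2 ⟨ENNReal.mul_ne_top hπt ENNReal.ofReal_ne_top,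
        ENNReal.mul_ne_top hZZ (ENNReal.inv_ne_top.2 (by simpa using hK0))⟩
    have hI : I ≠ ∞ := (ENNReal.add_ne_top.1 hR).1
    have h2 := congrArg ENNReal.toReal h1
    rw [ENNReal.toReal_add hI hπt, ENNReal.toReal_add (ENNReal.mul_ne_top hπt ENNReal.ofReal_ne_top)
      (ENNReal.mul_ne_top hZZ (ENNReal.inv_ne_top.2 (by simpa using hK0))), ENNReal.toReal_mul,
      ENNReal.toReal_mul, ENNReal.toReal_inv, ENNReal.toReal_ofReal hlogK,
      ENNReal.toReal_ofReal hK0.le] at h2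
    have h3 := ENNReal.toReal_mono (ENNReal.add_ne_top.2 ⟨ENNReal.ofReal_ne_top, hπt⟩) hAK
    rw [ENNReal.toReal_add hZZ ENNReal.one_ne_top, ENNReal.toReal_add ENNReal.ofReal_ne_top hπt,
      ENNReal.toReal_ofReal hK0.le, ENNReal.toReal_one] at h3
    have h4 : π.toReal ≤ 1 := by simpa using ENNReal.toReal_mono ENNReal.one_ne_top hπ
    rw [← ENNReal.ofReal_toReal hI]
    refine ENNReal.ofReal_le_ofReal ?_
    have h5 : ZZ.toReal * K⁻¹ ≤ (K + π.toReal - 1) * K⁻¹ := by gcongr; linarith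
    have h6 : (K + π.toReal - 1) * K⁻¹ = 1 - (1 - π.toReal) * K⁻¹ := by field_simp; ring
    have h7 := Real.one_sub_inv_le_log_of_pos hK0
    nlinarith [mul_nonneg (sub_nonneg.2 h4) (sub_nonneg.2 h7)]
  calc _ ≤ ∫⁻ y in G, ((∫⁻ x, f₁ (x, y) * κ (x, y) * (c y / N y) * h (x, y) ∂ν) +
        ((∫⁻ x, f₀ x * κ (x, y) * b (x, y) ∂ν) + c y * ENNReal.ofReal (ℓ y))) ∂lam := by
        refine setLIntegral_mono' hG fun y hy => ?_
        rw [hcdef, ← lintegral_mul_const _ (by fun_prop), ← lintegral_add_left (by fun_prop),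
          ← lintegral_add_left (by fun_prop)]
        exact lintegral_mono (hpt y hy)
    _ = (∫⁻ y in G, ∫⁻ x, f₁ (x, y) * κ (x, y) * (c y / N y) * h (x, y) ∂ν ∂lam) +
        ((∫⁻ y in G, ∫⁻ x, f₀ x * κ (x, y) * b (x, y) ∂ν ∂lam) +
          ∫⁻ y in G, c y * ENNReal.ofReal (ℓ y) ∂lam) := by
        have m1 : Measurable fun y => ∫⁻ x, f₁ (x, y) * κ (x, y) * (c y / N y) * h (x, y) ∂ν :=
          Measurable.lintegral_prod_left'
            (f := fun q : 𝓧 × 𝓨 => f₁ q * κ q * (c q.2 / N q.2) * h q) (by fun_prop)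
        have m2 : Measurable fun y => ∫⁻ x, f₀ x * κ (x, y) * b (x, y) ∂ν :=
          Measurable.lintegral_prod_left'
            (f := fun q : 𝓧 × 𝓨 => f₀ q.1 * κ q * b q) (by fun_prop)
        rw [lintegral_add_left m1, lintegral_add_left m2]
    _ ≤ _ := by gcongr

end PlugIn

/-! ### Joint measurability in data and parameter -/

section Measurability

variable {𝓧 E β : Type*} [MeasurableSpace 𝓧] [MeasurableSpace β]

/-- A directional derivative is a limit of difference quotients along steps 1/n; the shift by `n₀`
keeps all evaluation points in `s`. -/
theorem measurable_fderiv_apply_of_measurable [NormedAddCommGroup E] [NormedSpace ℝ E]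
    {F : E → 𝓧 → ℝ} {s : Set E} (hs : IsOpen s)
    (hF : ∀ x, DifferentiableOn ℝ (fun θ => F θ x) s) (hm : ∀ θ ∈ s, Measurable (F θ)) {θ : E}
    (hθ : θ ∈ s) (v : E) : Measurable fun x => fderiv ℝ (fun t => F t x) θ v := by
  have hlim : Filter.Tendsto (fun n : ℕ => θ + (n : ℝ)⁻¹ • v) Filter.atTop (nhds θ) := by
    have := (tendsto_inv_atTop_nhds_zero_nat (𝕜 := ℝ)).smul_const v
    simpa only [zero_smul, add_zero] using this.const_add θ
  obtain ⟨n₀, hn₀⟩ := Filter.eventually_atTop.1 (hlim.eventually (hs.mem_nhds hθ))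
  refine measurable_of_tendsto_metrizable
    (f := fun (n : ℕ) x => ((n + n₀ : ℕ) : ℝ) •
      (F (θ + ((n + n₀ : ℕ) : ℝ)⁻¹ • v) x - F θ x : ℝ)) (fun n => ?_) ?_
  · exact ((hm _ (hn₀ _ (Nat.le_add_left _ _))).sub (hm θ hθ)).const_mul _
  · rw [tendsto_pi_nhds]
    intro x
    have h1 := ((hF x).differentiableAt (hs.mem_nhds hθ)).hasFDerivAt
    refine h1.lim v (c := fun n : ℕ => ((n + n₀ : ℕ) : ℝ)) ?_
    have : Filter.Tendsto (fun n : ℕ => n + n₀) Filter.atTop Filter.atTop :=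
      Filter.tendsto_add_atTop_nat n₀
    simp only [Real.norm_natCast]
    exact tendsto_natCast_atTop_atTop.comp this

/-- A function that is continuous in one variable on a set and measurable in the other one, extended
by zero, is jointly measurable. -/
theorem measurable_indicator_of_continuousOn [TopologicalSpace E]
    [TopologicalSpace.MetrizableSpace E] [SecondCountableTopology E] [MeasurableSpace E]
    [OpensMeasurableSpace E]
    [TopologicalSpace β] [TopologicalSpace.PseudoMetrizableSpace β] [BorelSpace β] [Zero β]
    {F : E → 𝓧 → β} {s : Set E} (hs : MeasurableSet s)
    (hF : ∀ x, ContinuousOn (fun θ => F θ x) s) (hm : ∀ θ ∈ s, Measurable (F θ)) :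
    Measurable fun q : E × 𝓧 => s.indicator (fun θ => F θ q.2) q.1 := by
  classical
  have h1 : Measurable (Function.uncurry fun (θ : s) x => F θ x) :=
    measurable_uncurry_of_continuous_of_measurable (fun x => (hF x).domRestrict) fun θ => hm θ θ.2
  have hs' : MeasurableSet {q : E × 𝓧 | q.1 ∈ s} := measurable_fst hs
  refine measurable_of_measurable_union_cover _ _ hs' hs'.compl (Set.union_compl_self _).ge ?_ ?_
  · have h2 : Measurable fun q : {q : E × 𝓧 | q.1 ∈ s} => ((⟨q.1.1, q.2⟩ : s), q.1.2) := by
      fun_prop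
    convert h1.comp h2 using 2 with q
    exact Set.indicator_of_mem (s := s) (a := q.1.1) q.2 (fun θ : E => F θ q.1.2)
  · convert measurable_const (a := (0 : β)) using 2 with q
    exact Set.indicator_of_notMem (s := s) (a := q.1.1) q.2 (fun θ : E => F θ q.1.2)

theorem _root_.IsSigmaCompact.measurableSet {X : Type*} [TopologicalSpace X] [T2Space X]
    [MeasurableSpace X] [OpensMeasurableSpace X] {s : Set X} (hs : IsSigmaCompact s) :
    MeasurableSet s := by
  obtain ⟨K, hK, rfl⟩ := hs
  exact MeasurableSet.iUnion fun n => (hK n).measurableSet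

theorem continuous_det_of {n : ℕ} :
    Continuous fun M : Fin n → Fin n → ℝ => (Matrix.of M).det := by
  simp only [Matrix.det_apply, Matrix.of_apply]
  fun_prop

/-- Positive definite means positive semidefinite with nonzero determinant, and semidefiniteness is
a closed condition on the entries. -/
theorem measurableSet_posDef {Z : Type*} [MeasurableSpace Z] {n : ℕ}
    {B : Z → Matrix (Fin n) (Fin n) ℝ} (hB : ∀ i j, Measurable fun z => B z i j) :
    MeasurableSet {z | (B z).PosDef} := by
  have h1 : MeasurableSet {M : Fin n → Fin n → ℝ | (Matrix.of M).PosDef} := by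
    have : {M : Fin n → Fin n → ℝ | (Matrix.of M).PosDef} =
        ({M | (Matrix.of M)ᴴ = Matrix.of M} ∩
          ⋂ x : Fin n → ℝ, {M | 0 ≤ star x ⬝ᵥ (Matrix.of M *ᵥ x)}) ∩
          {M | (Matrix.of M).det ≠ 0} := by
      ext M
      have h2 := Matrix.posSemidef_iff_dotProduct_mulVec (M := Matrix.of M)
      simp only [Set.mem_inter_iff, Set.mem_ofPred_eq, Set.mem_iInter]
      rw [← Matrix.IsHermitian, ← h2]
      refine ⟨fun h => ⟨h.posSemidef, h.det_pos.ne'⟩, fun h => ?_⟩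
      exact h.1.posDef_iff_isUnit.2 ((Matrix.isUnit_iff_isUnit_det _).2 (isUnit_iff_ne_zero.2 h.2))
    rw [this]
    refine (MeasurableSet.inter ?_ ?_).inter ?_
    · have : {M : Fin n → Fin n → ℝ | (Matrix.of M)ᴴ = Matrix.of M} =
          ⋂ i, ⋂ j, {M | M j i = M i j} := by
        ext M
        simp [← Matrix.ext_iff]
      rw [this]
      exact MeasurableSet.iInter fun i => MeasurableSet.iInter fun j =>
        measurableSet_eq_fun (by fun_prop) (by fun_prop)
    · refine (isClosed_iInter fun x => ?_).measurableSet
      have h3 : Continuous fun M : Fin n → Fin n → ℝ => star x ⬝ᵥ (Matrix.of M *ᵥ x) := by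
        simp only [Matrix.mulVec, dotProduct, Matrix.of_apply]; fun_prop
      exact isClosed_le continuous_const h3
    · exact (continuous_det_of.measurable (measurableSet_singleton 0)).compl
  exact h1.preimage (f := fun z i j => B z i j) (by fun_prop)

theorem measurable_det_of_entries {Z : Type*} [MeasurableSpace Z] {n : ℕ}
    {B : Z → Matrix (Fin n) (Fin n) ℝ} (hB : ∀ i j, Measurable fun z => B z i j) :
    Measurable fun z => (B z).det := by
  have h1 : Measurable fun M : Fin n → Fin n → ℝ => (Matrix.of M).det :=
    continuous_det_of.measurable
  exact h1.comp (f := fun z i j => B z i j) (by fun_prop)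

end Measurability

theorem det_toEuclideanCLM {n : ℕ} (M : Matrix (Fin n) (Fin n) ℝ) :
    (Matrix.toEuclideanCLM (n := Fin n) (𝕜 := ℝ) M).det = M.det := by
  rw [ContinuousLinearMap.det, Matrix.coe_toEuclideanCLM_eq_toEuclideanLin, Matrix.toEuclideanLin,
    Matrix.toLpLin_eq_toLin, LinearMap.det_toLin]

/-- Used with `a` the active set. The size of Uᵀ∇²L U depends on that set, so measurability is
checked with the set frozen. -/
theorem measurable_comp_countable {Z C β : Type*} [MeasurableSpace Z] [MeasurableSpace C]
    [Countable C] [MeasurableSingletonClass C] [MeasurableSpace β] {F : C → Z → β} {a : Z → C}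
    (hF : ∀ s, Measurable (F s)) (ha : Measurable a) : Measurable fun z => F (a z) z := by
  have : Measurable fun q : C × Z => F q.1 q.2 := measurable_from_prod_countable_right hF
  exact this.comp (f := fun z => (a z, z)) (by fun_prop)

theorem measurableSet_comp_countable {Z C : Type*} [MeasurableSpace Z] [MeasurableSpace C]
    [Countable C] [MeasurableSingletonClass C] {F : C → Z → Prop} {a : Z → C}
    (hF : ∀ s, MeasurableSet {z | F s z}) (ha : Measurable a) : MeasurableSet {z | F (a z) z} :=
  measurableSet_setOfPred.2 (measurable_comp_countable (fun s => measurableSet_setOfPred.1 (hF s)) ha)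

/-- The matrix λ_max I - M is symmetric with nonnegative spectrum. Finiteness of the spectrum makes
`sSup` a genuine upper bound. -/
theorem dotProduct_mulVec_le_lambdaMax {n : ℕ} {M : Matrix (Fin n) (Fin n) ℝ} (hM : M.IsHermitian)
    (v : EuclideanSpace ℝ (Fin n)) :
    v.ofLp ⬝ᵥ M *ᵥ v.ofLp ≤ lambdaMax M * ‖v‖ ^ 2 := by
  have hfin : (spectrum ℝ M).Finite := by
    rw [hM.spectrum_real_eq_range_eigenvalues]
    exact Set.finite_range _
  have h1 : (algebraMap ℝ (Matrix (Fin n) (Fin n) ℝ) (lambdaMax M) - M).PosSemidef := by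
    refine Matrix.posSemidef_iff_isHermitian_and_spectrum_nonneg.2 ⟨?_, ?_⟩
    · refine Matrix.IsHermitian.sub ?_ hM
      rw [Algebra.algebraMap_eq_smul_one]
      exact Matrix.isHermitian_one.smul (IsSelfAdjoint.all _)
    · rw [← spectrum.singleton_sub_eq]
      rintro _ ⟨a, ha, b, hb, rfl⟩
      rw [Set.mem_singleton_iff.1 ha]
      exact sub_nonneg.2 (le_csSup hfin.bddAbove hb)
  have h2 := h1.dotProduct_mulVec_nonneg v.ofLp
  rw [Matrix.sub_mulVec, dotProduct_sub, Algebra.algebraMap_eq_smul_one, Matrix.smul_mulVec,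
    Matrix.one_mulVec, dotProduct_smul, star_trivial] at h2
  have h3 : ‖v‖ ^ 2 = v.ofLp ⬝ᵥ v.ofLp := by
    rw [EuclideanSpace.real_norm_sq_eq]; simp [dotProduct, pow_two]
  rw [h3]
  simpa using h2

theorem dotProduct_mulVec_le_sq_mul {n : ℕ} {M : Matrix (Fin n) (Fin n) ℝ} (hM : M.IsHermitian)
    {v : EuclideanSpace ℝ (Fin n)} {r : ℝ} (hv : ‖v‖ ≤ r) :
    v.ofLp ⬝ᵥ M *ᵥ v.ofLp ≤ r ^ 2 * max (lambdaMax M) 0 := by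
  calc _ ≤ lambdaMax M * ‖v‖ ^ 2 := dotProduct_mulVec_le_lambdaMax hM v
    _ ≤ max (lambdaMax M) 0 * r ^ 2 := by gcongr; exact le_max_left _ _
    _ = _ := mul_comm _ _

/-- A second-order Taylor bound on the unit interval. -/
theorem le_add_add_half_of_hasDerivAt {φ φ' φ'' : ℝ → ℝ} {C : ℝ}
    (h : ∀ s ∈ Set.Icc (0 : ℝ) 1, HasDerivAt φ (φ' s) s)
    (h' : ∀ s ∈ Set.Icc (0 : ℝ) 1, HasDerivAt φ' (φ'' s) s)
    (hC : ∀ s ∈ Set.Icc (0 : ℝ) 1, φ'' s ≤ C) : φ 1 ≤ φ 0 + φ' 0 + C / 2 := by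
  -- Applied first to φ'(s) - Cs, then to φ(s) - φ'(0)s - Cs²/2; no continuity of φ'' is needed.
  have key : ∀ {ψ ψ' : ℝ → ℝ}, (∀ s ∈ Set.Icc (0 : ℝ) 1, HasDerivAt ψ (ψ' s) s) →
      (∀ s ∈ Set.Icc (0 : ℝ) 1, ψ' s ≤ 0) → ∀ s ∈ Set.Icc (0 : ℝ) 1, ψ s ≤ ψ 0 := by
    intro ψ ψ' h1 h2 s hs
    refine antitoneOn_of_deriv_nonpos (convex_Icc 0 1)
      (fun t ht => (h1 t ht).continuousAt.continuousWithinAt)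
      (fun t ht => (h1 t (interior_subset ht)).differentiableAt.differentiableWithinAt)
      (fun t ht => ?_) (Set.left_mem_Icc.2 zero_le_one) hs hs.1
    rw [(h1 t (interior_subset ht)).deriv]
    exact h2 t (interior_subset ht)
  have h1 : ∀ s ∈ Set.Icc (0 : ℝ) 1, φ' s - C * s ≤ φ' 0 := fun s hs => by
    have := key (ψ := fun s => φ' s - C * s) (ψ' := fun s => φ'' s - C)
      (fun s hs => ((h' s hs).sub ((hasDerivAt_id s).const_mul C)).congr_deriv (by simp))
      (fun s hs => sub_nonpos.2 (hC s hs)) s hs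
    simpa using this
  have h2 := key (ψ := fun s => φ s - φ' 0 * s - C / 2 * s ^ 2)
    (ψ' := fun s => φ' s - φ' 0 - C * s)
    (fun s hs => by
      have := ((h s hs).sub ((hasDerivAt_id s).const_mul (φ' 0))).sub
        ((hasDerivAt_pow 2 s).const_mul (C / 2))
      refine this.congr_deriv ?_
      simp; ring)
    (fun s hs => by linarith [h1 s hs]) 1 (Set.right_mem_Icc.2 zero_le_one)
  simp at h2
  linarith

theorem one_le_exp_coe (a : ℝ≥0∞) : 1 ≤ EReal.exp (a : EReal) :=
  EReal.one_le_exp_iff.2 (EReal.coe_ennreal_nonneg a)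

theorem exp_coe (a : ℝ≥0∞) (ha : a ≠ ∞) :
    EReal.exp (a : EReal) = ENNReal.ofReal (Real.exp a.toReal) := by
  lift a to NNReal using ha
  rfl

theorem exp_coe_half (a : ℝ≥0∞) (ha : a ≠ ∞) :
    EReal.exp ((a / 2 : ℝ≥0∞) : EReal) =
      ENNReal.ofReal (Real.exp (a.toReal / 2)) := by
  have h : (a / 2).toReal = a.toReal / 2 := by simp [ENNReal.toReal_div]
  rw [exp_coe _ (ENNReal.div_lt_top ha (by simp)).ne, h]

/-- By the arithmetic-geometric mean inequality, exp(F/2) ≤ (exp(e/2) + exp(-e/2) exp(F))/2. The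
halved exponent matches the factor 1/2 in Taylor's formula. -/
theorem lintegral_exp_half_le {Y : Type*} [MeasurableSpace Y] {m : Measure Y}
    [IsProbabilityMeasure m] {F : Y → ℝ≥0∞} (hF : Measurable F) {e : ℝ}
    (h : ∫⁻ x, EReal.exp (F x) ∂m ≤ ENNReal.ofReal (Real.exp e)) :
    ∫⁻ x, EReal.exp ((F x / 2 : ℝ≥0∞) : EReal) ∂m ≤ ENNReal.ofReal (Real.exp (e / 2)) := by
  have hE : Measurable fun x => EReal.exp (F x : EReal) :=
    EReal.measurable_exp.comp hF.coe_ereal_ennreal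
  have hpt : ∀ x, EReal.exp ((F x / 2 : ℝ≥0∞) : EReal) ≤
      ENNReal.ofReal (Real.exp (e / 2) / 2) +
        ENNReal.ofReal (Real.exp (-(e / 2)) / 2) * EReal.exp (F x) := fun x => by
    by_cases hx : F x = ∞
    · rw [hx]
      simp [ENNReal.mul_top, Real.exp_pos]
    · rw [exp_coe_half _ hx, exp_coe _ hx, ← ENNReal.ofReal_mul (by positivity),
        ← ENNReal.ofReal_add (by positivity) (by positivity)]
      refine ENNReal.ofReal_le_ofReal ?_
      set u := (F x).toReal
      have h1 : Real.exp u = Real.exp (u / 2) ^ 2 := by rw [← Real.exp_nat_mul]; ring_nf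
      have h2 : Real.exp (-(e / 2)) = (Real.exp (e / 2))⁻¹ := Real.exp_neg _
      rw [h1, h2]
      have h3 := Real.exp_pos (e / 2)
      have : Real.exp (e / 2) / 2 + (Real.exp (e / 2))⁻¹ / 2 * Real.exp (u / 2) ^ 2 -
          Real.exp (u / 2) =
          (Real.exp (u / 2) - Real.exp (e / 2)) ^ 2 / (2 * Real.exp (e / 2)) := by
        field_simp; ring
      have h4 : 0 ≤ (Real.exp (u / 2) - Real.exp (e / 2)) ^ 2 / (2 * Real.exp (e / 2)) := by
        positivity
      linarith
  refine (lintegral_mono hpt).trans ?_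
  rw [lintegral_add_left measurable_const, lintegral_const_mul _ hE]
  simp only [lintegral_const, measure_univ, mul_one]
  calc _ ≤ ENNReal.ofReal (Real.exp (e / 2) / 2) +
        ENNReal.ofReal (Real.exp (-(e / 2)) / 2) * ENNReal.ofReal (Real.exp e) := by gcongr
    _ = _ := by
      rw [← ENNReal.ofReal_mul (by positivity), ← ENNReal.ofReal_add (by positivity)
        (by positivity), div_mul_eq_mul_div, ← Real.exp_add]
      congr 1
      rw [show -(e / 2) + e = e / 2 by ring]
      ring

/-! ### Derivatives of the loss -/

namespace Setup

variable {𝓧 : Type*} [MeasurableSpace 𝓧] {d p : ℕ} {S : Setup 𝓧 d p}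

local notation "E" => EuclideanSpace ℝ (Fin d)

theorem continuousOn_R : ContinuousOn S.R S.Θ := S.R_differentiable.continuousOn

theorem measurableSet_Θ (hReg : S.Regularity) : MeasurableSet S.Θ := hReg.isOpen.measurableSet

theorem differentiableAt_loss (hReg : S.Regularity) {θ : E} (hθ : θ ∈ S.Θ) (x : 𝓧) :
    DifferentiableAt ℝ (fun t => S.loss t x) θ :=
  ((hReg.contDiff_loss x).differentiableOn (by norm_num)).differentiableAt
    (hReg.isOpen.mem_nhds hθ)

theorem contDiffOn_fderiv_loss (hReg : S.Regularity) (x : 𝓧) :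
    ContDiffOn ℝ 1 (fderiv ℝ fun t => S.loss t x) S.Θ :=
  (hReg.contDiff_loss x).fderiv_of_isOpen hReg.isOpen (by norm_num)

theorem differentiableAt_fderiv_loss (hReg : S.Regularity) {θ : E} (hθ : θ ∈ S.Θ) (x : 𝓧) :
    DifferentiableAt ℝ (fderiv ℝ fun t => S.loss t x) θ :=
  ((contDiffOn_fderiv_loss hReg x).differentiableOn (by norm_num)).differentiableAt
    (hReg.isOpen.mem_nhds hθ)

theorem pertLoss_eq (θ : E) (x : 𝓧) (w : E) :
    S.pertLoss θ x w = S.loss θ x + S.σ * inner ℝ w θ := rfl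

theorem hasFDerivAt_pertLoss (hReg : S.Regularity) {θ : E} (hθ : θ ∈ S.Θ) (x : 𝓧) (w : E) :
    HasFDerivAt (fun t => S.pertLoss t x w)
      (fderiv ℝ (fun t => S.loss t x) θ + S.σ • innerSL ℝ w) θ := by
  simp only [pertLoss_eq]
  exact (differentiableAt_loss hReg hθ x).hasFDerivAt.add
    (((innerSL ℝ w).hasFDerivAt (x := θ)).const_mul S.σ)

theorem gradPertLoss_eq (hReg : S.Regularity) {θ : E} (hθ : θ ∈ S.Θ) (x : 𝓧) (w : E) :
    S.gradPertLoss θ x w = S.gradLoss θ x + S.σ • w := by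
  rw [gradPertLoss, gradLoss, gradient, gradient, (hasFDerivAt_pertLoss hReg hθ x w).fderiv,
    map_add, map_smul]
  congr 2
  exact (InnerProductSpace.toDual ℝ E).symm_apply_eq.2 rfl

theorem hessian_pertLoss_eq (hReg : S.Regularity) {θ : E} (hθ : θ ∈ S.Θ) (x : 𝓧) (w : E) :
    hessian (fun t => S.pertLoss t x w) θ = hessian (fun t => S.loss t x) θ := by
  have h1 : fderiv ℝ (fun t => S.pertLoss t x w) =ᶠ[nhds θ]
      fun t => fderiv ℝ (fun t => S.loss t x) t + S.σ • innerSL ℝ w := by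
    filter_upwards [hReg.isOpen.mem_nhds hθ] with t ht
    exact (hasFDerivAt_pertLoss hReg ht x w).fderiv
  ext i j
  simp only [hessian, Matrix.of_apply, iteratedFDeriv_two_apply]
  rw [h1.fderiv_eq, fderiv_add_const]

theorem hessian_loss_apply (hReg : S.Regularity) {θ : E} (hθ : θ ∈ S.Θ) (x : 𝓧) (i j : Fin d) :
    hessian (fun t => S.loss t x) θ i j =
      fderiv ℝ (fun t => fderiv ℝ (fun t => S.loss t x) t (EuclideanSpace.single j 1)) θ
        (EuclideanSpace.single i 1) := by
  rw [fderiv_clm_apply (differentiableAt_fderiv_loss hReg hθ x) (differentiableAt_const _)]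
  simp [hessian, iteratedFDeriv_two_apply]

theorem inner_gradLoss (θ : E) (x : 𝓧) (v : E) :
    inner ℝ (S.gradLoss θ x) v = fderiv ℝ (fun t => S.loss t x) θ v := by
  rw [gradLoss, gradient, InnerProductSpace.toDual_symm_apply]

theorem gradLoss_apply (θ : E) (x : 𝓧) (i : Fin d) :
    S.gradLoss θ x i = fderiv ℝ (fun t => S.loss t x) θ (EuclideanSpace.single i 1) := by
  rw [← inner_gradLoss]
  simp [EuclideanSpace.inner_single_right]

theorem measurable_loss (hReg : S.Regularity) {θ : E} (hθ : θ ∈ S.Θ) : Measurable (S.loss θ) :=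
  ((hReg.measurable_density θ hθ).log.neg).add_const _

theorem measurable_fderiv_loss_apply (hReg : S.Regularity) {θ : E} (hθ : θ ∈ S.Θ) (v : E) :
    Measurable fun x => fderiv ℝ (fun t => S.loss t x) θ v :=
  measurable_fderiv_apply_of_measurable hReg.isOpen
    (fun x => (hReg.contDiff_loss x).differentiableOn (by norm_num))
    (fun _ h => measurable_loss hReg h) hθ v

theorem contDiffOn_fderiv_loss_apply (hReg : S.Regularity) (x : 𝓧) (v : E) :
    ContDiffOn ℝ 1 (fun θ => fderiv ℝ (fun t => S.loss t x) θ v) S.Θ :=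
  (contDiffOn_fderiv_loss hReg x).clm_apply contDiffOn_const

theorem measurable_hessian_loss (hReg : S.Regularity) {θ : E} (hθ : θ ∈ S.Θ) (i j : Fin d) :
    Measurable fun x => hessian (fun t => S.loss t x) θ i j := by
  simp only [hessian_loss_apply hReg hθ]
  exact measurable_fderiv_apply_of_measurable hReg.isOpen
    (fun x => (contDiffOn_fderiv_loss_apply hReg x _).differentiableOn (by norm_num))
    (fun _ h => measurable_fderiv_loss_apply hReg h _) hθ _

theorem continuousOn_hessian_loss (hReg : S.Regularity) (x : 𝓧) (i j : Fin d) :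
    ContinuousOn (fun θ => hessian (fun t => S.loss t x) θ i j) S.Θ := by
  have h1 : ContinuousOn (fun θ => fderiv ℝ (fderiv ℝ fun t => S.loss t x) θ) S.Θ :=
    (contDiffOn_fderiv_loss hReg x).continuousOn_fderiv_of_isOpen hReg.isOpen (by norm_num)
  simp only [hessian, Matrix.of_apply, iteratedFDeriv_two_apply]
  exact (h1.clm_apply continuousOn_const).clm_apply continuousOn_const

variable (S) in
/-- The density, extended by zero outside the parameter space. -/
def density₀ (θ : E) (x : 𝓧) : ℝ := S.Θ.indicator (fun θ => S.f θ x) θ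

variable (S) in
/-- The gradient of the loss, extended by zero outside the parameter space. -/
def gradLoss₀ (θ : E) (x : 𝓧) : E := S.Θ.indicator (fun θ => S.gradLoss θ x) θ

variable (S) in
/-- The entries of the Hessian of the loss, extended by zero outside the parameter space. -/
def hessLoss₀ (θ : E) (x : 𝓧) : Matrix (Fin d) (Fin d) ℝ :=
  Matrix.of fun i j => S.Θ.indicator (fun θ => hessian (fun t => S.loss t x) θ i j) θ

theorem density₀_of_mem {θ : E} (hθ : θ ∈ S.Θ) (x : 𝓧) : S.density₀ θ x = S.f θ x :=
  Set.indicator_of_mem hθ _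

theorem gradLoss₀_of_mem {θ : E} (hθ : θ ∈ S.Θ) (x : 𝓧) : S.gradLoss₀ θ x = S.gradLoss θ x :=
  Set.indicator_of_mem hθ _

theorem hessLoss₀_of_mem {θ : E} (hθ : θ ∈ S.Θ) (x : 𝓧) :
    S.hessLoss₀ θ x = hessian (fun t => S.loss t x) θ := by
  ext i j
  exact Set.indicator_of_mem hθ fun θ => hessian (fun t => S.loss t x) θ i j

theorem measurable_density₀ (hReg : S.Regularity) :
    Measurable fun q : E × 𝓧 => S.density₀ q.1 q.2 := by
  refine measurable_indicator_of_continuousOn (F := S.f) (measurableSet_Θ hReg) (fun x => ?_)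
    hReg.measurable_density
  -- The density is exp(R - L), which makes it continuous in θ.
  have h1 : ContinuousOn (fun θ => Real.exp (S.R θ - S.loss θ x)) S.Θ :=
    (continuousOn_R.sub (hReg.contDiff_loss x).continuousOn).rexp
  refine h1.congr fun θ hθ => ?_
  dsimp only
  rw [show S.loss θ x = -Real.log (S.f θ x) + S.R θ from rfl, show S.R θ - (-Real.log (S.f θ x) + S.R θ) = Real.log (S.f θ x) by ring,
    Real.exp_log (hReg.density_pos θ hθ x)]

theorem measurable_gradLoss₀ (hReg : S.Regularity) :
    Measurable fun q : E × 𝓧 => S.gradLoss₀ q.1 q.2 := by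
  have h1 : ∀ i : Fin d, Measurable fun q : E × 𝓧 =>
      S.Θ.indicator (fun θ => fderiv ℝ (fun t => S.loss t q.2) θ
        (EuclideanSpace.single i 1)) q.1 := fun i =>
    measurable_indicator_of_continuousOn (F := fun θ x => fderiv ℝ (fun t => S.loss t x) θ
        (EuclideanSpace.single i 1)) (measurableSet_Θ hReg)
      (fun x => (contDiffOn_fderiv_loss_apply hReg x _).continuousOn)
      (fun _ h => measurable_fderiv_loss_apply hReg h _)
  have h2 : (fun q : E × 𝓧 => S.gradLoss₀ q.1 q.2) = fun q => WithLp.toLp 2 fun i =>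
      S.Θ.indicator (fun θ => fderiv ℝ (fun t => S.loss t q.2) θ
        (EuclideanSpace.single i 1)) q.1 := by
    funext q
    ext i
    by_cases h : q.1 ∈ S.Θ
    · simp [gradLoss₀_of_mem h, gradLoss_apply, Set.indicator_of_mem h]
    · simp [gradLoss₀, Set.indicator_of_notMem h]
  rw [h2]
  exact (WithLp.measurable_toLp 2 _).comp (measurable_pi_lambda _ h1)

theorem measurable_hessLoss₀ (hReg : S.Regularity) (i j : Fin d) :
    Measurable fun q : E × 𝓧 => S.hessLoss₀ q.1 q.2 i j :=
  measurable_indicator_of_continuousOn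
    (F := fun θ x => hessian (fun t => S.loss t x) θ i j) (measurableSet_Θ hReg)
    (fun x => continuousOn_hessian_loss hReg x i j)
    (fun _ h => measurable_hessian_loss hReg h i j)

/-! ### Stationarity and the geometry of active sets -/

variable (S) in
/-- The cone generated by the rows with index in `s`. -/
def cone (s : Set (Fin p)) : Set E :=
  (fun m : Fin p → ℝ => ∑ i, m i • S.row i) '' {m | (∀ i, 0 ≤ m i) ∧ ∀ i, i ∉ s → m i = 0}

/-- A closed set of multipliers in a finite-dimensional space is σ-compact, and so is its linear
image. -/
theorem measurableSet_cone (s : Set (Fin p)) : MeasurableSet (S.cone s) := by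
  refine IsSigmaCompact.measurableSet (IsSigmaCompact.image (by fun_prop) ?_)
  refine IsSigmaCompact.of_isClosed_subset isSigmaCompact_univ ?_ (Set.subset_univ _)
  rw [Set.ofPred_and]
  simp only [Set.ofPred_forall]
  exact (isClosed_iInter fun i => isClosed_le continuous_const (by fun_prop)).inter
    (isClosed_iInter fun i => isClosed_iInter fun _ => isClosed_eq (by fun_prop) continuous_const)

theorem cone_subset_span (s : Set (Fin p)) {v : E} (hv : v ∈ S.cone s) :
    v ∈ Submodule.span ℝ (S.row '' s) := by
  obtain ⟨m, ⟨-, h0⟩, rfl⟩ := hv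
  refine Submodule.sum_mem _ fun i _ => ?_
  by_cases hi : i ∈ s
  · exact Submodule.smul_mem _ _ (Submodule.subset_span ⟨i, hi, rfl⟩)
  · simp [h0 i hi]

/-- The perturbation is linear in θ: it shifts the gradient by σw and leaves the Hessian unchanged.
In this form each condition is visibly measurable. -/
theorem isSSOSP_iff (hReg : S.Regularity) {θ : E} (hθ : θ ∈ S.Θ) (x : 𝓧) (w : E) :
    S.IsSSOSP θ x w ↔ (∀ i, (S.A *ᵥ WithLp.ofLp θ) i ≤ S.b i) ∧
      -(S.gradLoss₀ θ x + S.σ • w) ∈ S.cone (S.active θ) ∧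
      ((S.U (S.active θ))ᵀ * S.hessLoss₀ θ x * S.U (S.active θ)).PosDef := by
  rw [gradLoss₀_of_mem hθ, hessLoss₀_of_mem hθ, ← gradPertLoss_eq hReg hθ]
  constructor
  · intro h
    refine ⟨h.feasible, ?_, ?_⟩
    · obtain ⟨m, h1, h2, h3⟩ := h.kkt
      exact ⟨m, ⟨h1, h2⟩, by rw [eq_neg_iff_add_eq_zero, add_comm]; exact h3⟩
    · rw [← hessian_pertLoss_eq hReg hθ x w]; exact h.second_order
  · rintro ⟨h1, ⟨m, ⟨h2, h3⟩, h4⟩, h5⟩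
    refine ⟨hθ, h1, ⟨m, h2, h3, ?_⟩, ?_⟩
    · rw [eq_neg_iff_add_eq_zero, add_comm] at h4; exact h4
    · rw [hessian_pertLoss_eq hReg hθ x w]; exact h5

theorem measurable_active : Measurable (S.active : E → Set (Fin p)) := by
  have h1 : ∀ i, Measurable fun θ : E => (S.A *ᵥ WithLp.ofLp θ) i := fun i => by
    have : Continuous fun θ : E => (S.A *ᵥ WithLp.ofLp θ) i := by
      simp only [Matrix.mulVec, dotProduct]; fun_prop
    exact this.measurable
  refine measurable_set_iff.2 fun i => ?_
  exact measurable_mem.2 (measurableSet_eq_fun (h1 i) measurable_const)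

theorem transpose_U_mul_U (s : Set (Fin p)) : (S.U s)ᵀ * S.U s = 1 := by
  ext i j
  have h := orthonormal_iff_ite.1 (stdOrthonormalBasis ℝ (S.perp s)).orthonormal j i
  rw [Submodule.coe_inner] at h
  simp only [PiLp.inner_apply, RCLike.inner_apply, conj_trivial] at h
  simp only [Matrix.mul_apply, Matrix.transpose_apply, U, Matrix.of_apply, Matrix.one_apply]
  rw [h]
  simp [eq_comm]

variable (S) in
/-- The orthogonal projection onto the complement of the span of the rows with index in `s`. -/
def proj (s : Set (Fin p)) : E →L[ℝ] E :=
  Matrix.toEuclideanCLM (n := Fin d) (𝕜 := ℝ) (S.U s * (S.U s)ᵀ)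

theorem proj_eq_starProjection (s : Set (Fin p)) : S.proj s = (S.perp s).starProjection := by
  rw [(stdOrthonormalBasis ℝ (S.perp s)).starProjection_eq_sum_rankOne]
  ext v i
  simp only [proj, Matrix.ofLp_toEuclideanCLM, ← Matrix.mulVec_mulVec]
  simp only [Matrix.mulVec, dotProduct, Matrix.transpose_apply, U, Matrix.of_apply]
  simp [PiLp.inner_apply, mul_comm]

theorem proj_of_mem {s : Set (Fin p)} {v : E} (hv : v ∈ S.perp s) : S.proj s v = v := by
  rw [proj_eq_starProjection]
  exact Submodule.starProjection_eq_self_iff.2 hv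

theorem proj_of_mem_span {s : Set (Fin p)} {v : E} (hv : v ∈ Submodule.span ℝ (S.row '' s)) :
    S.proj s v = 0 := by
  rw [proj_eq_starProjection]
  exact (Submodule.starProjection_apply_eq_zero_iff _).2 (Submodule.le_orthogonal_orthogonal _ hv)

theorem proj_proj (s : Set (Fin p)) (v : E) : S.proj s (S.proj s v) = S.proj s v := by
  refine proj_of_mem ?_
  rw [proj_eq_starProjection]
  exact Submodule.starProjection_apply_mem _ _

theorem inner_row (i : Fin p) (θ : E) : inner ℝ (S.row i) θ = (S.A *ᵥ WithLp.ofLp θ) i := by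
  simp [row, PiLp.inner_apply, Matrix.mulVec, dotProduct, mul_comm]

/-- Both points satisfy the same active equations, so every active row is orthogonal to their
difference. -/
theorem sub_mem_perp {θ θ' : E} (h : S.active θ = S.active θ') : θ - θ' ∈ S.perp (S.active θ) := by
  rw [perp, Submodule.mem_orthogonal]
  intro u hu
  induction hu using Submodule.span_induction with
  | mem u hu =>
    obtain ⟨i, hi, rfl⟩ := hu
    have h1 : (S.A *ᵥ WithLp.ofLp θ) i = S.b i := hi
    have h2 : (S.A *ᵥ WithLp.ofLp θ') i = S.b i := by rw [h] at hi; exact hi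
    rw [inner_sub_right, inner_row, inner_row, h1, h2, sub_self]
  | zero => simp
  | add u v _ _ hu hv => rw [inner_add_left, hu, hv, add_zero]
  | smul c u _ hu => rw [inner_smul_left, hu, mul_zero]

variable (S) in
open Classical in
/-- The common component orthogonal to `perp s` of all points with active set `s`. -/
def basePoint (s : Set (Fin p)) : E :=
  if h : ∃ θ, S.active θ = s then h.choose - S.proj s h.choose else 0

theorem basePoint_add {θ : E} {s : Set (Fin p)} (h : S.active θ = s) :
    S.basePoint s + S.proj s θ = θ := by
  have hex : ∃ θ, S.active θ = s := ⟨θ, h⟩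
  have h1 : hex.choose - θ ∈ S.perp s := by
    have := sub_mem_perp (hex.choose_spec.trans h.symm)
    rwa [hex.choose_spec] at this
  have h2 := proj_of_mem h1
  rw [map_sub] at h2
  rw [basePoint, dif_pos hex]
  rw [sub_eq_sub_iff_add_eq_add] at h2
  rw [sub_add_eq_add_sub, sub_eq_iff_eq_add, add_comm θ, h2, add_comm]

theorem proj_basePoint (s : Set (Fin p)) : S.proj s (S.basePoint s) = 0 := by
  unfold basePoint
  split_ifs with h
  · rw [map_sub, proj_proj, sub_self]
  · exact map_zero _

variable (S) in
/-- A linear parametrization of the pairs `(θ, g)` such that `θ` has active set `s` and `g` is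
orthogonal to `perp s`. -/
def param (s : Set (Fin p)) (y : E) : E × E := (S.basePoint s + S.proj s y, y - S.proj s y)

theorem continuous_param (s : Set (Fin p)) : Continuous (S.param s) := by
  unfold param; fun_prop

theorem proj_param_add (s : Set (Fin p)) (y : E) :
    S.proj s (S.param s y).1 + (S.param s y).2 = y := by
  simp [param, proj_basePoint, proj_proj]

/-- Together with `proj_param_add` this lets y and (θ, g) determine each other, so `d` coordinates
suffice for the pair. -/
theorem param_proj_add {s : Set (Fin p)} {θ g : E} (hθ : S.active θ = s)
    (hg : g ∈ Submodule.span ℝ (S.row '' s)) : S.param s (S.proj s θ + g) = (θ, g) := by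
  simp [param, proj_proj, proj_of_mem_span hg, basePoint_add hθ]

/-! ### Recovering the noise from the solver's output -/

variable (S) in
/-- The noise that is consistent with the gradient `g` at `θ`. -/
def noiseOf (x : 𝓧) (q : E × E) : E := S.σ⁻¹ • (q.2 - S.gradLoss₀ q.1 x)

theorem gradLoss₀_add_noiseOf (x : 𝓧) (q : E × E) :
    S.gradLoss₀ q.1 x + S.σ • S.noiseOf x q = q.2 := by
  rw [noiseOf, smul_inv_smul₀ S.σ_pos.ne']
  abel

theorem noiseOf_eq_iff {x : 𝓧} {q : E × E} {w : E} :
    S.noiseOf x q = w ↔ S.gradLoss₀ q.1 x + S.σ • w = q.2 := by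
  constructor
  · rintro rfl; exact gradLoss₀_add_noiseOf x q
  · intro h
    rw [noiseOf, ← h, add_sub_cancel_left, inv_smul_smul₀ S.σ_pos.ne']

theorem measurable_noiseOf (hReg : S.Regularity) :
    Measurable fun q : 𝓧 × E × E => S.noiseOf q.1 q.2 := by
  have h := (measurable_gradLoss₀ hReg).comp
    (f := fun q : 𝓧 × E × E => (q.2.1, q.1)) (by fun_prop)
  have h2 : Measurable fun q : 𝓧 × E × E => q.2.2 := by fun_prop
  have h3 : Measurable fun q : 𝓧 × E × E => q.2.2 - S.gradLoss₀ q.2.1 q.1 := h2.sub h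
  exact h3.const_smul S.σ⁻¹

/-- As σ ≠ 0, the noise is determined by x, θ and g, which removes the existential quantifier from
`compat`. -/
theorem mem_compat_iff (hReg : S.Regularity) {x : 𝓧} {q : E × E} :
    x ∈ S.compat q.1 q.2 ↔ q.1 ∈ S.Θ ∧ S.θhat x (S.noiseOf x q) = q.1 ∧
      S.IsSSOSP q.1 x (S.noiseOf x q) := by
  constructor
  · rintro ⟨w, h1, h2, h3⟩
    have hw : S.noiseOf x q = w := by
      rw [noiseOf_eq_iff, gradLoss₀_of_mem h2.mem, h3, gradPertLoss_eq hReg h2.mem]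
    rw [hw]
    exact ⟨h2.mem, h1.symm, h2⟩
  · rintro ⟨h1, h2, h3⟩
    refine ⟨_, h2.symm, h3, ?_⟩
    rw [gradPertLoss_eq hReg h1, ← gradLoss₀_of_mem h1, gradLoss₀_add_noiseOf]

variable (S) in
/-- `Uᵀ ∇²L(θ; x) U` for the active set `s`. -/
def redHess (s : Set (Fin p)) (θ : E) (x : 𝓧) :
    Matrix (Fin (Module.finrank ℝ (S.perp s))) (Fin (Module.finrank ℝ (S.perp s))) ℝ :=
  (S.U s)ᵀ * S.hessLoss₀ θ x * S.U s

theorem measurable_redHess (hReg : S.Regularity) (s : Set (Fin p))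
    (i j : Fin (Module.finrank ℝ (S.perp s))) :
    Measurable fun q : E × 𝓧 => S.redHess s q.1 q.2 i j := by
  have := measurable_hessLoss₀ hReg
  simp only [redHess, Matrix.mul_apply]
  fun_prop

theorem measurableSet_isSSOSP_comp (hReg : S.Regularity) {Z : Type*} [MeasurableSpace Z]
    {θ w : Z → E} {X : Z → 𝓧} (hθ : Measurable θ) (hw : Measurable w) (hX : Measurable X) :
    MeasurableSet {z | S.IsSSOSP (θ z) (X z) (w z)} := by
  have h0 : {z | S.IsSSOSP (θ z) (X z) (w z)} =
      {z | θ z ∈ S.Θ} ∩ ({z | ∀ i, (S.A *ᵥ WithLp.ofLp (θ z)) i ≤ S.b i} ∩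
      ({z | -(S.gradLoss₀ (θ z) (X z) + S.σ • w z) ∈ S.cone (S.active (θ z))} ∩
      {z | (S.redHess (S.active (θ z)) (θ z) (X z)).PosDef})) := by
    ext z
    by_cases h : θ z ∈ S.Θ
    · simp only [Set.mem_inter_iff, Set.mem_ofPred_eq, isSSOSP_iff hReg h, h, true_and]; rfl
    · simp only [Set.mem_inter_iff, Set.mem_ofPred_eq, h, false_and, iff_false]
      exact fun h' => h h'.mem
  rw [h0]
  have hact : Measurable fun z => S.active (θ z) := measurable_active.comp hθ
  have hgrad : Measurable fun z => S.gradLoss₀ (θ z) (X z) :=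
    (measurable_gradLoss₀ hReg).comp (hθ.prodMk hX)
  refine (hθ (measurableSet_Θ hReg)).inter (MeasurableSet.inter ?_ (MeasurableSet.inter ?_ ?_))
  · simp only [← inner_row, Set.ofPred_forall]
    exact MeasurableSet.iInter fun i => measurableSet_le (by fun_prop) measurable_const
  · refine measurableSet_comp_countable
      (F := fun s z => -(S.gradLoss₀ (θ z) (X z) + S.σ • w z) ∈ S.cone s) (fun s => ?_) hact
    have : Measurable fun z => -(S.gradLoss₀ (θ z) (X z) + S.σ • w z) := by fun_prop
    exact this (measurableSet_cone s)
  · refine measurableSet_comp_countable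
      (F := fun s z => (S.redHess s (θ z) (X z)).PosDef) (fun s => ?_) hact
    refine measurableSet_posDef (B := fun z => S.redHess s (θ z) (X z)) fun i j => ?_
    exact Measurable.comp (g := fun q : E × 𝓧 => S.redHess s q.1 q.2 i j)
      (f := fun z => (θ z, X z)) (measurable_redHess hReg s i j) (hθ.prodMk hX)

theorem measurableSet_compat (hReg : S.Regularity) :
    MeasurableSet {q : 𝓧 × E × E | q.1 ∈ S.compat q.2.1 q.2.2} := by
  have hw := measurable_noiseOf hReg
  simp only [mem_compat_iff hReg (q := Prod.snd _)]
  have h1 : Measurable fun q : 𝓧 × E × E => S.θhat q.1 (S.noiseOf q.1 q.2) :=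
    S.θhat_measurable.comp (measurable_fst.prodMk hw)
  have h2 : Measurable fun q : 𝓧 × E × E => q.2.1 := by fun_prop
  exact (h2 (measurableSet_Θ hReg)).inter ((measurableSet_eq_fun h1 h2).inter
    (measurableSet_isSSOSP_comp hReg h2 hw measurable_fst))

variable (S) in
open Classical in
/-- The density of `(θhat, ghat)` given `x`, on the event of an SSOSP. -/
def kernelDensity (q : 𝓧 × E × E) : ℝ :=
  if q.1 ∈ S.compat q.2.1 q.2.2 then
    noisePDF d (S.noiseOf q.1 q.2) * (S.σ⁻¹ ^ d * (S.redHess (S.active q.2.1) q.2.1 q.1).det)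
  else 0

theorem measurable_kernelDensity (hReg : S.Regularity) : Measurable S.kernelDensity := by
  classical
  refine Measurable.ite (measurableSet_compat hReg) ?_ measurable_const
  refine ((continuous_noisePDF d).measurable.comp (measurable_noiseOf hReg)).mul
    (measurable_const.mul ?_)
  exact measurable_comp_countable (F := fun s (q : 𝓧 × E × E) => (S.redHess s q.2.1 q.1).det)
    (a := fun q => S.active q.2.1)
    (fun s => measurable_det_of_entries fun i j => (measurable_redHess hReg s i j).comp
      (f := fun q : 𝓧 × E × E => (q.2.1, q.1)) (by fun_prop))
    (measurable_active.comp (by fun_prop))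

/-! ### Change of variables from the noise to (θ̂, ĝ) -/

theorem hasFDerivAt_gradLoss (hReg : S.Regularity) {θ : E} (hθ : θ ∈ S.Θ) (x : 𝓧) :
    HasFDerivAt (fun t => S.gradLoss t x)
      (Matrix.toEuclideanCLM (n := Fin d) (𝕜 := ℝ) (hessian (fun t => S.loss t x) θ)ᵀ) θ := by
  rw [← hasFDerivWithinAt_univ, hasFDerivWithinAt_euclidean]
  intro i
  simp only [gradLoss_apply, hasFDerivWithinAt_univ]
  have h1 : DifferentiableAt ℝ
      (fun t => fderiv ℝ (fun t => S.loss t x) t (EuclideanSpace.single i 1)) θ :=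
    ((contDiffOn_fderiv_loss_apply hReg x _).differentiableOn (by norm_num)).differentiableAt
      (hReg.isOpen.mem_nhds hθ)
  refine h1.hasFDerivAt.congr_fderiv (ContinuousLinearMap.ext fun v => ?_)
  have hv : v = ∑ j, v j • EuclideanSpace.single j (1 : ℝ) := by
    ext k; simp [Pi.single_apply]
  conv_lhs => rw [hv]
  simp [Matrix.mulVec, dotProduct, hessian_loss_apply hReg hθ, mul_comm]

theorem hasFDerivAt_noiseOf_param (hReg : S.Regularity) (x : 𝓧) {s : Set (Fin p)} {y : E}
    (hy : (S.param s y).1 ∈ S.Θ) :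
    HasFDerivAt (fun y => S.noiseOf x (S.param s y))
      (Matrix.toEuclideanCLM (n := Fin d) (𝕜 := ℝ)
        (S.σ⁻¹ • (1 - S.U s * (S.U s)ᵀ -
          (S.hessLoss₀ (S.param s y).1 x)ᵀ * (S.U s * (S.U s)ᵀ)))) y := by
  have h1 : HasFDerivAt (fun y => S.gradLoss₀ (S.param s y).1 x)
      ((Matrix.toEuclideanCLM (n := Fin d) (𝕜 := ℝ) (S.hessLoss₀ (S.param s y).1 x)ᵀ).comp
        (S.proj s)) y := by
    have h2 : HasFDerivAt (fun t => S.gradLoss₀ t x)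
        (Matrix.toEuclideanCLM (n := Fin d) (𝕜 := ℝ) (S.hessLoss₀ (S.param s y).1 x)ᵀ)
        (S.param s y).1 := by
      rw [hessLoss₀_of_mem hy]
      refine (hasFDerivAt_gradLoss hReg hy x).congr_of_eventuallyEq ?_
      filter_upwards [hReg.isOpen.mem_nhds hy] with t ht using gradLoss₀_of_mem ht x
    exact h2.comp y (((S.proj s).hasFDerivAt (x := y)).const_add (S.basePoint s))
  have h3 : HasFDerivAt (fun y => S.noiseOf x (S.param s y))
      (S.σ⁻¹ • ((ContinuousLinearMap.id ℝ E - S.proj s) -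
        (Matrix.toEuclideanCLM (n := Fin d) (𝕜 := ℝ) (S.hessLoss₀ (S.param s y).1 x)ᵀ).comp
        (S.proj s))) y :=
    ((((hasFDerivAt_id y).sub (S.proj s).hasFDerivAt)).sub h1).const_smul S.σ⁻¹
  convert h3 using 1
  rw [map_smul, map_sub, map_sub, map_mul, map_one]
  rfl

/-- The matrix in brackets is 1 - (U + HᵀU)Uᵀ. By Sylvester's identity its determinant is that of 1
- Uᵀ(U + HᵀU) = -(UᵀHU)ᵀ, since UᵀU = 1. -/
theorem abs_det_noiseOf_param (s : Set (Fin p)) (H : Matrix (Fin d) (Fin d) ℝ) :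
    |(S.σ⁻¹ • (1 - S.U s * (S.U s)ᵀ - Hᵀ * (S.U s * (S.U s)ᵀ))).det| =
      S.σ⁻¹ ^ d * |((S.U s)ᵀ * H * S.U s).det| := by
  have h1 : (1 : Matrix (Fin d) (Fin d) ℝ) - S.U s * (S.U s)ᵀ - Hᵀ * (S.U s * (S.U s)ᵀ) =
      1 - (S.U s + Hᵀ * S.U s) * (S.U s)ᵀ := by
    rw [Matrix.add_mul, Matrix.mul_assoc, sub_sub]
  have h2 : 1 - (S.U s)ᵀ * (S.U s + Hᵀ * S.U s) = -((S.U s)ᵀ * H * S.U s)ᵀ := by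
    rw [Matrix.mul_add, transpose_U_mul_U, Matrix.transpose_mul, Matrix.transpose_mul,
      Matrix.transpose_transpose]
    abel
  rw [Matrix.det_smul, h1, Matrix.det_one_sub_mul_comm, h2, Matrix.det_neg, Matrix.det_transpose,
    abs_mul, abs_mul, abs_pow, abs_pow, abs_neg, abs_one, one_pow, one_mul, Fintype.card_fin,
    abs_of_pos (inv_pos.2 S.σ_pos)]

variable (S) in
/-- The event that the solver returns an SSOSP. -/
def success : Set (𝓧 × E) := {z | S.IsSSOSP (S.θhat z.1 z.2) z.1 z.2}

theorem measurableSet_success (hReg : S.Regularity) : MeasurableSet S.success :=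
  measurableSet_isSSOSP_comp hReg S.θhat_measurable measurable_snd measurable_fst

theorem ghat_eq (hReg : S.Regularity) (x : 𝓧) (w : E) :
    S.ghat x w = S.gradLoss₀ (S.θhat x w) x + S.σ • w := by
  rw [ghat, gradPertLoss_eq hReg (S.θhat_mem x w), gradLoss₀_of_mem (S.θhat_mem x w)]

theorem noiseOf_hat (hReg : S.Regularity) (x : 𝓧) (w : E) :
    S.noiseOf x (S.θhat x w, S.ghat x w) = w :=
  noiseOf_eq_iff.2 (ghat_eq hReg x w).symm

theorem measurable_hat (hReg : S.Regularity) :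
    Measurable fun z : 𝓧 × E => (S.θhat z.1 z.2, S.ghat z.1 z.2) := by
  refine S.θhat_measurable.prodMk ?_
  simp only [ghat_eq hReg]
  exact ((measurable_gradLoss₀ hReg).comp (S.θhat_measurable.prodMk measurable_fst)).add
    (by fun_prop)

/-- Change of variables from the noise to `(θhat, ghat)` for a given active set. -/
theorem setLIntegral_noise_eq (hReg : S.Regularity) (hd : 1 ≤ d) (x : 𝓧) (s : Set (Fin p))
    (φ : E × E → ℝ≥0∞) :
    ∫⁻ w in {w | (x, w) ∈ S.success ∧ S.active (S.θhat x w) = s},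
        φ (S.θhat x w, S.ghat x w) * ENNReal.ofReal (noisePDF d w) =
      ∫⁻ y in {y | S.active (S.param s y).1 = s},
        φ (S.param s y) * ENNReal.ofReal (S.kernelDensity (x, S.param s y)) := by
  have hparam : Measurable (S.param s) := (continuous_param s).measurable
  set D : Set E := {y | x ∈ S.compat (S.param s y).1 (S.param s y).2}
  set A : Set E := {y | S.active (S.param s y).1 = s}
  have hD : MeasurableSet D := (measurable_const.prodMk hparam) (measurableSet_compat hReg)
  have hA : MeasurableSet A :=
    (measurable_active.comp hparam.fst) (measurableSet_singleton s)
  have hat : ∀ y ∈ D, (S.θhat x (S.noiseOf x (S.param s y)),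
      S.ghat x (S.noiseOf x (S.param s y))) = S.param s y := fun y hy => by
    have h1 := ((mem_compat_iff hReg).1 hy).2.1
    refine Prod.ext h1 ?_
    rw [ghat_eq hReg, h1, gradLoss₀_add_noiseOf]
  -- Surjectivity uses the KKT condition: it puts ĝ in the span of the active rows, so (θ̂, ĝ) is in
  -- the range of `param`.
  have himage : (fun y => S.noiseOf x (S.param s y)) '' (D ∩ A) =
      {w | (x, w) ∈ S.success ∧ S.active (S.θhat x w) = s} := by
    ext w
    constructor
    · rintro ⟨y, ⟨hy, hyA⟩, rfl⟩
      have h1 := (mem_compat_iff hReg).1 hy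
      refine ⟨?_, ?_⟩
      · change S.IsSSOSP _ _ _
        rw [h1.2.1]; exact h1.2.2
      · rw [h1.2.1]; exact hyA
    · rintro ⟨h1, h2⟩
      have hθ := S.θhat_mem x w
      have h3 := ((isSSOSP_iff hReg hθ x w).1 h1).2.1
      rw [← ghat_eq hReg, h2] at h3
      have h4 := S.param_proj_add h2 (by simpa using cone_subset_span s h3)
      refine ⟨S.proj s (S.θhat x w) + S.ghat x w, ⟨?_, ?_⟩, ?_⟩
      · change x ∈ S.compat _ _
        rw [h4]
        exact ⟨w, rfl, h1, rfl⟩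
      · change S.active _ = s
        rw [h4]; exact h2
      · simp only [h4]
        rw [noiseOf_hat hReg]
  -- The solver is a function of x and w, so w determines (θ̂, ĝ) and hence y.
  have hinj : Set.InjOn (fun y => S.noiseOf x (S.param s y)) (D ∩ A) := by
    intro y hy y' hy' h
    dsimp only at h
    rw [← proj_param_add (S := S) s y, ← proj_param_add (S := S) s y', ← hat y hy.1,
      ← hat y' hy'.1, h]
  rw [← himage, lintegral_image_eq_lintegral_abs_det_fderiv_mul volume (hD.inter hA)
    (fun y hy => (hasFDerivAt_noiseOf_param hReg x
      ((mem_compat_iff hReg).1 hy.1).1).hasFDerivWithinAt) hinj,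
    ← Measure.restrict_restrict hD, ← lintegral_indicator hD]
  refine setLIntegral_congr_fun hA fun y hyA => ?_
  by_cases hy : y ∈ D
  · have hy' : (x, S.param s y).1 ∈ S.compat (x, S.param s y).2.1 (x, S.param s y).2.2 := hy
    rw [Set.indicator_of_mem hy, hat y hy, kernelDensity, if_pos hy', det_toEuclideanCLM,
      abs_det_noiseOf_param]
    have hyA' : S.active (S.param s y).1 = s := hyA
    have h2 := ((mem_compat_iff hReg).1 hy)
    have h3 := ((isSSOSP_iff hReg h2.1 x _).1 h2.2.2).2.2
    dsimp only
    rw [redHess, hyA']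
    rw [hyA'] at h3
    -- Strict second-order stationarity makes the determinant positive, so the absolute value can be
    -- dropped.
    rw [abs_of_pos h3.det_pos, mul_left_comm, ENNReal.ofReal_mul (noisePDF_pos hd _).le]
    congr 1
    rw [mul_comm]
  · have hy' : (x, S.param s y).1 ∉ S.compat (x, S.param s y).2.1 (x, S.param s y).2.2 := hy
    rw [Set.indicator_of_notMem hy, kernelDensity, if_neg hy']
    simp

variable (S) in
/-- The base measure for `(θhat, ghat)`: on the pairs for which `θhat` has active set `s` it is the
`d`-dimensional Lebesgue measure on the possible pairs. -/
def pairMeasure : Measure (E × E) :=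
  Measure.sum fun s => (volume.map (S.param s)).restrict {q | S.active q.1 = s}

instance : SFinite S.pairMeasure := by
  unfold pairMeasure; infer_instance

theorem lintegral_success_noise (hReg : S.Regularity) (hd : 1 ≤ d) (x : 𝓧)
    {φ : E × E → ℝ≥0∞} (hφ : Measurable φ) :
    ∫⁻ w, S.success.indicator (fun z => φ (S.θhat z.1 z.2, S.ghat z.1 z.2)) (x, w) ∂noise d =
      ∫⁻ q, ENNReal.ofReal (S.kernelDensity (x, q)) * φ q ∂S.pairMeasure := by
  have hk : Measurable fun q => S.kernelDensity (x, q) :=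
    (measurable_kernelDensity hReg).comp measurable_prodMk_left
  have hS : MeasurableSet {w | (x, w) ∈ S.success} :=
    measurable_prodMk_left (measurableSet_success hReg)
  have hθ : Measurable fun w => S.θhat x w := S.θhat_measurable.comp measurable_prodMk_left
  have hhat : Measurable fun w => (S.θhat x w, S.ghat x w) :=
    (measurable_hat hReg).comp measurable_prodMk_left
  have hφ' : Measurable fun w => φ (S.θhat x w, S.ghat x w) := hφ.comp hhat
  have hactive : ∀ s, MeasurableSet {w | S.active (S.θhat x w) = s} := fun s =>
    (measurable_active.comp hθ) (measurableSet_singleton s)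
  have hactive' : ∀ s, MeasurableSet {q : E × E | S.active q.1 = s} := fun s =>
    (measurable_active.comp measurable_fst) (measurableSet_singleton s)
  have h1 : ∫⁻ w, S.success.indicator (fun z => φ (S.θhat z.1 z.2, S.ghat z.1 z.2)) (x, w) ∂noise d
      = ∫⁻ w in {w | (x, w) ∈ S.success},
        φ (S.θhat x w, S.ghat x w) * ENNReal.ofReal (noisePDF d w) := by
    rw [noise_eq_withDensity hd, lintegral_withDensity_eq_lintegral_mul _
      (continuous_noisePDF d).measurable.ennreal_ofReal]
    · rw [← lintegral_indicator hS]
      refine lintegral_congr fun w => ?_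
      by_cases hw : (x, w) ∈ S.success
      · have hw' : w ∈ {w | (x, w) ∈ S.success} := hw
        rw [Pi.mul_apply, Set.indicator_of_mem hw, Set.indicator_of_mem hw', mul_comm]
      · have hw' : w ∉ {w | (x, w) ∈ S.success} := hw
        rw [Pi.mul_apply, Set.indicator_of_notMem hw, Set.indicator_of_notMem hw', mul_zero]
    · exact ((hφ.comp (measurable_hat hReg)).indicator (measurableSet_success hReg)).comp
        measurable_prodMk_left
  -- The finitely many active sets partition the event; each piece has its own change of variables.
  have h2 : {w | (x, w) ∈ S.success} =
      ⋃ s : Set (Fin p), {w | (x, w) ∈ S.success ∧ S.active (S.θhat x w) = s} := by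
    ext w; simp
  have h3 : ∀ s : Set (Fin p),
      MeasurableSet {w | (x, w) ∈ S.success ∧ S.active (S.θhat x w) = s} :=
    fun s => hS.inter (hactive s)
  rw [h1, h2, lintegral_iUnion h3, pairMeasure,
    lintegral_sum_measure]
  · refine tsum_congr fun s => ?_
    rw [setLIntegral_noise_eq hReg hd, Measure.restrict_map (continuous_param s).measurable
      (hactive' s), lintegral_map (by fun_prop) (continuous_param s).measurable]
    simp only [mul_comm]
    rfl
  · intro s t hst
    refine Set.disjoint_left.2 fun w hw hw' => hst (hw.2.symm.trans hw'.2)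

/-- The base measure has the finite density 1/f with respect to a finite measure. This is what
allows Fubini for `ν`. -/
theorem sigmaFinite_of_density {ν : Measure 𝓧} {f : 𝓧 → ℝ} (hf : Measurable f)
    (hpos : ∀ x, 0 < f x) [IsFiniteMeasure (ν.withDensity fun x => ENNReal.ofReal (f x))] :
    SigmaFinite ν := by
  rw [← withDensity_inv_same hf.ennreal_ofReal (μ := ν)
    (Filter.Eventually.of_forall fun x => by simpa using hpos x)
    (Filter.Eventually.of_forall fun x => by simp)]
  exact SigmaFinite.withDensity_of_ne_top
    (Filter.Eventually.of_forall fun x => by simpa using hpos x)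

theorem sigmaFinite_ν (hReg : S.Regularity) {θ : E} (hθ : θ ∈ S.Θ) : SigmaFinite S.ν := by
  have : IsProbabilityMeasure (S.ν.withDensity fun x => ENNReal.ofReal (S.f θ x)) :=
    hReg.isProbabilityMeasure θ hθ
  exact sigmaFinite_of_density (hReg.measurable_density θ hθ) (hReg.density_pos θ hθ)

/-- The joint density of `(X, θhat, ghat)` on the event of an SSOSP. -/
theorem setLIntegral_success (hReg : S.Regularity) (hd : 1 ≤ d) {θ₀ : E} (hθ₀ : θ₀ ∈ S.Θ)
    {φ : 𝓧 × E × E → ℝ≥0∞} (hφ : Measurable φ) :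
    ∫⁻ z in S.success, φ (z.1, S.θhat z.1 z.2, S.ghat z.1 z.2) ∂((S.P θ₀).prod (noise d)) =
      ∫⁻ q, ∫⁻ x, ENNReal.ofReal (S.f θ₀ x) * ENNReal.ofReal (S.kernelDensity (x, q)) * φ (x, q)
        ∂S.ν ∂S.pairMeasure := by
  have := sigmaFinite_ν hReg hθ₀
  have hf := hReg.measurable_density θ₀ hθ₀
  have hk := measurable_kernelDensity hReg
  have hφ' : Measurable fun z : 𝓧 × E => φ (z.1, S.θhat z.1 z.2, S.ghat z.1 z.2) :=
    hφ.comp (measurable_fst.prodMk (measurable_hat hReg))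
  have := hReg.isProbabilityMeasure θ₀ hθ₀
  rw [← lintegral_indicator (measurableSet_success hReg),
    lintegral_prod _ (hφ'.indicator (measurableSet_success hReg)).aemeasurable]
  have h1 : ∀ x, ∫⁻ w, S.success.indicator
      (fun z => φ (z.1, S.θhat z.1 z.2, S.ghat z.1 z.2)) (x, w) ∂noise d =
      ∫⁻ q, ENNReal.ofReal (S.kernelDensity (x, q)) * φ (x, q) ∂S.pairMeasure := fun x => by
    rw [← lintegral_success_noise hReg hd x (φ := fun q => φ (x, q))
      (hφ.comp measurable_prodMk_left)]
    rfl
  simp only [h1]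
  have h2 : Measurable fun x =>
      ∫⁻ q, ENNReal.ofReal (S.kernelDensity (x, q)) * φ (x, q) ∂S.pairMeasure :=
    Measurable.lintegral_prod_right'
      (f := fun z : 𝓧 × E × E => ENNReal.ofReal (S.kernelDensity z) * φ z) (by fun_prop)
  rw [P, lintegral_withDensity_eq_lintegral_mul _ hf.ennreal_ofReal h2,
    lintegral_lintegral_swap (by fun_prop)]
  refine lintegral_congr fun x => ?_
  rw [Pi.mul_apply, ← lintegral_const_mul _ (by fun_prop)]
  simp only [mul_assoc]

/-! ### Hessian concentration and comparison of likelihood ratios -/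

theorem neg_log_density_eq (x : 𝓧) :
    (fun t => -Real.log (S.f t x)) = fun t => S.loss t x - S.R t := by
  funext t; simp [loss]

theorem eventually_fderiv_neg_log (hReg : S.Regularity) {θ : E} (hθ : θ ∈ S.Θ) (x : 𝓧) :
    ∀ᶠ t in nhds θ, HasFDerivAt (fun t => S.loss t x - S.R t)
      (fderiv ℝ (fun t => S.loss t x) t - fderiv ℝ S.R t) t := by
  filter_upwards [hReg.isOpen.mem_nhds hθ] with t ht
  exact (differentiableAt_loss hReg ht x).hasFDerivAt.sub
    (S.R_differentiable.differentiableAt (hReg.isOpen.mem_nhds ht)).hasFDerivAt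

theorem hasFDerivAt_fderiv_neg_log (hReg : S.Regularity) {θ : E} (hθ : θ ∈ S.Θ) (x : 𝓧) :
    HasFDerivAt (fun t => fderiv ℝ (fun t => S.loss t x) t - fderiv ℝ S.R t)
      (fderiv ℝ (fderiv ℝ fun t => S.loss t x) θ - fderiv ℝ (fderiv ℝ S.R) θ) θ :=
  (differentiableAt_fderiv_loss hReg hθ x).hasFDerivAt.sub
    (S.R_twice_differentiable.differentiableAt (hReg.isOpen.mem_nhds hθ)).hasFDerivAt

theorem fderiv_fderiv_neg_log (hReg : S.Regularity) {θ : E} (hθ : θ ∈ S.Θ) (x : 𝓧) :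
    fderiv ℝ (fderiv ℝ fun t => S.loss t x - S.R t) θ =
      fderiv ℝ (fderiv ℝ fun t => S.loss t x) θ - fderiv ℝ (fderiv ℝ S.R) θ := by
  have h1 : fderiv ℝ (fun t => S.loss t x - S.R t) =ᶠ[nhds θ]
      fun t => fderiv ℝ (fun t => S.loss t x) t - fderiv ℝ S.R t :=
    (eventually_fderiv_neg_log hReg hθ x).mono fun t ht => ht.fderiv
  rw [h1.fderiv_eq, (hasFDerivAt_fderiv_neg_log hReg hθ x).fderiv]

theorem negHess_eq (hReg : S.Regularity) {θ : E} (hθ : θ ∈ S.Θ) (x : 𝓧) :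
    S.negHess θ x = hessian (fun t => S.loss t x) θ - hessian S.R θ := by
  ext i j
  simp only [negHess, neg_log_density_eq, hessian, Matrix.of_apply, iteratedFDeriv_two_apply,
    fderiv_fderiv_neg_log hReg hθ, Matrix.sub_apply]
  rfl

/-- R is twice differentiable but need not be C², so symmetry is drawn from differentiability of the
first derivative at the point. -/
theorem isHermitian_negHess (hReg : S.Regularity) {θ : E} (hθ : θ ∈ S.Θ) (x : 𝓧) :
    (S.negHess θ x).IsHermitian := by
  ext i j
  simp only [Matrix.conjTranspose_apply, star_trivial, negHess, neg_log_density_eq, hessian,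
    Matrix.of_apply, iteratedFDeriv_two_apply, fderiv_fderiv_neg_log hReg hθ]
  exact second_derivative_symmetric_of_eventually (eventually_fderiv_neg_log hReg hθ x)
    (hasFDerivAt_fderiv_neg_log hReg hθ x) _ _

theorem isHermitian_meanNegHess (hReg : S.Regularity) (θ₀ : E) {θ : E} (hθ : θ ∈ S.Θ) :
    (S.meanNegHess θ₀ θ).IsHermitian := by
  ext i j
  simp only [Matrix.conjTranspose_apply, star_trivial, meanNegHess, Matrix.of_apply]
  congr 1
  funext x
  exact (isHermitian_negHess hReg hθ x).apply i j

theorem measurable_negHess (hReg : S.Regularity) {θ : E} (hθ : θ ∈ S.Θ) (i j : Fin d) :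
    Measurable fun x => S.negHess θ x i j := by
  simp only [negHess_eq hReg hθ, Matrix.sub_apply]
  exact (measurable_hessian_loss hReg hθ i j).sub_const _

theorem measurable_dotProduct_mulVec {B : 𝓧 → Matrix (Fin d) (Fin d) ℝ}
    (hB : ∀ i j, Measurable fun x => B x i j) (v : Fin d → ℝ) :
    Measurable fun x => v ⬝ᵥ B x *ᵥ v := by
  simp only [Matrix.mulVec, dotProduct]
  fun_prop

/-- Measurable envelopes of the two suprema of `HessianConcentration`, which together control the
differences of the Hessians of the loss. -/
theorem exists_envelopes (hReg : S.Regularity) {r ε : E → ℝ}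
    (hHess : S.HessianConcentration r ε) {θ₀ : E} (hθ₀ : θ₀ ∈ S.Θ) :
    ∃ Fu Fl : 𝓧 → ℝ≥0∞, Measurable Fu ∧ Measurable Fl ∧
      ∫⁻ x, Fl x ∂S.P θ₀ ≤ ENNReal.ofReal (ε θ₀) ∧
      ∫⁻ x, EReal.exp (Fu x) ∂S.P θ₀ ≤ ENNReal.ofReal (Real.exp (ε θ₀)) ∧
      ∀ x x', Fu x' ≠ ∞ → Fl x ≠ ∞ → ∀ θ ∈ Metric.closedBall θ₀ (r θ₀) ∩ S.Θ, ∀ v : E,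
        ‖v‖ ≤ r θ₀ → v.ofLp ⬝ᵥ (hessian (fun t => S.loss t x') θ -
          hessian (fun t => S.loss t x) θ) *ᵥ v.ofLp ≤ (Fu x').toReal + (Fl x).toReal := by
  -- The suprema over θ in the assumption may fail to be measurable. Suprema of quadratic forms over
  -- a countable dense set of pairs (θ, v) are measurable and no larger.
  set T : Set (E × E) := (Metric.closedBall θ₀ (r θ₀) ∩ S.Θ) ×ˢ {v | ‖v‖ ≤ r θ₀}
  obtain ⟨D, hDT, hDc, hTD⟩ :=
    (TopologicalSpace.IsSeparable.of_separableSpace T).exists_countable_dense_subset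
  let gu : E × E → 𝓧 → ℝ := fun q x =>
    q.2.ofLp ⬝ᵥ (S.negHess q.1 x - S.meanNegHess θ₀ q.1) *ᵥ q.2.ofLp
  let gl : E × E → 𝓧 → ℝ := fun q x =>
    q.2.ofLp ⬝ᵥ (S.meanNegHess θ₀ q.1 - S.negHess q.1 x) *ᵥ q.2.ofLp
  have hgu : ∀ q ∈ D, Measurable (gu q) := fun q hq => measurable_dotProduct_mulVec
    (fun i j => (measurable_negHess hReg (hDT hq).1.2 i j).sub_const _) _
  have hgl : ∀ q ∈ D, Measurable (gl q) := fun q hq => measurable_dotProduct_mulVec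
    (fun i j => (measurable_negHess hReg (hDT hq).1.2 i j).const_sub _) _
  refine ⟨fun x => ⨆ q ∈ D, ENNReal.ofReal (gu q x), fun x => ⨆ q ∈ D, ENNReal.ofReal (gl q x),
    Measurable.biSup D hDc fun q hq => (hgu q hq).ennreal_ofReal,
    Measurable.biSup D hDc fun q hq => (hgl q hq).ennreal_ofReal, ?_, ?_, ?_⟩
  · refine (lintegral_mono fun x => ?_).trans (hHess.lower θ₀ hθ₀)
    refine iSup₂_le fun q hq => ?_
    refine le_trans (ENNReal.ofReal_le_ofReal ?_) (le_iSup₂ (f := fun θ _ =>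
      ENNReal.ofReal (r θ₀ ^ 2 * max (lambdaMax (S.meanNegHess θ₀ θ - S.negHess θ x)) 0)) q.1 (hDT hq).1)
    exact dotProduct_mulVec_le_sq_mul ((isHermitian_meanNegHess hReg θ₀ (hDT hq).1.2).sub
      (isHermitian_negHess hReg (hDT hq).1.2 x)) (hDT hq).2
  · have h1 := EReal.exp_monotone (hHess.upper θ₀ hθ₀)
    rw [ENNReal.exp_log, EReal.exp_coe] at h1
    refine (lintegral_mono fun x => EReal.exp_monotone ?_).trans h1
    refine EReal.coe_ennreal_le_coe_ennreal_iff.2 (iSup₂_le fun q hq => ?_)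
    refine le_trans (ENNReal.ofReal_le_ofReal ?_) (le_iSup₂ (f := fun θ _ =>
      ENNReal.ofReal (r θ₀ ^ 2 * max (lambdaMax (S.negHess θ x - S.meanNegHess θ₀ θ)) 0)) q.1 (hDT hq).1)
    exact dotProduct_mulVec_le_sq_mul ((isHermitian_negHess hReg (hDT hq).1.2 x).sub
      (isHermitian_meanNegHess hReg θ₀ (hDT hq).1.2)) (hDT hq).2
  · intro x x' hu hl θ hθ v hv
    have hmem : (θ, v) ∈ T := ⟨hθ, hv⟩
    -- `negHess` and its mean need not be continuous in θ. In the difference between two data values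
    -- the mean and the Hessian of R cancel, and what remains extends by continuity from the dense
    -- set.
    have hcont : ContinuousOn (fun q : E × E => q.2.ofLp ⬝ᵥ (hessian (fun t => S.loss t x') q.1 -
        hessian (fun t => S.loss t x) q.1) *ᵥ q.2.ofLp) T := by
      have h1 : ∀ x i j, ContinuousOn
          (fun q : E × E => hessian (fun t => S.loss t x) q.1 i j) T := fun x i j =>
        (continuousOn_hessian_loss hReg x i j).comp continuousOn_fst fun q hq => hq.1.2
      have h2 : ∀ i : Fin d, ContinuousOn (fun q : E × E => q.2 i) T := fun i => by fun_prop
      simp only [dotProduct, Matrix.mulVec, Matrix.sub_apply]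
      exact continuousOn_finsetSum _ fun i _ => (h2 i).mul
        (continuousOn_finsetSum _ fun j _ => ((h1 x' i j).sub (h1 x i j)).mul (h2 j))
    refine ContinuousWithinAt.closure_le (s := D) (x := (θ, v)) (f := fun q : E × E =>
      q.2.ofLp ⬝ᵥ (hessian (fun t => S.loss t x') q.1 -
        hessian (fun t => S.loss t x) q.1) *ᵥ q.2.ofLp) (hTD hmem)
      ((hcont _ hmem).mono hDT) continuousWithinAt_const fun q hq => ?_
    have hle : ∀ {g : E × E → 𝓧 → ℝ} {x}, (⨆ q ∈ D, ENNReal.ofReal (g q x)) ≠ ∞ →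
        g q x ≤ (⨆ q ∈ D, ENNReal.ofReal (g q x)).toReal := fun {g x} h => by
      rw [← ENNReal.ofReal_le_iff_le_toReal h]
      exact le_iSup₂ (f := fun q (_ : q ∈ D) => ENNReal.ofReal (g q x)) q hq
    refine le_trans (le_of_eq ?_) (add_le_add (hle hu) (hle hl))
    simp only [gu, gl]
    rw [← dotProduct_add, ← Matrix.add_mulVec, negHess_eq hReg (hDT hq).1.2,
      negHess_eq hReg (hDT hq).1.2]
    congr 2
    abel

/-- The second-order comparison of the loss at two data values. -/
theorem loss_sub_le (hReg : S.Regularity) {θ θ₀ : E} (hθ : θ ∈ S.Θ) (hθ₀ : θ₀ ∈ S.Θ) (x x' : 𝓧)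
    {C : ℝ} (hC : ∀ t ∈ segment ℝ θ θ₀, (θ₀ - θ).ofLp ⬝ᵥ (hessian (fun t => S.loss t x') t -
      hessian (fun t => S.loss t x) t) *ᵥ (θ₀ - θ).ofLp ≤ C) :
    S.loss θ₀ x' - S.loss θ₀ x ≤ S.loss θ x' - S.loss θ x +
      inner ℝ (S.gradLoss θ x' - S.gradLoss θ x) (θ₀ - θ) + C / 2 := by
  set v := θ₀ - θ with hv
  have hseg : ∀ s ∈ Set.Icc (0 : ℝ) 1, θ + s • v ∈ segment ℝ θ θ₀ := fun s hs => by
    rw [segment_eq_image']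
    exact ⟨s, hs, rfl⟩
  have hmem : ∀ s ∈ Set.Icc (0 : ℝ) 1, θ + s • v ∈ S.Θ := fun s hs =>
    hReg.convex.segment_subset hθ hθ₀ (hseg s hs)
  have hline : ∀ s : ℝ, HasDerivAt (fun s : ℝ => θ + s • v) v s := fun s => by
    simpa using ((hasDerivAt_id s).smul_const v).const_add θ
  have hloss : ∀ x, ∀ s ∈ Set.Icc (0 : ℝ) 1, HasDerivAt (fun s : ℝ => S.loss (θ + s • v) x)
      (inner ℝ (S.gradLoss (θ + s • v) x) v) s := fun x s hs => by
    rw [inner_gradLoss]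
    exact (differentiableAt_loss hReg (hmem s hs) x).hasFDerivAt.comp_hasDerivAt s (hline s)
  have hgrad : ∀ x, ∀ s ∈ Set.Icc (0 : ℝ) 1,
      HasDerivAt (fun s : ℝ => inner ℝ (S.gradLoss (θ + s • v) x) v)
      (v.ofLp ⬝ᵥ hessian (fun t => S.loss t x) (θ + s • v) *ᵥ v.ofLp) s := fun x s hs => by
    have h1 := (hasFDerivAt_gradLoss hReg (hmem s hs) x).comp_hasDerivAt s (hline s)
    have h2 := h1.inner ℝ (hasDerivAt_const s v)
    refine h2.congr_deriv ?_
    rw [inner_zero_right, zero_add, real_inner_comm, Matrix.inner_toEuclideanCLM,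
      Matrix.mulVec_transpose, dotProduct_comm, Matrix.dotProduct_mulVec]
  have h := le_add_add_half_of_hasDerivAt
    (φ := fun s : ℝ => S.loss (θ + s • v) x' - S.loss (θ + s • v) x)
    (φ' := fun s : ℝ => inner ℝ (S.gradLoss (θ + s • v) x') v -
      inner ℝ (S.gradLoss (θ + s • v) x) v)
    (fun s hs => (hloss x' s hs).sub (hloss x s hs))
    (fun s hs => (hgrad x' s hs).sub (hgrad x s hs)) (C := C)
    (fun s hs => by
      rw [← dotProduct_sub, ← Matrix.sub_mulVec]
      exact hC _ (hseg s hs))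
  simpa [hv, inner_sub_left] using h

/-- Comparison of likelihood ratios at two data values. -/
theorem density_mul_le (hReg : S.Regularity) {r : ℝ} {θ₀ : E} (hθ₀ : θ₀ ∈ S.Θ) {q : E × E}
    (hθ : q.1 ∈ S.Θ) (hr : ‖q.1 - θ₀‖ ≤ r) {x x' : 𝓧} {a b : ℝ}
    (hab : ∀ θ ∈ Metric.closedBall θ₀ r ∩ S.Θ, ∀ v : E,
        ‖v‖ ≤ r → v.ofLp ⬝ᵥ (hessian (fun t => S.loss t x') θ -
          hessian (fun t => S.loss t x) θ) *ᵥ v.ofLp ≤ a + b) :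
    S.f q.1 x' * S.f θ₀ x ≤
      S.f θ₀ x' * Real.exp (S.σ * r * ‖S.noiseOf x' q‖ + a / 2) *
        (S.f q.1 x * Real.exp (S.σ * r * ‖S.noiseOf x q‖ + b / 2)) := by
  have hr0 : 0 ≤ r := (norm_nonneg _).trans hr
  have hθ' : q.1 ∈ Metric.closedBall θ₀ r := by rwa [mem_closedBall_iff_norm]
  have h1 := loss_sub_le hReg hθ hθ₀ x x' (C := a + b) fun t ht => hab t
    ⟨(convex_closedBall θ₀ r).segment_subset hθ' (Metric.mem_closedBall_self hr0) ht,
      hReg.convex.segment_subset hθ hθ₀ ht⟩ _ (by rwa [norm_sub_rev])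
  -- Both data values are paired with the same g, so ∇L + σw agrees at the two.
  have h2 : S.gradLoss q.1 x' - S.gradLoss q.1 x =
      S.σ • (S.noiseOf x q - S.noiseOf x' q) := by
    have e1 := S.gradLoss₀_add_noiseOf x q
    have e2 := S.gradLoss₀_add_noiseOf x' q
    rw [gradLoss₀_of_mem hθ] at e1 e2
    rw [smul_sub, eq_sub_of_add_eq e1, eq_sub_of_add_eq e2]
    abel
  have h3 : inner ℝ (S.gradLoss q.1 x' - S.gradLoss q.1 x) (θ₀ - q.1) ≤
      S.σ * r * ‖S.noiseOf x' q‖ + S.σ * r * ‖S.noiseOf x q‖ := by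
    rw [h2, inner_smul_left]
    calc S.σ * inner ℝ (S.noiseOf x q - S.noiseOf x' q) (θ₀ - q.1)
        ≤ S.σ * (‖S.noiseOf x q - S.noiseOf x' q‖ * ‖θ₀ - q.1‖) :=
          mul_le_mul_of_nonneg_left (real_inner_le_norm _ _) S.σ_pos.le
      _ ≤ S.σ * ((‖S.noiseOf x q‖ + ‖S.noiseOf x' q‖) * r) := by
          have := S.σ_pos.le
          gcongr
          · exact norm_sub_le _ _
          · rwa [norm_sub_rev]
      _ = _ := by ring
  have p1 := hReg.density_pos q.1 hθ x
  have p2 := hReg.density_pos q.1 hθ x'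
  have p3 := hReg.density_pos θ₀ hθ₀ x
  have p4 := hReg.density_pos θ₀ hθ₀ x'
  rw [← Real.log_le_log_iff (by positivity) (by positivity), Real.log_mul p2.ne' p3.ne',
    Real.log_mul (by positivity) (by positivity), Real.log_mul p4.ne' (by positivity),
    Real.log_mul p1.ne' (by positivity), Real.log_exp, Real.log_exp]
  -- The regularizer cancels, leaving only log-densities.
  simp only [loss] at h1
  linarith

variable (S) in
/-- The factor between the conditional density and `unDensity`. -/
def scale : ℝ := (2 * Real.pi / d) ^ (-(d / 2 : ℝ)) * S.σ⁻¹ ^ d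

theorem scale_pos (hd : 1 ≤ d) : 0 < S.scale := by
  have h1 : (0 : ℝ) < d := by exact_mod_cast hd
  have h2 := S.σ_pos
  unfold scale
  positivity

/-- The exponential factor of `unDensity` is the Gaussian density at the recovered noise and the
determinant is the Jacobian; the constants left over do not depend on x and disappear on
normalization. -/
theorem density₀_mul_kernelDensity (hd : 1 ≤ d) {y : E × E} (hy : y.1 ∈ S.Θ) (x : 𝓧) :
    S.density₀ y.1 x * S.kernelDensity (x, y) = S.scale * S.unDensity y.1 y.2 x := by
  have h1 : (d : ℝ) ≠ 0 := by have : (0 : ℝ) < d := by exact_mod_cast hd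
                              exact this.ne'
  have h2 := S.σ_pos.ne'
  rw [density₀_of_mem hy, kernelDensity, unDensity, scale]
  by_cases h : x ∈ S.compat y.1 y.2
  · have h' : (x, y).1 ∈ S.compat (x, y).2.1 (x, y).2.2 := h
    rw [if_pos h', if_pos h, noisePDF, redHess]
    dsimp only
    rw [hessLoss₀_of_mem hy, noiseOf, gradLoss₀_of_mem hy, norm_smul, mul_pow, norm_inv,
      Real.norm_of_nonneg S.σ_pos.le]
    have h3 : -(d / 2 : ℝ) * (S.σ⁻¹ ^ 2 * ‖y.2 - S.gradLoss y.1 x‖ ^ 2) =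
        -(‖y.2 - S.gradLoss y.1 x‖ ^ 2 / (2 * S.σ ^ 2 / (d : ℝ))) := by field_simp
    rw [h3]
    ring
  · have h' : ¬ (x, y).1 ∈ S.compat (x, y).2.1 (x, y).2.2 := h
    rw [if_neg h', if_neg h]
    simp

theorem ofReal_density₀_mul (hReg : S.Regularity) (hd : 1 ≤ d) {y : E × E} (hy : y.1 ∈ S.Θ)
    (x : 𝓧) : ENNReal.ofReal (S.density₀ y.1 x) * ENNReal.ofReal (S.kernelDensity (x, y)) =
      ENNReal.ofReal S.scale * ENNReal.ofReal (S.unDensity y.1 y.2 x) := by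
  rw [← ENNReal.ofReal_mul (by rw [density₀_of_mem hy]; exact (hReg.density_pos _ hy x).le),
    density₀_mul_kernelDensity hd hy, ENNReal.ofReal_mul (scale_pos hd).le]

theorem measurable_density₀_right (hReg : S.Regularity) (θ : E) : Measurable (S.density₀ θ) :=
  (measurable_density₀ hReg).comp (f := fun x => (θ, x)) (by fun_prop)

theorem measurable_kernelDensity_left (hReg : S.Regularity) (y : E × E) :
    Measurable fun x => S.kernelDensity (x, y) :=
  (measurable_kernelDensity hReg).comp (f := fun x => (x, y)) (by fun_prop)

theorem measurable_unDensity (hReg : S.Regularity) (hd : 1 ≤ d) {y : E × E} (hy : y.1 ∈ S.Θ) :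
    Measurable (S.unDensity y.1 y.2) := by
  have h1 : S.unDensity y.1 y.2 =
      fun x => S.scale⁻¹ * (S.density₀ y.1 x * S.kernelDensity (x, y)) := by
    funext x
    rw [density₀_mul_kernelDensity hd hy, inv_mul_cancel_left₀ (scale_pos hd).ne']
  rw [h1]
  exact ((measurable_density₀_right hReg _).mul (measurable_kernelDensity_left hReg _)).const_mul _

/-! ### The sampler under the plug-in law -/

variable {M : ℕ}

/-- Appending the copies to the data. -/
def joinCopies (z : (𝓧 × E × E) × (Fin M → 𝓧)) : Fin (M + 1) → 𝓧 := Fin.cons z.1.1 z.2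

theorem measurable_cons : Measurable fun z : 𝓧 × (Fin M → 𝓧) =>
    (Fin.cons z.1 z.2 : Fin (M + 1) → 𝓧) := by
  refine measurable_pi_lambda _ fun i => ?_
  refine Fin.cases ?_ (fun j => ?_) i
  · simpa using measurable_fst
  · simp only [Fin.cons_succ]
    fun_prop

theorem measurable_joinCopies : Measurable (joinCopies (𝓧 := 𝓧) (d := d) (M := M)) :=
  measurable_cons.comp (f := fun z : (𝓧 × E × E) × (Fin M → 𝓧) => (z.1.1, z.2)) (by fun_prop)

section Sampler

variable (Pt : Kernel (𝓧 × EuclideanSpace ℝ (Fin d) × EuclideanSpace ℝ (Fin d)) (Fin M → 𝓧))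

/-- The conditional probability that the data and the copies are in `A`. -/
def copiesProb (A : Set (Fin (M + 1) → 𝓧)) (q : 𝓧 × E × E) : ℝ≥0∞ :=
  Pt q {xt | (Fin.cons q.1 xt : Fin (M + 1) → 𝓧) ∈ A}

variable [IsMarkovKernel Pt]

theorem measurable_copiesProb {A : Set (Fin (M + 1) → 𝓧)} (hA : MeasurableSet A) :
    Measurable (copiesProb Pt A) :=
  Kernel.measurable_kernel_prodMk_left (κ := Pt) (measurable_joinCopies hA)

theorem copiesProb_le_one (A : Set (Fin (M + 1) → 𝓧)) (q : 𝓧 × E × E) : copiesProb Pt A q ≤ 1 :=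
  prob_le_one

/-- The law of the data and the copies, when `(x, θ, g)` has law `m`. -/
def joinLaw (m : Measure (𝓧 × E × E)) : Measure (Fin (M + 1) → 𝓧) := (m ⊗ₘ Pt).map joinCopies

theorem joinLaw_apply (m : Measure (𝓧 × E × E)) [SFinite m] {A : Set (Fin (M + 1) → 𝓧)}
    (hA : MeasurableSet A) : joinLaw Pt m A = ∫⁻ q, copiesProb Pt A q ∂m := by
  rw [joinLaw, Measure.map_apply measurable_joinCopies hA,
    Measure.compProd_apply (measurable_joinCopies hA)]
  rfl

theorem condLaw_copies_apply (hReg : S.Regularity) (hd : 1 ≤ d) {y : E × E} (hy : y.1 ∈ S.Θ)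
    [SFinite S.ν] {A : Set (Fin (M + 1) → 𝓧)} (hA : MeasurableSet A) :
    ((S.condLaw y.1 y.2 ⊗ₘ Pt.comap (fun x => (x, y.1, y.2)) (by fun_prop)).map
        fun z => (Fin.cons z.1 z.2 : Fin (M + 1) → 𝓧)) A =
      (S.normConst y.1 y.2)⁻¹ *
        ∫⁻ x, ENNReal.ofReal (S.unDensity y.1 y.2 x) * copiesProb Pt A (x, y) ∂S.ν := by
  have hm := measurable_unDensity hReg hd hy
  have : SFinite (S.condLaw y.1 y.2) := by unfold condLaw; infer_instance
  have hcp : Measurable fun x => copiesProb Pt A (x, y) :=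
    (measurable_copiesProb Pt hA).comp (f := fun x => (x, y)) (by fun_prop)
  rw [Measure.map_apply measurable_cons hA, Measure.compProd_apply (measurable_cons hA), condLaw,
    lintegral_smul_measure, smul_eq_mul]
  congr 1
  exact lintegral_withDensity_eq_lintegral_mul S.ν hm.ennreal_ofReal hcp

/-- This is the validity of the sampler written with the kernel density: the positive constant
`scale` affects neither the well-definedness of the conditional law nor the identity. -/
theorem lintegral_copiesProb_perm (hReg : S.Regularity) (hd : 1 ≤ d) (hPt : S.IsValidSampler Pt)
    {y : E × E} (hy : y.1 ∈ S.Θ) [SFinite S.ν]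
    (hN0 : ∫⁻ x, ENNReal.ofReal (S.density₀ y.1 x) *
      ENNReal.ofReal (S.kernelDensity (x, y)) ∂S.ν ≠ 0)
    (hNt : ∫⁻ x, ENNReal.ofReal (S.density₀ y.1 x) *
      ENNReal.ofReal (S.kernelDensity (x, y)) ∂S.ν ≠ ∞)
    (π : Equiv.Perm (Fin (M + 1))) {A : Set (Fin (M + 1) → 𝓧)} (hA : MeasurableSet A) :
    ∫⁻ x, ENNReal.ofReal (S.density₀ y.1 x) * ENNReal.ofReal (S.kernelDensity (x, y)) *
        copiesProb Pt ((fun x => x ∘ π) ⁻¹' A) (x, y) ∂S.ν =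
      ∫⁻ x, ENNReal.ofReal (S.density₀ y.1 x) * ENNReal.ofReal (S.kernelDensity (x, y)) *
        copiesProb Pt A (x, y) ∂S.ν := by
  have hs : ENNReal.ofReal S.scale ≠ 0 := by simpa using scale_pos hd
  have hm := measurable_unDensity hReg hd hy
  simp only [ofReal_density₀_mul hReg hd hy] at hN0 hNt ⊢
  rw [lintegral_const_mul _ hm.ennreal_ofReal] at hN0 hNt
  have hπ : Measurable fun x : Fin (M + 1) → 𝓧 => x ∘ π := by fun_prop
  have hN0' : S.normConst y.1 y.2 ≠ 0 := right_ne_zero_of_mul hN0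
  have hNt' : S.normConst y.1 y.2 ≠ ∞ := fun h => hNt (by
    rw [normConst] at h; rw [h, ENNReal.mul_top hs])
  have h1 := congrArg (fun m => m A) (hPt y.1 hy y.2 hN0' hNt' π)
  rw [Measure.map_apply hπ hA, condLaw_copies_apply Pt hReg hd hy hA,
    condLaw_copies_apply Pt hReg hd hy (hπ hA),
    ENNReal.mul_right_inj (ENNReal.inv_ne_zero.2 hNt') (ENNReal.inv_ne_top.2 hN0')] at h1
  have hcp : ∀ {B}, MeasurableSet B → Measurable fun x => copiesProb Pt B (x, y) := fun hB =>
    (measurable_copiesProb Pt hB).comp (f := fun x => (x, y)) (by fun_prop)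
  have hcpA := hcp hA
  have hcpB := hcp (hπ hA)
  simp only [mul_assoc]
  rw [lintegral_const_mul _ (by fun_prop), lintegral_const_mul _ (by fun_prop), h1]

/-- The law of `(x, θ, g)` when `(θ, g)` has density `c` on `G` and `x` given `(θ, g)` has the
plug-in distribution. -/
def plugInMeasure (S : Setup 𝓧 d p) (c : E × E → ℝ≥0∞) (G : Set (E × E)) : Measure (𝓧 × E × E) :=
  (S.ν.prod (S.pairMeasure.restrict G)).withDensity fun q =>
    ENNReal.ofReal (S.density₀ q.2.1 q.1) * ENNReal.ofReal (S.kernelDensity q) *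
      (c q.2 / ∫⁻ x, ENNReal.ofReal (S.density₀ q.2.1 x) *
        ENNReal.ofReal (S.kernelDensity (x, q.2)) ∂S.ν)

theorem measurable_density₀_swap (hReg : S.Regularity) :
    Measurable fun q : 𝓧 × E × E => S.density₀ q.2.1 q.1 :=
  (measurable_density₀ hReg).comp (f := fun q : 𝓧 × E × E => (q.2.1, q.1)) (by fun_prop)

theorem lintegral_plugInMeasure (hReg : S.Regularity) [SFinite S.ν] {c : E × E → ℝ≥0∞}
    (hc : Measurable c) (G : Set (E × E)) {h : 𝓧 × E × E → ℝ≥0∞} (hh : Measurable h) :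
    ∫⁻ q, h q ∂plugInMeasure S c G =
      ∫⁻ y in G, ∫⁻ x, ENNReal.ofReal (S.density₀ y.1 x) * ENNReal.ofReal (S.kernelDensity (x, y)) *
        (c y / ∫⁻ x, ENNReal.ofReal (S.density₀ y.1 x) *
          ENNReal.ofReal (S.kernelDensity (x, y)) ∂S.ν) * h (x, y) ∂S.ν ∂S.pairMeasure := by
  have hf := measurable_density₀_swap hReg
  have hk := measurable_kernelDensity hReg
  have hN : Measurable fun y : E × E => ∫⁻ x, ENNReal.ofReal (S.density₀ y.1 x) *
      ENNReal.ofReal (S.kernelDensity (x, y)) ∂S.ν :=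
    Measurable.lintegral_prod_left' (f := fun q : 𝓧 × E × E =>
      ENNReal.ofReal (S.density₀ q.2.1 q.1) * ENNReal.ofReal (S.kernelDensity q)) (by fun_prop)
  have hN' : Measurable fun q : 𝓧 × E × E => ∫⁻ x, ENNReal.ofReal (S.density₀ q.2.1 x) *
      ENNReal.ofReal (S.kernelDensity (x, q.2)) ∂S.ν := hN.comp measurable_snd
  have hw := (hf.ennreal_ofReal.mul hk.ennreal_ofReal).mul ((hc.comp measurable_snd).div hN')
  have h1 := lintegral_withDensity_eq_lintegral_mul (S.ν.prod (S.pairMeasure.restrict G)) hw hh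
  have h2 := lintegral_prod_symm (μ := S.ν) (ν := S.pairMeasure.restrict G) _
    (hw.mul hh).aemeasurable
  exact h1.trans h2

instance [SFinite S.ν] (c : E × E → ℝ≥0∞) (G : Set (E × E)) : SFinite (plugInMeasure S c G) := by
  unfold plugInMeasure; infer_instance

/-- A mixture over (θ, g) in `G` of exchangeable laws. -/
theorem isExchangeable_joinLaw_plugIn (hReg : S.Regularity) (hd : 1 ≤ d)
    (hPt : S.IsValidSampler Pt) [SFinite S.ν] {c : E × E → ℝ≥0∞} (hc : Measurable c)
    {G : Set (E × E)} (hG : MeasurableSet G) (hGΘ : ∀ y ∈ G, y.1 ∈ S.Θ)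
    (hN0 : ∀ y ∈ G, ∫⁻ x, ENNReal.ofReal (S.density₀ y.1 x) *
      ENNReal.ofReal (S.kernelDensity (x, y)) ∂S.ν ≠ 0)
    (hNt : ∀ y ∈ G, ∫⁻ x, ENNReal.ofReal (S.density₀ y.1 x) *
      ENNReal.ofReal (S.kernelDensity (x, y)) ∂S.ν ≠ ∞) :
    IsExchangeable (joinLaw Pt (plugInMeasure S c G)) := by
  intro π
  have hπ : Measurable fun x : Fin (M + 1) → 𝓧 => x ∘ π := by fun_prop
  ext A hA
  rw [Measure.map_apply hπ hA, joinLaw_apply Pt _ hA, joinLaw_apply Pt _ (hπ hA),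
    lintegral_plugInMeasure hReg hc _ (measurable_copiesProb Pt hA),
    lintegral_plugInMeasure hReg hc _ (measurable_copiesProb Pt (hπ hA))]
  refine setLIntegral_congr_fun hG fun y hy => ?_
  have h1 := lintegral_copiesProb_perm Pt hReg hd hPt (hGΘ y hy) (hN0 y hy) (hNt y hy) π hA
  have hf := measurable_density₀_right hReg y.1
  have hk := measurable_kernelDensity_left hReg y
  have h2 : ∀ {B}, MeasurableSet B → ∀ a : ℝ≥0∞,
      ∫⁻ x, ENNReal.ofReal (S.density₀ y.1 x) * ENNReal.ofReal (S.kernelDensity (x, y)) * a *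
        copiesProb Pt B (x, y) ∂S.ν =
      a * ∫⁻ x, ENNReal.ofReal (S.density₀ y.1 x) * ENNReal.ofReal (S.kernelDensity (x, y)) *
        copiesProb Pt B (x, y) ∂S.ν := fun {B} hB a => by
    have : Measurable fun x => copiesProb Pt B (x, y) :=
      (measurable_copiesProb Pt hB).comp (f := fun x => (x, y)) (by fun_prop)
    rw [← lintegral_const_mul _ (by fun_prop)]
    refine lintegral_congr fun x => by ring
  rw [h2 (hπ hA), h2 hA, h1]

end Sampler

/-! ### Comparing the true law with the plug-in law -/

variable (S) in
/-- The event that the solver succeeds with output in `G`. -/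
def successIn (G : Set (E × E)) : Set (𝓧 × E) :=
  S.success ∩ {z | (S.θhat z.1 z.2, S.ghat z.1 z.2) ∈ G}

theorem measurableSet_successIn (hReg : S.Regularity) {G : Set (E × E)} (hG : MeasurableSet G) :
    MeasurableSet (S.successIn G) :=
  (measurableSet_success hReg).inter (measurable_hat hReg hG)

theorem setLIntegral_successIn (hReg : S.Regularity) (hd : 1 ≤ d) {θ₀ : E} (hθ₀ : θ₀ ∈ S.Θ)
    {φ : 𝓧 × E × E → ℝ≥0∞} (hφ : Measurable φ) {G : Set (E × E)} (hG : MeasurableSet G) :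
    ∫⁻ z in S.successIn G, φ (z.1, S.θhat z.1 z.2, S.ghat z.1 z.2) ∂((S.P θ₀).prod (noise d)) =
      ∫⁻ y in G, ∫⁻ x, ENNReal.ofReal (S.f θ₀ x) * ENNReal.ofReal (S.kernelDensity (x, y)) *
        φ (x, y) ∂S.ν ∂S.pairMeasure := by
  have hG' : MeasurableSet (Prod.snd ⁻¹' G : Set (𝓧 × E × E)) := measurable_snd hG
  have h1 := setLIntegral_success hReg hd hθ₀ (hφ.indicator hG')
  have h2 : ∀ z : 𝓧 × E, (Prod.snd ⁻¹' G).indicator φ (z.1, S.θhat z.1 z.2, S.ghat z.1 z.2) =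
      {z : 𝓧 × E | (S.θhat z.1 z.2, S.ghat z.1 z.2) ∈ G}.indicator
        (fun z => φ (z.1, S.θhat z.1 z.2, S.ghat z.1 z.2)) z := fun z => rfl
  simp only [h2] at h1
  have h3 : MeasurableSet {z : 𝓧 × E | (S.θhat z.1 z.2, S.ghat z.1 z.2) ∈ G} :=
    measurable_hat hReg hG
  rw [setLIntegral_indicator h3, Set.inter_comm] at h1
  refine h1.trans ?_
  rw [← lintegral_indicator hG]
  refine lintegral_congr fun y => ?_
  by_cases hy : y ∈ G
  · simp [hy, Set.indicator]
  · simp [hy, Set.indicator]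

/-- The envelope is nonnegative, so 1 ≤ E[exp Fu] ≤ exp ε. -/
theorem HessianConcentration.nonneg {r ε : E → ℝ} (hHess : S.HessianConcentration r ε)
    (hReg : S.Regularity) {θ₀ : E} (hθ₀ : θ₀ ∈ S.Θ) : 0 ≤ ε θ₀ := by
  obtain ⟨Fu, Fl, hFu, hFl, hFlint, hFuint, hF⟩ := exists_envelopes hReg hHess hθ₀
  have := hReg.isProbabilityMeasure θ₀ hθ₀
  have h1 : (1 : ℝ≥0∞) ≤ ENNReal.ofReal (Real.exp (ε θ₀)) := by
    refine le_trans ?_ hFuint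
    calc (1 : ℝ≥0∞) = ∫⁻ _, 1 ∂S.P θ₀ := by simp
      _ ≤ _ := lintegral_mono fun x => one_le_exp_coe _
  rwa [ENNReal.one_le_ofReal, Real.one_le_exp_iff] at h1

/-- Replacing the true parameter by its estimate in the conditional distribution of the data
changes the joint law by little. -/
theorem exists_plugIn_comparison (hReg : S.Regularity) (hd : 1 ≤ d) {r ε : E → ℝ}
    (hHess : S.HessianConcentration r ε) {θ₀ : E} (hθ₀ : θ₀ ∈ S.Θ) (hr : 0 ≤ r θ₀)
    (ht : S.σ * r θ₀ ≤ 1 / 3) :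
    ∃ G : Set (E × E), MeasurableSet G ∧ (∀ y ∈ G, y.1 ∈ S.Θ) ∧
      (∀ y ∈ G, ∫⁻ x, ENNReal.ofReal (S.density₀ y.1 x) *
        ENNReal.ofReal (S.kernelDensity (x, y)) ∂S.ν ≠ 0) ∧
      (∀ y ∈ G, ∫⁻ x, ENNReal.ofReal (S.density₀ y.1 x) *
        ENNReal.ofReal (S.kernelDensity (x, y)) ∂S.ν ≠ ∞) ∧
      ((S.P θ₀).prod (noise d)) (S.successIn {y | y.1 ∈ S.Θ ∧ ‖y.1 - θ₀‖ ≤ r θ₀}) =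
        ((S.P θ₀).prod (noise d)) (S.successIn G) ∧
      ∀ h : 𝓧 × E × E → ℝ≥0∞, Measurable h → (∀ q, h q ≤ 1) →
        ∫⁻ y in G, ∫⁻ x, ENNReal.ofReal (S.f θ₀ x) * ENNReal.ofReal (S.kernelDensity (x, y)) *
            h (x, y) ∂S.ν ∂S.pairMeasure ≤
          (∫⁻ y in G, ∫⁻ x, ENNReal.ofReal (S.density₀ y.1 x) *
            ENNReal.ofReal (S.kernelDensity (x, y)) *
            ((∫⁻ x, ENNReal.ofReal (S.f θ₀ x) * ENNReal.ofReal (S.kernelDensity (x, y)) ∂S.ν) /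
              ∫⁻ x, ENNReal.ofReal (S.density₀ y.1 x) *
                ENNReal.ofReal (S.kernelDensity (x, y)) ∂S.ν) * h (x, y) ∂S.ν ∂S.pairMeasure) +
          ENNReal.ofReal (3 * S.σ * r θ₀ + ε θ₀) := by
  obtain ⟨Fu, Fl, hFu, hFl, hFlint, hFuint, hF⟩ := exists_envelopes hReg hHess hθ₀
  have := sigmaFinite_ν hReg hθ₀
  have := hReg.isProbabilityMeasure θ₀ hθ₀
  set e := ε θ₀
  set ρ := r θ₀
  set t := S.σ * ρ with htdef
  have ht0 : 0 ≤ t := mul_nonneg S.σ_pos.le hr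
  set Pn := (S.P θ₀).prod (noise d) with hPn
  have he : 0 ≤ e := hHess.nonneg hReg hθ₀
  let f₀ : 𝓧 → ℝ≥0∞ := fun x => ENNReal.ofReal (S.f θ₀ x)
  let f₁ : 𝓧 × E × E → ℝ≥0∞ := fun q => ENNReal.ofReal (S.density₀ q.2.1 q.1)
  let κ : 𝓧 × E × E → ℝ≥0∞ := fun q => ENNReal.ofReal (S.kernelDensity q)
  -- `A` and `b` are the factors of `density_mul_le` at x' and x. Along the true run `noiseOf`
  -- returns W, so their moments factor through the independent X and W.
  let A : 𝓧 × E × E → ℝ≥0∞ := fun q => ENNReal.ofReal (Real.exp (t * ‖S.noiseOf q.1 q.2‖)) *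
    EReal.exp ((Fu q.1 / 2 : ℝ≥0∞) : EReal)
  let b : 𝓧 × E × E → ℝ≥0∞ := fun q => ENNReal.ofReal (t * ‖S.noiseOf q.1 q.2‖) + Fl q.1 / 2
  let c : E × E → ℝ≥0∞ := fun y => ∫⁻ x, f₀ x * κ (x, y) ∂S.ν
  let Z : E × E → ℝ≥0∞ := fun y => ∫⁻ x, f₀ x * κ (x, y) * A (x, y) ∂S.ν
  have hFu2 : Measurable fun x => EReal.exp ((Fu x / 2 : ℝ≥0∞) : EReal) :=
    EReal.measurable_exp.comp (hFu.div_const _).coe_ereal_ennreal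
  have hnoise := measurable_noiseOf hReg
  have hf₀ : Measurable f₀ := (hReg.measurable_density θ₀ hθ₀).ennreal_ofReal
  have hf₁ : Measurable f₁ := (measurable_density₀_swap hReg).ennreal_ofReal
  have hκ : Measurable κ := (measurable_kernelDensity hReg).ennreal_ofReal
  have hA : Measurable A :=
    (Real.measurable_exp.comp (hnoise.norm.const_mul t)).ennreal_ofReal.mul
      (hFu2.comp measurable_fst)
  have hb : Measurable b := (hnoise.norm.const_mul t).ennreal_ofReal.add
      ((hFl.div_const _).comp measurable_fst)
  have hcm : Measurable c :=
    Measurable.lintegral_prod_left' (f := fun q : 𝓧 × E × E => f₀ q.1 * κ q) (by fun_prop)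
  have hZm : Measurable Z :=
    Measurable.lintegral_prod_left' (f := fun q : 𝓧 × E × E => f₀ q.1 * κ q * A q) (by fun_prop)
  have hf₀0 : ∀ x, f₀ x ≠ 0 := fun x => by simpa [f₀] using hReg.density_pos θ₀ hθ₀ x
  have hf₀t : ∀ x, f₀ x ≠ ∞ := fun x => ENNReal.ofReal_ne_top
  have hA1 : ∀ q, 1 ≤ A q := fun q => by
    refine one_le_mul ?_ (one_le_exp_coe _)
    rw [ENNReal.one_le_ofReal, Real.one_le_exp_iff]
    positivity
  have hAint : ∫⁻ z, A (z.1, S.θhat z.1 z.2, S.ghat z.1 z.2) ∂Pn ≤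
      ENNReal.ofReal (Real.exp (5 / 4 * t + e / 2)) := by
    have h1 : ∀ z : 𝓧 × E, A (z.1, S.θhat z.1 z.2, S.ghat z.1 z.2) =
        EReal.exp ((Fu z.1 / 2 : ℝ≥0∞) : EReal) * ENNReal.ofReal (Real.exp (t * ‖z.2‖)) :=
      fun z => by simp only [A]; rw [noiseOf_hat hReg, mul_comm]
    simp only [h1]
    rw [hPn, lintegral_prod_mul (f := fun x => EReal.exp ((Fu x / 2 : ℝ≥0∞) : EReal))
      (g := fun w => ENNReal.ofReal (Real.exp (t * ‖w‖))) hFu2.aemeasurable (by fun_prop),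
      add_comm, Real.exp_add, ENNReal.ofReal_mul (by positivity)]
    exact mul_le_mul' (lintegral_exp_half_le hFu hFuint) (lintegral_exp_norm_noise_le hd ht0 ht)
  have hbint : ∫⁻ z, b (z.1, S.θhat z.1 z.2, S.ghat z.1 z.2) ∂Pn ≤
      ENNReal.ofReal (5 / 4 * t + e / 2) := by
    have h1 : ∀ z : 𝓧 × E, b (z.1, S.θhat z.1 z.2, S.ghat z.1 z.2) =
        ENNReal.ofReal (t * ‖z.2‖) + Fl z.1 / 2 :=
      fun z => by simp only [b]; rw [noiseOf_hat hReg]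
    simp only [h1]
    rw [lintegral_add_left (by fun_prop), ENNReal.ofReal_add (by positivity) (by positivity)]
    refine add_le_add ?_ ?_
    · rw [hPn, lintegral_prod _ (by fun_prop)]
      simpa using lintegral_norm_noise_le hd ht0 ht
    · rw [hPn, lintegral_prod _ (by fun_prop)]
      simp only [lintegral_const, measure_univ, mul_one, div_eq_mul_inv]
      rw [lintegral_mul_const _ hFl, ENNReal.ofReal_mul he, ENNReal.ofReal_inv_of_pos two_pos,
        ENNReal.ofReal_ofNat]
      gcongr
  have hint : ∀ {G}, MeasurableSet G → ∀ {φ : 𝓧 × E × E → ℝ≥0∞}, Measurable φ →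
      ∫⁻ y in G, ∫⁻ x, f₀ x * κ (x, y) * φ (x, y) ∂S.ν ∂S.pairMeasure =
        ∫⁻ z in S.successIn G, φ (z.1, S.θhat z.1 z.2, S.ghat z.1 z.2) ∂Pn :=
    fun hG _ hφ => (setLIntegral_successIn hReg hd hθ₀ hφ hG).symm
  have hcint : ∀ {G}, MeasurableSet G → ∫⁻ y in G, c y ∂S.pairMeasure = Pn (S.successIn G) :=
    fun {G} hG => by simpa [c] using hint hG (φ := fun _ => 1) measurable_const
  set C : Set (E × E) := {y | y.1 ∈ S.Θ ∧ ‖y.1 - θ₀‖ ≤ ρ} with hCdef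
  have hC : MeasurableSet C := (measurable_fst (measurableSet_Θ hReg)).inter
    (measurableSet_le (f := fun y : E × E => ‖y.1 - θ₀‖) (by fun_prop) measurable_const)
  -- What is removed from `C` carries no mass of (θ̂, ĝ): `c` and `Z` have finite integrals over
  -- `C`, and `c` is the density of that pair.
  let G : Set (E × E) := C ∩ {y | c y ≠ 0 ∧ c y ≠ ∞ ∧ Z y ≠ ∞}
  have hG : MeasurableSet G := hC.inter
    ((hcm (measurableSet_singleton 0)).compl.inter
      ((hcm (measurableSet_singleton ∞)).compl.inter (hZm (measurableSet_singleton ∞)).compl))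
  have hZC : ∫⁻ y in C, Z y ∂S.pairMeasure ≠ ∞ := by
    have h1 : ∫⁻ y in C, Z y ∂S.pairMeasure = _ := hint hC hA
    rw [h1]
    exact ((setLIntegral_le_lintegral _ _).trans_lt (hAint.trans_lt ENNReal.ofReal_lt_top)).ne
  have hcC : ∫⁻ y in C, c y ∂S.pairMeasure ≠ ∞ := by
    rw [hcint hC]; exact measure_ne_top _ _
  have hGC : ∫⁻ y in C, c y ∂S.pairMeasure = ∫⁻ y in G, c y ∂S.pairMeasure := by
    rw [← lintegral_indicator hC, ← lintegral_indicator hG]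
    refine lintegral_congr_ae ?_
    filter_upwards [(ae_restrict_iff' hC).1 (ae_lt_top hZm hZC),
      (ae_restrict_iff' hC).1 (ae_lt_top hcm hcC)] with y hy1 hy2
    by_cases hy : y ∈ C
    · by_cases hy0 : c y = 0
      · simp [Set.indicator, hy0]
      · have hyG : y ∈ G := ⟨hy, hy0, (hy2 hy).ne, (hy1 hy).ne⟩
        rw [Set.indicator_of_mem hy, Set.indicator_of_mem hyG]
    · rw [Set.indicator_of_notMem hy, Set.indicator_of_notMem fun h => hy h.1]
  have hf₁0 : ∀ x, ∀ y ∈ G, f₁ (x, y) ≠ 0 := fun x y hy => by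
    simp only [f₁]
    rw [density₀_of_mem hy.1.1]
    simpa using hReg.density_pos _ hy.1.1 x
  have hN0 : ∀ y ∈ G, ∫⁻ x, f₁ (x, y) * κ (x, y) ∂S.ν ≠ 0 := fun y hy h0 => by
    rw [lintegral_eq_zero_iff (by fun_prop)] at h0
    refine hy.2.1 ?_
    simp only [c]
    rw [lintegral_eq_zero_iff (by fun_prop)]
    filter_upwards [h0] with x hx
    have hx' : κ (x, y) = 0 := (mul_eq_zero.1 hx).resolve_left (hf₁0 x y hy)
    simp [hx']
  have hpair : ∀ x x', ∀ y ∈ G, b (x, y) ≠ ∞ → f₁ (x', y) * f₀ x ≤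
      f₀ x' * A (x', y) * (f₁ (x, y) * ENNReal.ofReal (Real.exp (b (x, y)).toReal)) := by
    intro x x' y hy hbt
    have hl2 : Fl x / 2 ≠ ∞ := (ENNReal.add_ne_top.1 hbt).2
    have hl : Fl x ≠ ∞ := fun h => hl2 (by rw [h, ENNReal.top_div_of_ne_top (by simp)])
    by_cases hu : Fu x' = ∞
    · have hAt : A (x', y) = ∞ := by
        simp only [A, hu]
        rw [ENNReal.top_div_of_ne_top (by simp), EReal.coe_ennreal_top, EReal.exp_top,
          ENNReal.mul_top (by simp [Real.exp_pos])]
      rw [hAt, ENNReal.mul_top (hf₀0 x'), ENNReal.top_mul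
        (mul_ne_zero (hf₁0 x y hy) (by simp [Real.exp_pos]))]
      exact le_top
    · have hbr : (b (x, y)).toReal = t * ‖S.noiseOf x y‖ + (Fl x).toReal / 2 := by
        simp only [b]
        rw [ENNReal.toReal_add ENNReal.ofReal_ne_top hl2, ENNReal.toReal_ofReal (by positivity),
          ENNReal.toReal_div]
        simp
      have hAr : A (x', y) =
          ENNReal.ofReal (Real.exp (t * ‖S.noiseOf x' y‖ + (Fu x').toReal / 2)) := by
        simp only [A]
        rw [exp_coe_half _ hu, ← ENNReal.ofReal_mul (by positivity), ← Real.exp_add]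
      have hp := hReg.density_pos _ hy.1.1
      have hp₀ := hReg.density_pos _ hθ₀
      rw [hbr, hAr]
      simp only [f₁, f₀, density₀_of_mem hy.1.1]
      rw [← ENNReal.ofReal_mul (hp _).le, ← ENNReal.ofReal_mul (hp₀ _).le,
        ← ENNReal.ofReal_mul (hp _).le,
        ← ENNReal.ofReal_mul (mul_nonneg (hp₀ _).le (Real.exp_pos _).le)]
      refine ENNReal.ofReal_le_ofReal ?_
      exact density_mul_le hReg hθ₀ hy.1.1 hy.1.2 (hF x x' hu hl)
  have hNt : ∀ y ∈ G, ∫⁻ x, f₁ (x, y) * κ (x, y) ∂S.ν ≠ ∞ := fun y hy => by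
    -- One data value with finite `Fl` suffices: the pairwise inequality there, integrated over x',
    -- bounds the normalizing constant by a finite multiple of `Z y`.
    obtain ⟨x, hx⟩ := (ae_lt_top hFl (hFlint.trans_lt ENNReal.ofReal_lt_top).ne).exists
    have hbx : b (x, y) ≠ ∞ :=
      ENNReal.add_ne_top.2 ⟨ENNReal.ofReal_ne_top, (ENNReal.div_lt_top hx.ne (by simp)).ne⟩
    have h1 : (∫⁻ x', f₁ (x', y) * κ (x', y) ∂S.ν) * f₀ x ≤
        Z y * (f₁ (x, y) * ENNReal.ofReal (Real.exp (b (x, y)).toReal)) := by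
      simp only [Z]
      rw [← lintegral_mul_const _ (by fun_prop), ← lintegral_mul_const _ (by fun_prop)]
      refine lintegral_mono fun x' => ?_
      calc f₁ (x', y) * κ (x', y) * f₀ x = κ (x', y) * (f₁ (x', y) * f₀ x) := by ring
        _ ≤ κ (x', y) * (f₀ x' * A (x', y) *
            (f₁ (x, y) * ENNReal.ofReal (Real.exp (b (x, y)).toReal))) :=
          mul_le_mul' le_rfl (hpair x x' y hy hbx)
        _ = _ := by ring
    intro h
    rw [h, ENNReal.top_mul (hf₀0 x), top_le_iff] at h1
    exact ENNReal.mul_ne_top hy.2.2.2 (ENNReal.mul_ne_top ENNReal.ofReal_ne_top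
      ENNReal.ofReal_ne_top) h1
  refine ⟨G, hG, fun y hy => hy.1.1, hN0, hNt, ?_, ?_⟩
  · rw [← hcint hC, ← hcint hG, hGC]
  intro h hh hh1
  -- Since A ≥ 1 off the event as well, E[A; G] + P(Gᶜ) ≤ E[A].
  have hAK : ∫⁻ y in G, Z y ∂S.pairMeasure + 1 ≤
      ENNReal.ofReal (Real.exp (5 / 4 * t + e / 2)) + ∫⁻ y in G, c y ∂S.pairMeasure := by
    have hD := measurableSet_successIn hReg hG
    have hZG : ∫⁻ y in G, Z y ∂S.pairMeasure = _ := hint hG hA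
    have h1 : (1 : ℝ≥0∞) = Pn (S.successIn G)ᶜ + Pn (S.successIn G) := by
      rw [add_comm, prob_add_prob_compl hD]
    rw [hZG, hcint hG, h1, ← add_assoc]
    refine add_le_add (le_trans ?_ hAint) le_rfl
    rw [← lintegral_add_compl (fun z => A (z.1, S.θhat z.1 z.2, S.ghat z.1 z.2)) (μ := Pn) hD]
    refine add_le_add le_rfl ?_
    rw [← setLIntegral_one]
    exact lintegral_mono fun z => hA1 _
  have hmain := setLIntegral_le_plugIn (lam := S.pairMeasure) hf₀ hf₁ hκ hA hb hf₀0 hf₀t hA1 hG hf₁0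
    (fun x y _ => ENNReal.ofReal_ne_top) (fun y hy => hy.2.1) (fun y hy => hy.2.2.1) hN0 hNt
    (fun y hy => hy.2.2.2) hpair (B := ENNReal.ofReal (5 / 4 * t + e / 2))
    (K := Real.exp (5 / 4 * t + e / 2)) (Real.one_le_exp_iff.2 (by positivity))
    ((hint hG hb).trans_le ((setLIntegral_le_lintegral _ _).trans hbint))
    ((hcint hG).trans_le prob_le_one) hAK hh hh1
  refine hmain.trans (add_le_add le_rfl ?_)
  -- The bound on E[b] and log K are both (5/4)t + e/2; they add up to (5/2)t + e ≤ 3t + e.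
  rw [Real.log_exp, ← ENNReal.ofReal_add (by positivity) (by positivity)]
  refine ENNReal.ofReal_le_ofReal ?_
  rw [mul_assoc, ← htdef]
  linarith

/-! ### The law produced by the procedure -/

variable
  {Pt : Kernel (𝓧 × EuclideanSpace ℝ (Fin d) × EuclideanSpace ℝ (Fin d)) (Fin M → 𝓧)}
  {θ₀ : EuclideanSpace ℝ (Fin d)} {Ω : Type*} [MeasurableSpace Ω] {μ : Measure Ω}
  {X : Ω → 𝓧} {W : Ω → EuclideanSpace ℝ (Fin d)} {Xt : Ω → Fin M → 𝓧}

theorem IsRun.measurable_vector (hRun : S.IsRun Pt θ₀ μ X W Xt) :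
    Measurable fun ω => (Fin.cons (X ω) (Xt ω) : Fin (M + 1) → 𝓧) :=
  measurable_cons.comp (f := fun ω => (X ω, Xt ω))
    (hRun.measurable_data.prodMk hRun.measurable_copies)

/-- The joint law of the data and the copies on the event that the solver succeeds with output
in `G`. -/
theorem IsRun.measure_vector_successIn [IsProbabilityMeasure μ] [IsMarkovKernel Pt]
    (hRun : S.IsRun Pt θ₀ μ X W Xt)
    (hReg : S.Regularity) (hd : 1 ≤ d) (hθ₀ : θ₀ ∈ S.Θ) {G : Set (E × E)} (hG : MeasurableSet G)
    {A : Set (Fin (M + 1) → 𝓧)} (hA : MeasurableSet A) :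
    μ {ω | (Fin.cons (X ω) (Xt ω) : Fin (M + 1) → 𝓧) ∈ A ∧ (X ω, W ω) ∈ S.successIn G} =
      ∫⁻ y in G, ∫⁻ x, ENNReal.ofReal (S.f θ₀ x) * ENNReal.ofReal (S.kernelDensity (x, y)) *
        copiesProb Pt A (x, y) ∂S.ν ∂S.pairMeasure := by
  have hXW : Measurable fun ω => (X ω, W ω) := hRun.measurable_data.prodMk hRun.measurable_noise
  have hhat : Measurable fun z : 𝓧 × E => (z.1, S.θhat z.1 z.2, S.ghat z.1 z.2) :=
    measurable_fst.prodMk (measurable_hat hReg)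
  have hY : Measurable fun ω => (X ω, S.θhat (X ω) (W ω), S.ghat (X ω) (W ω)) := hhat.comp hXW
  have hcp := measurable_copiesProb Pt hA
  set D : Set Ω := {ω | S.IsSSOSP (S.θhat (X ω) (W ω)) (X ω) (W ω)} with hDdef
  have hD : MeasurableSet D := hXW (measurableSet_success hReg)
  have hG' : MeasurableSet {q : 𝓧 × E × E | q.2 ∈ G} := measurable_snd hG
  set T : Set ((𝓧 × E × E) × (Fin M → 𝓧)) := {z | joinCopies z ∈ A ∧ z.1.2 ∈ G} with hTdef
  have hT : MeasurableSet T := (measurable_joinCopies hA).inter (measurable_fst hG')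
  have h1 := congrArg (fun m => m T) hRun.copies_of_SSOSP
  rw [Measure.map_apply (hY.prodMk hRun.measurable_copies) hT,
    Measure.restrict_apply ((hY.prodMk hRun.measurable_copies) hT),
    Measure.compProd_apply hT] at h1
  have h2 : ∀ q, Pt q (Prod.mk q ⁻¹' T) =
      {q : 𝓧 × E × E | q.2 ∈ G}.indicator (copiesProb Pt A) q := fun q => by
    by_cases hq : q.2 ∈ G
    · rw [Set.indicator_of_mem (by exact hq), copiesProb]
      congr 1
      ext xt
      simp [hTdef, hq, joinCopies]
    · rw [Set.indicator_of_notMem (by exact hq)]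
      simp [hTdef, hq]
  simp only [h2] at h1
  rw [lintegral_map (hcp.indicator hG') hY] at h1
  have h3 : ∫⁻ ω in D, {q : 𝓧 × E × E | q.2 ∈ G}.indicator (copiesProb Pt A)
      (X ω, S.θhat (X ω) (W ω), S.ghat (X ω) (W ω)) ∂μ =
      ∫⁻ z in S.successIn G, copiesProb Pt A (z.1, S.θhat z.1 z.2, S.ghat z.1 z.2)
        ∂((S.P θ₀).prod (noise d)) := by
    rw [← hRun.law_data_noise, setLIntegral_map (measurableSet_successIn hReg hG)
      (f := fun z => copiesProb Pt A (z.1, S.θhat z.1 z.2, S.ghat z.1 z.2)) (hcp.comp hhat) hXW,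
      ← lintegral_indicator hD,
      ← lintegral_indicator (hXW (measurableSet_successIn hReg hG))]
    refine lintegral_congr fun ω => ?_
    by_cases h : ω ∈ D
    · rw [Set.indicator_of_mem h]
      by_cases h' : (S.θhat (X ω) (W ω), S.ghat (X ω) (W ω)) ∈ G
      · rw [Set.indicator_of_mem (by exact h'), Set.indicator_of_mem (by exact ⟨h, h'⟩)]
      · rw [Set.indicator_of_notMem (by exact h'),
          Set.indicator_of_notMem (by exact fun h'' => h' h''.2)]
    · rw [Set.indicator_of_notMem h, Set.indicator_of_notMem (by exact fun h'' => h h''.1)]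
  rw [h3, setLIntegral_successIn hReg hd hθ₀ hcp hG] at h1
  rw [← h1]
  congr 1
  ext ω
  exact ⟨fun h => ⟨⟨h.1, h.2.2⟩, h.2.1⟩, fun h => ⟨h.1.1, h.2, h.1.2⟩⟩

/-- On the good event `Q` keeps the law of (θ̂, ĝ) and draws the data from the plug-in conditional
law; off it, all entries equal the data. Both parts are exchangeable, the first costs 3σr + ε and
the second at most δ. -/
theorem IsRun.exists_exchangeable [IsProbabilityMeasure μ] [IsMarkovKernel Pt]
    (hRun : S.IsRun Pt θ₀ μ X W Xt) (hd : 1 ≤ d)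
    {r δ ε : EuclideanSpace ℝ (Fin d) → ℝ} (hr : ∀ θ ∈ S.Θ, 0 ≤ r θ)
    (hReg : S.Regularity) (hAcc : S.Accuracy r δ) (hHess : S.HessianConcentration r ε)
    (hPt : S.IsValidSampler Pt) (hθ₀ : θ₀ ∈ S.Θ) :
    ∃ Q : Measure (Fin (M + 1) → 𝓧), IsProbabilityMeasure Q ∧ IsExchangeable Q ∧
      ∀ A, MeasurableSet A →
        (μ.map fun ω => (Fin.cons (X ω) (Xt ω) : Fin (M + 1) → 𝓧)).real A ≤
          Q.real A + (3 * S.σ * r θ₀ + ε θ₀ + δ θ₀) := by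
  have hX := hRun.measurable_data
  have hvec := hRun.measurable_vector
  have := hReg.isProbabilityMeasure θ₀ hθ₀
  have := Measure.isProbabilityMeasure_map hvec.aemeasurable (μ := μ)
  have hσr : 0 ≤ S.σ * r θ₀ := mul_nonneg S.σ_pos.le (hr θ₀ hθ₀)
  -- Any exchangeable law serves when the bound is at least 1. Otherwise ε, δ ≥ 0 give σr < 1/3, as
  -- the Gaussian estimates require.
  by_cases hB : 1 ≤ 3 * S.σ * r θ₀ + ε θ₀ + δ θ₀
  · have hc : Measurable fun ω => (fun _ => X ω : Fin (M + 1) → 𝓧) := by fun_prop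
    refine ⟨_, Measure.isProbabilityMeasure_map hc.aemeasurable,
      isExchangeable_map_const μ hX, fun A hA => ?_⟩
    exact measureReal_le_one.trans (hB.trans (le_add_of_nonneg_left measureReal_nonneg))
  push Not at hB
  have hε := hHess.nonneg hReg hθ₀
  have hδ : 0 ≤ δ θ₀ := by
    have h1 := hAcc θ₀ hθ₀
    have h2 := measureReal_le_one (μ := (S.P θ₀).prod (noise d))
      (s := {z | S.IsSSOSP (S.θhat z.1 z.2) z.1 z.2 ∧ ‖S.θhat z.1 z.2 - θ₀‖ ≤ r θ₀})
    linarith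
  have := sigmaFinite_ν hReg hθ₀
  obtain ⟨G, hG, hGΘ, hN0, hNt, hCG, hcomp⟩ := exists_plugIn_comparison hReg hd hHess hθ₀
    (hr θ₀ hθ₀) (by rw [mul_assoc] at hB; linarith)
  have hf₀ := hReg.measurable_density θ₀ hθ₀
  have hk := measurable_kernelDensity hReg
  have hXW : Measurable fun ω => (X ω, W ω) := hX.prodMk hRun.measurable_noise
  have hD := measurableSet_successIn hReg hG
  set D : Set Ω := {ω | (X ω, W ω) ∈ S.successIn G} with hDdef
  have hDm : MeasurableSet D := hXW hD
  set c : E × E → ℝ≥0∞ := fun y =>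
    ∫⁻ x, ENNReal.ofReal (S.f θ₀ x) * ENNReal.ofReal (S.kernelDensity (x, y)) ∂S.ν with hc
  have hcm : Measurable c := Measurable.lintegral_prod_left' (f := fun q : 𝓧 × E × E =>
    ENNReal.ofReal (S.f θ₀ q.1) * ENNReal.ofReal (S.kernelDensity q)) (by fun_prop)
  have hμD : μ D = ((S.P θ₀).prod (noise d)) (S.successIn G) := by
    rw [← hRun.law_data_noise, Measure.map_apply hXW hD]
    rfl
  have hμDc : μ Dᶜ ≤ ENNReal.ofReal (δ θ₀) := by
    have h1 := hAcc θ₀ hθ₀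
    have h2 : {z | S.IsSSOSP (S.θhat z.1 z.2) z.1 z.2 ∧ ‖S.θhat z.1 z.2 - θ₀‖ ≤ r θ₀} ⊆
        S.successIn {y | y.1 ∈ S.Θ ∧ ‖y.1 - θ₀‖ ≤ r θ₀} := fun z hz => ⟨hz.1, hz.1.mem, hz.2⟩
    have h3 := h1.trans (measureReal_mono h2)
    rw [measureReal_def, hCG, ← hμD, ← measureReal_def] at h3
    have h4 := probReal_compl_eq_one_sub (μ := μ) hDm
    rw [← ofReal_measureReal]
    exact ENNReal.ofReal_le_ofReal (by linarith)
  have hconst : Measurable fun ω => (fun _ => X ω : Fin (M + 1) → 𝓧) := by fun_prop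
  -- Normalizing the plug-in density for each (θ, g) preserves the marginal density `c`, so the two
  -- parts of `Q` have total mass one.
  have hmass : joinLaw Pt (plugInMeasure S c G) Set.univ = μ D := by
    rw [joinLaw_apply Pt _ MeasurableSet.univ]
    have h1 : copiesProb Pt (Set.univ : Set (Fin (M + 1) → 𝓧)) =
        fun _ : 𝓧 × E × E => (1 : ℝ≥0∞) := by
      funext q; simp [copiesProb]
    rw [h1, lintegral_plugInMeasure hReg hcm G measurable_const, hμD, ← setLIntegral_one,
      setLIntegral_successIn hReg hd hθ₀ (φ := fun _ => 1) measurable_const hG]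
    refine setLIntegral_congr_fun hG fun y hy => ?_
    have hf₁ := measurable_density₀_right hReg y.1
    have hk' := measurable_kernelDensity_left hReg y
    simp only [mul_one]
    rw [lintegral_mul_const _ (by fun_prop), ENNReal.mul_div_cancel (hN0 y hy) (hNt y hy)]
  set Q := joinLaw Pt (plugInMeasure S c G) +
    (μ.restrict Dᶜ).map fun ω => (fun _ => X ω : Fin (M + 1) → 𝓧) with hQ
  have hQ1 : IsProbabilityMeasure Q := by
    constructor
    rw [hQ, Measure.add_apply, hmass, Measure.map_apply hconst MeasurableSet.univ,
      Set.preimage_univ, Measure.restrict_apply_univ, prob_add_prob_compl hDm]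
  refine ⟨Q, hQ1, ?_, fun A hA => ?_⟩
  · exact (isExchangeable_joinLaw_plugIn Pt hReg hd hPt hcm hG hGΘ hN0 hNt).add
      (isExchangeable_map_const _ hX)
  · have hQt : Q A ≠ ∞ := measure_ne_top _ _
    have h0 : 0 ≤ 3 * S.σ * r θ₀ + ε θ₀ := by rw [mul_assoc]; positivity
    have h1 : μ.map (fun ω => (Fin.cons (X ω) (Xt ω) : Fin (M + 1) → 𝓧)) A ≤
        Q A + ENNReal.ofReal (3 * S.σ * r θ₀ + ε θ₀ + δ θ₀) := by
      rw [Measure.map_apply hvec hA]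
      calc _ ≤ μ ({ω | (Fin.cons (X ω) (Xt ω) : Fin (M + 1) → 𝓧) ∈ A ∧
              (X ω, W ω) ∈ S.successIn G} ∪ Dᶜ) := measure_mono fun ω hω => by
            by_cases h : ω ∈ D
            · exact Or.inl ⟨hω, h⟩
            · exact Or.inr h
        _ ≤ _ := measure_union_le _ _
        _ ≤ (joinLaw Pt (plugInMeasure S c G) A + ENNReal.ofReal (3 * S.σ * r θ₀ + ε θ₀)) +
            ENNReal.ofReal (δ θ₀) := by
          refine add_le_add ?_ hμDc
          rw [hRun.measure_vector_successIn hReg hd hθ₀ hG hA, joinLaw_apply Pt _ hA,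
            lintegral_plugInMeasure hReg hcm G (measurable_copiesProb Pt hA)]
          exact hcomp _ (measurable_copiesProb Pt hA) (copiesProb_le_one Pt A)
        _ ≤ _ := by
          rw [add_assoc, ← ENNReal.ofReal_add h0 hδ, hQ, Measure.add_apply]
          gcongr
          exact le_self_add
    have h2 := ENNReal.toReal_mono (ENNReal.add_ne_top.2 ⟨hQt, ENNReal.ofReal_ne_top⟩) h1
    rwa [ENNReal.toReal_add hQt ENNReal.ofReal_ne_top,
      ENNReal.toReal_ofReal (add_nonneg h0 hδ)] at h2

end Setup

end ACSS

end

theorem theorem1 {𝓧 : Type*} [MeasurableSpace 𝓧] {d p M : ℕ} (hd : 1 ≤ d)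
    (S : ACSS.Setup 𝓧 d p)
    (r δ ε : EuclideanSpace ℝ (Fin d) → ℝ) (hr : ∀ θ ∈ S.Θ, 0 ≤ r θ)
    (hReg : S.Regularity) (hAcc : S.Accuracy r δ) (hHess : S.HessianConcentration r ε)
    (Pt : Kernel (𝓧 × EuclideanSpace ℝ (Fin d) × EuclideanSpace ℝ (Fin d)) (Fin M → 𝓧))
    [IsMarkovKernel Pt] (hPt : S.IsValidSampler Pt)
    (θ₀ : EuclideanSpace ℝ (Fin d)) (hθ₀ : θ₀ ∈ S.Θ)
    {Ω : Type*} [MeasurableSpace Ω] (μ : Measure Ω) [IsProbabilityMeasure μ]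
    (X : Ω → 𝓧) (W : Ω → EuclideanSpace ℝ (Fin d)) (Xt : Ω → Fin M → 𝓧)
    (hRun : S.IsRun Pt θ₀ μ X W Xt) :
    ACSS.dExch (μ.map fun ω => (Fin.cons (X ω) (Xt ω) : Fin (M + 1) → 𝓧)) ≤
        3 * S.σ * r θ₀ + ε θ₀ + δ θ₀ ∧
      ∀ T : 𝓧 → ℝ, Measurable T → ∀ α ∈ Set.Icc (0 : ℝ) 1,
        μ.real {ω | ACSS.pval T (X ω) (Xt ω) ≤ α} ≤
          α + 3 * S.σ * r θ₀ + ε θ₀ + δ θ₀ := by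
  obtain ⟨Q, hQ, hQe, hle⟩ := hRun.exists_exchangeable hd hr hReg hAcc hHess hPt hθ₀
  have hvec := hRun.measurable_vector
  have := Measure.isProbabilityMeasure_map hvec.aemeasurable (μ := μ)
  refine ⟨(ACSS.dExch_le_tvDist _ hQ hQe).trans (ACSS.tvDist_le_of_forall_le hle),
    fun T hT α hα => ?_⟩
  -- The event is one for the vector (X, copies), so its probability exceeds its `Q`-probability, at
  -- most α, by no more than the error bound.
  obtain ⟨hm, hp⟩ := hQe.pval_le hT hα.1
  have h1 := hle _ hm
  rw [map_measureReal_apply hvec hm] at h1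
  simp only [Set.preimage_ofPred_eq, Fin.cons_zero, Fin.cons_succ] at h1
  linarith
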